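/- Let $j\ge 1$ be an integer, let $r,R>1$, and let $\mathbb A=\{z\in\mathbb C:1<|z|<r\}$, $\mathbb B=\{w\in\mathbb C:1<|w|<R\}$. **The class $\mathcal H_j(\mathbb A,\mathbb B)$.** It consists of all $f\in W^{1,2}(\mathbb A,\mathbb C)$ such that * $1\le |f|\le R$ a.e. in $\mathbb A$; * $f$ maps the inner (outer) boundary of $\mathbb A$ to the inner (outer) boundary of $\mathbb B$ in the sense of traces, i.e. $\frac1\varepsilon\int_{1<|z|<1+\varepsilon}\big||f|-1\big|\,dx\,dy\to0$ and $\frac1\varepsilon\int_{r-\varepsilon<|z|<r}\big||f|-R\big|\,dx\,dy\to0$ as $\varepsilon\to0^+$; * $f$ has degree $j$, in one of the following two senses: (a) $f$ is $C^1$ in $\mathbb A$ and, for every $w\in\mathbb B$ with $\det Df\neq0$ on $f^{-1}(w)$, the set $f^{-1}(w)$ is finite and $\sum_{z\in f^{-1}(w)}\operatorname{sign}\det Df(z)=j$; or (b) $\int_{\mathbb A}\varphi(f)\det Df\,dx\,dy=j\int_{\mathbb B}\varphi\,du\,dv$ for all $\varphi\in C_c^\infty(\mathbb B)$. The Dirichlet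 energy is $\mathcal E[f]=\int_{\mathbb A}|Df|^2\,dx\,dy$ with $|Df|^2=|f_z|^2+|f_{\bar z}|^2=\frac12(|f_x|^2+|f_y|^2)$. A *$j$-degree radial harmonic map between $\mathbb A$ and $\mathbb B$* is a harmonic map $f$ of $\mathbb A$ onto $\mathbb B$ of the form $f(te^{i\tau})=G(t)e^{ij\tau}$ with $G>0$, which maps the inner (outer) boundary to the inner (outer) boundary in the above sense. Put $$g^\circ_{r}(z)=\frac{r^jR-r^{2j}}{1-r^{2j}}\,\bar z^{-j}+\frac{1-r^jR}{1-r^{2j}}\,z^j ,\qquad r_\circ=\big(R+\sqrt{R^2-1}\big)^{1/j},\qquad \rho=\frac{r_\circ}{r},$$ $$g^\diamond(z)=\begin{cases} g^\circ_{r_\circ}(z), & 1\le|z|<r_\circ,\\ z^j/|z|^j, & \rho<|z|\le1.\end{cases}$$ **Theorem.** 1. A $j$-degree radial harmonic map between $\mathbb A$ and $\mathbb B$ exists if and only if $$R\ge\tfrac12\,r^{-j}\,(1+r^{2j}).\tag{N}$$ 2. If (N) holds, then $g^\circ=g^\circ_r$ is the only such map. It is continuous on $\overline{\mathbb A}$ and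 maps $\{|z|=1\}$ onto $\{|w|=1\}$ and $\{|z|=r\}$ onto $\{|w|=R\}$. It has degree $j$ in both senses (a) and (b), belongs to $\mathcal H_j(\mathbb A,\mathbb B)$, and minimizes $\mathcal E$ over $\mathcal H_j(\mathbb A,\mathbb B)$. 3. If (N) fails, then $\rho<1<r_\circ$ and $h(z)=g^\diamond(\rho z)$, $z\in\mathbb A$ (that is, $g^\diamond$ transplanted from $\{\rho<|z|<r_\circ\}$ to $\mathbb A$ by a dilation), belongs to $\mathcal H_j(\mathbb A,\mathbb B)$ and minimizes $\mathcal E$ over $\mathcal H_j(\mathbb A,\mathbb B)$. It has degree $j$ in both senses, extends continuously to $\overline{\mathbb A}$, and maps $\{|z|=1\}$ onto $\{|w|=1\}$ and $\{|z|=r\}$ onto $\{|w|=R\}$. It is harmonic in $\{1/\rho<|z|<r\}$, which it maps onto $\mathbb B$, and it squeezes $\{1<|z|\le1/\rho\}$ onto the inner circle by $h(z)=z^j/|z|^j$. 4. In both cases the minimizer is unique up to rotation: a map $f\in\mathcal H_j(\mathbb A,\mathbb B)$ has the minimal energy if and only if there is a constant $c$ with $|c|=1$ such that $f=c\,g^\circ$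 (respectively $f=c\,h$) a.e. in $\mathbb A$. -/

import Mathlib

open Filter Topology MeasureTheory Set
open scoped ContDiff ComplexConjugate

noncomputable section

/-- The open annulus of inner radius `a` and outer radius `b`, centred at the origin. -/
def annulus (a b : ℝ) : Set ℂ := {z | a < ‖z‖ ∧ ‖z‖ < b}

/-- `g` is the weak derivative of `f` on `X` in the direction `v`: integration by parts holds
against all smooth test functions with compact support in `X`. The directions `1` and
`Complex.I` give the partial derivatives with respect to `x` and `y`. -/
def IsWeakPartial (X : Set ℂ) (v : ℂ) (f g : ℂ → ℂ) : Prop :=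
  ∀ φ : ℂ → ℝ, ContDiff ℝ ∞ φ → HasCompactSupport φ → tsupport φ ⊆ X →
    ∫ z in X, (fderiv ℝ φ z v) • f z = - ∫ z in X, φ z • g z

/-- `f` has a square integrable weak derivative on `X` in the direction `v`. -/
def HasL2WeakPartial (X : Set ℂ) (v : ℂ) (f : ℂ → ℂ) : Prop :=
  ∃ g : ℂ → ℂ, MemLp g 2 (volume.restrict X) ∧ IsWeakPartial X v f g

/-- The Sobolev class `W^{1,2}(X, ℂ)`. -/
structure MemW12 (X : Set ℂ) (f : ℂ → ℂ) : Prop where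
  memLp : MemLp f 2 (volume.restrict X)
  partial_x : HasL2WeakPartial X 1 f
  partial_y : HasL2WeakPartial X Complex.I f

open Classical in
/-- The square integrable weak derivative of `f` on `X` in the direction `v` (for open `X` it is
unique up to a null set; the value is `0` if there is none). -/
def weakPartial (X : Set ℂ) (v : ℂ) (f : ℂ → ℂ) : ℂ → ℂ :=
  if h : HasL2WeakPartial X v f then h.choose else 0

/-- The Dirichlet energy `∫_X |Df|²`, with `|Df|² = |f_z|² + |f_{z̄}|² = (|f_x|² + |f_y|²) / 2`. -/
def dirichletEnergy (X : Set ℂ) (f : ℂ → ℂ) : ℝ :=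
  ∫ z in X, (1 / 2 : ℝ) * (‖weakPartial X 1 f z‖ ^ 2 + ‖weakPartial X Complex.I f z‖ ^ 2)

/-- The Jacobian determinant of the weak derivative. -/
def weakJacobian (X : Set ℂ) (f : ℂ → ℂ) (z : ℂ) : ℝ :=
  (weakPartial X 1 f z).re * (weakPartial X Complex.I f z).im
    - (weakPartial X 1 f z).im * (weakPartial X Complex.I f z).re

/-- Degree `j` of a continuously differentiable map from `X` to `Y`, by counting: at every regular
value `w ∈ Y` the sum of the signs of the Jacobian determinant over the preimages of `w` is `j`.
(The degree at a critical value is the limit of degrees at regular values converging to it, so it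
is `j` as well.) -/
def HasRegularDegree (X Y : Set ℂ) (f : ℂ → ℂ) (j : ℕ) : Prop :=
  ContDiffOn ℝ 1 f X ∧
    ∀ w ∈ Y, (∀ z ∈ X, f z = w → (fderiv ℝ f z).det ≠ 0) →
      {z ∈ X | f z = w}.Finite ∧
        ∑ᶠ z ∈ {z ∈ X | f z = w}, (SignType.sign (fderiv ℝ f z).det : ℤ) = (j : ℤ)

/-- Degree `j` of a `W^{1,2}` map from `X` to `Y`: the integral definition of the degree. -/
def HasSobolevDegree (X Y : Set ℂ) (f : ℂ → ℂ) (j : ℕ) : Prop :=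
  ∀ φ : ℂ → ℝ, ContDiff ℝ ∞ φ → HasCompactSupport φ → tsupport φ ⊆ Y →
    ∫ z in X, φ (f z) * weakJacobian X f z = j * ∫ w in Y, φ w

/-- The inner boundary circle of `annulus 1 r` is sent to the unit circle, in the sense of traces:
the mean of `| |f| - 1 |` over the strip of width `ε` along the inner boundary tends to `0`.
For a map that is continuous up to the boundary this says that `|f| = 1` there. -/
def InnerToInner (f : ℂ → ℂ) : Prop :=
  Tendsto (fun ε : ℝ => ε⁻¹ * ∫ z in annulus 1 (1 + ε), |‖f z‖ - 1|) (𝓝[>] 0) (𝓝 0)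

/-- The outer boundary circle of `annulus 1 r` is sent to the circle of radius `R`, in the same
sense. -/
def OuterToOuter (r R : ℝ) (f : ℂ → ℂ) : Prop :=
  Tendsto (fun ε : ℝ => ε⁻¹ * ∫ z in annulus (r - ε) r, |‖f z‖ - R|) (𝓝[>] 0) (𝓝 0)

/-- The class `H_j(𝔸, 𝔹)` of `j`-degree `W^{1,2}` maps between `𝔸 = annulus 1 r` and
`𝔹 = annulus 1 R` that send inner/outer boundary to inner/outer boundary. Values are allowed in
the closure of `𝔹`. The boundary circles are covered because the degree is not zero. -/
structure IsAdmissible (j : ℕ) (r R : ℝ) (f : ℂ → ℂ) : Prop where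
  sobolev : MemW12 (annulus 1 r) f
  range : ∀ᵐ z ∂(volume.restrict (annulus 1 r)), 1 ≤ ‖f z‖ ∧ ‖f z‖ ≤ R
  inner : InnerToInner f
  outer : OuterToOuter r R f
  degree : HasRegularDegree (annulus 1 r) (annulus 1 R) f j ∨
    HasSobolevDegree (annulus 1 r) (annulus 1 R) f j

/-- `f` is continuous on the closed annulus and maps the two boundary circles of `annulus 1 r`
onto those of `annulus 1 R`, inner onto inner and outer onto outer. -/
def IsBoundaryOnto (r R : ℝ) (f : ℂ → ℂ) : Prop :=
  ContinuousOn f {z | 1 ≤ ‖z‖ ∧ ‖z‖ ≤ r} ∧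
    f '' Metric.sphere 0 1 = Metric.sphere 0 1 ∧ f '' Metric.sphere 0 r = Metric.sphere 0 R

/-- `f` is a `j`-degree radial harmonic map between `annulus 1 r` and `annulus 1 R`: it has the
form `f (t e^{iτ}) = G t e^{ijτ}` with a positive radial profile `G`, it is harmonic, and it maps
the first annulus onto the second, inner/outer boundary to inner/outer boundary. -/
structure IsRadialHarmonicMap (j : ℕ) (r R : ℝ) (f : ℂ → ℂ) : Prop where
  radial : ∃ G : ℝ → ℝ, ∀ t : ℝ, 1 < t → t < r → 0 < G t ∧
    ∀ τ : ℝ, f (t * Complex.exp (τ * Complex.I)) = G t * Complex.exp (j * τ * Complex.I)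
  harmonic : InnerProductSpace.HarmonicOnNhd f (annulus 1 r)
  onto : f '' annulus 1 r = annulus 1 R
  inner : InnerToInner f
  outer : OuterToOuter r R f

/-- The Nitsche type bound. -/
def NitscheBound (j : ℕ) (r R : ℝ) : Prop :=
  R ≥ 1 / 2 * (r ^ j)⁻¹ * (1 + r ^ (2 * j))

/-- The harmonic map `g°`. -/
def gCirc (j : ℕ) (r R : ℝ) (z : ℂ) : ℂ :=
  (((r ^ j * R - r ^ (2 * j)) / (1 - r ^ (2 * j)) : ℝ) : ℂ) * (conj z ^ j)⁻¹
    + (((1 - r ^ j * R) / (1 - r ^ (2 * j)) : ℝ) : ℂ) * z ^ j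

/-- The critical radius `r_∘`. -/
def critRadius (j : ℕ) (R : ℝ) : ℝ := (R + √(R ^ 2 - 1)) ^ (1 / (j : ℝ))

/-- The map `g⋄` on the annulus `ρ < |z| < r_∘`, where `ρ = r_∘ / r`. -/
def gDiamond (j : ℕ) (R : ℝ) (z : ℂ) : ℂ :=
  if 1 ≤ ‖z‖ then gCirc j (critRadius j R) R z else z ^ j / (‖z‖ : ℂ) ^ j

/-- The map `g⋄` transplanted to `annulus 1 r` by the dilation `z ↦ ρ z`, `ρ = r_∘ / r`, which
maps `annulus 1 r` onto `annulus ρ r_∘`. -/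
def gDiamondScaled (j : ℕ) (r R : ℝ) (z : ℂ) : ℂ :=
  gDiamond j R (((critRadius j R / r : ℝ) : ℂ) * z)

/-- `g` minimizes the Dirichlet energy in the class `H_j`, and every other minimizer is a rotation
of `g` (maps that agree almost everywhere being identified). -/
def IsUniqueMinimizer (j : ℕ) (r R : ℝ) (g : ℂ → ℂ) : Prop :=
  IsAdmissible j r R g ∧
    ∀ f : ℂ → ℂ, IsAdmissible j r R f →
      dirichletEnergy (annulus 1 r) g ≤ dirichletEnergy (annulus 1 r) f ∧
      (dirichletEnergy (annulus 1 r) f = dirichletEnergy (annulus 1 r) g ↔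
        ∃ c : ℂ, ‖c‖ = 1 ∧ ∀ᵐ z ∂(volume.restrict (annulus 1 r)), f z = c * g z)

end

open Filter Topology MeasureTheory Set
open scoped ContDiff ComplexConjugate

noncomputable section

/-! Write τ = |z|², s = |f|², let P + iQ be conj f times the radial derivative t f_t and M + iN be
conj f times the angular derivative f_θ, and let J be the Jacobian. Then (|f_x|² + |f_y|²) τ s = P²
+ Q² + M² + N² and J τ s = PN - QM.

Minimality rests on free Lagrangians, integrals with the same value for all maps of the class. For
C¹ functions K, Z, the integral of K(s) Z'(τ) + K'(s) (P/τ) Z(τ) is π (K(R²) Z(r²) - K(1) Z(1)), by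
the fundamental theorem of calculus along rays (`AnnulusMap.integral_radial`). The integral of K(s)
(N/s) Z'(τ) + K'(s) J Z(τ) is j times the same number, by Stokes' theorem for K(s) Z(τ) d arg f, the
winding number being j (`AnnulusMap.integral_angular`).

The candidates are G(t) e^{ijθ} with t G' = j √(G² - c) for a constant c ≤ 1. Harmonic profiles are
G = a t^j + b t^{-j}, with first integral c = 4ab. With G(1) = 1 and G(r) = R, such a G stays above
1 exactly if a ≥ b, which is the bound (N). If (N) fails, take c = 1: the equation then has the
constant solution 1, which (t^j + t^{-j})/2 leaves with slope zero, so a plateau G = 1 followed by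
this curve reaches R at t = r. Both minimizers are thus instances of `RadialProfile` and are treated
together.

Given c, the energy density minus a suitable free Lagrangian is pointwise a sum of squares that
vanishes exactly when `RadialSystem` holds: P = j √(s(s - c)), N = js, M = Q = 0. The Jacobian is
weighted by √(1 - c/s) for 0 < c ≤ 1 and by the reciprocal for c < 0. For c = 0 the bound is that of
energy by area, and a second integral identity removes the remaining conformal freedom. The result
is `DegreeMap.exists_energy_bound`.

For uniqueness, the system is an equation for s along rays whose right side increases with s. As s
has the same values as G² on both boundary circles, s = G² (`AnnulusMap.normSq_eq_of_radialSystem`).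
Then f and the candidate have the same logarithmic derivatives, so their quotient is constant
(`AnnulusMap.eq_rotation_of_radialSystem`).

The analytic work is that f is merely a W^{1,2} map whose modulus has boundary values in the mean.
The identities are proved by mollification for compactly supported tests and carried to the boundary
by cutoffs; the angular one needs the Poincaré type estimate `AnnulusMap.stripVanish_mul`. The
counting degree reduces to the integral one by change of variables and Sard's theorem
(`HasRegularDegree.integral_comp_mul_det`), and the integral degree identifies the winding number
(`AnnulusMap.winding_eq`).

Existence and uniqueness of the radial harmonic map are separate: equivariance turns Laplace's
equation into an Euler equation, whose two constants are fixed by the traces. -/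

/-! ### Mollification -/

/-- A bump function supported in the ball of radius `2 / (n + 1)`. -/
def mollBump (n : ℕ) : ContDiffBump (0 : ℂ) where
  rIn := 1 / (n + 1)
  rOut := 2 / (n + 1)
  rIn_pos := by positivity
  rIn_lt_rOut := by gcongr; norm_num

/-- The mollifier kernel. -/
def mollKer (n : ℕ) : ℂ → ℝ := (mollBump n).normed volume

/-- Convolution with the mollifier kernel. -/
def mollify {E : Type*} [NormedAddCommGroup E] [NormedSpace ℝ E] (n : ℕ) (h : ℂ → E) : ℂ → E :=
  convolution (mollKer n) h (ContinuousLinearMap.lsmul ℝ ℝ) volume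

lemma mollBump_rOut_tendsto : Tendsto (fun n => (mollBump n).rOut) atTop (𝓝 0) := by
  have := (tendsto_one_div_add_atTop_nhds_zero_nat (𝕜 := ℝ)).const_mul 2
  simpa [mollBump, div_eq_mul_inv] using this

lemma mollKer_nonneg (n : ℕ) (z : ℂ) : 0 ≤ mollKer n z := (mollBump n).nonneg_normed z

lemma mollKer_contDiff (n : ℕ) : ContDiff ℝ ∞ (mollKer n) := (mollBump n).contDiff_normed

lemma mollKer_hasCompactSupport (n : ℕ) : HasCompactSupport (mollKer n) :=
  (mollBump n).hasCompactSupport_normed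

lemma mollKer_tsupport (n : ℕ) : tsupport (mollKer n) = Metric.closedBall 0 (mollBump n).rOut :=
  (mollBump n).tsupport_normed_eq

lemma integral_mollKer (n : ℕ) : ∫ z, mollKer n z = 1 := (mollBump n).integral_normed

lemma integral_mollKer_sub (n : ℕ) (x : ℂ) : ∫ t, mollKer n (x - t) = 1 := by
  rw [integral_sub_left_eq_self (fun t => mollKer n t) volume x, integral_mollKer]

lemma integrable_mollKer (n : ℕ) : Integrable (mollKer n) :=
  (mollKer_contDiff n).continuous.integrable_of_hasCompactSupport (mollKer_hasCompactSupport n)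

section
variable {E : Type*} [NormedAddCommGroup E] [NormedSpace ℝ E]

lemma mollify_apply (n : ℕ) (h : ℂ → E) (x : ℂ) :
    mollify n h x = ∫ t, mollKer n (x - t) • h t := by
  rw [mollify, convolution_eq_swap]; rfl

lemma mollify_integrand (n : ℕ) {h : ℂ → E} (hh : LocallyIntegrable h) (x : ℂ) :
    Integrable fun t => mollKer n (x - t) • h t := by
  have := (mollKer_hasCompactSupport n).convolutionExists_left (ContinuousLinearMap.lsmul ℝ ℝ)
    (mollKer_contDiff n).continuous hh x
  exact this.integrable_swap

lemma mollify_contDiff [CompleteSpace E] (n : ℕ) {h : ℂ → E} (hh : LocallyIntegrable h) :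
    ContDiff ℝ ∞ (mollify n h) :=
  (mollKer_hasCompactSupport n).contDiff_convolution_left _ (mollKer_contDiff n) hh

lemma mollify_ae_tendsto [CompleteSpace E] {h : ℂ → E} (hh : LocallyIntegrable h) :
    ∀ᵐ x, Tendsto (fun n => mollify n h x) atTop (𝓝 (h x)) := by
  -- The ratio of outer to inner radius stays equal to 2, so the kernels are comparable with means
  -- over balls and Lebesgue differentiation applies.
  refine ContDiffBump.ae_convolution_tendsto_right_of_locallyIntegrable (K := 2)
    mollBump_rOut_tendsto (Eventually.of_forall fun n => ?_) hh
  simp only [mollBump]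
  apply le_of_eq; ring

lemma norm_mollify_le (n : ℕ) {h : ℂ → E} {M : ℝ} (hM : ∀ᵐ x, ‖h x‖ ≤ M)
    (x : ℂ) : ‖mollify n h x‖ ≤ M := by
  rw [mollify_apply]
  have hi : Integrable (fun t => mollKer n (x - t)) := (integrable_mollKer n).comp_sub_left x
  calc ‖∫ t, mollKer n (x - t) • h t‖ ≤ ∫ t, mollKer n (x - t) * M := by
        refine norm_integral_le_of_norm_le (hi.mul_const M) ?_
        filter_upwards [hM] with t ht
        rw [norm_smul, Real.norm_of_nonneg (mollKer_nonneg _ _)]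
        exact mul_le_mul_of_nonneg_left ht (mollKer_nonneg _ _)
    _ = M := by rw [integral_mul_const, integral_mollKer_sub, one_mul]

end

lemma locallyIntegrable_of_memLp_two {h : ℂ → ℂ} (hh : MemLp h 2) : LocallyIntegrable h :=
  hh.locallyIntegrable (by norm_num)

/-- Jensen's inequality for the probability density `mollKer n (x - t)`, obtained by expanding the
nonnegative variance of `h` about its mean `c`. -/
lemma sq_norm_mollify_le (n : ℕ) {h : ℂ → ℂ} (hh : MemLp h 2) (x : ℂ) :
    ‖mollify n h x‖ ^ 2 ≤ mollify n (fun t => ‖h t‖ ^ 2) x := by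
  set c := mollify n h x with hc
  have hsq : Integrable (fun t => ‖h t‖ ^ 2) := hh.integrable_norm_pow (by norm_num)
  have i1 : Integrable fun t => mollKer n (x - t) • ‖h t‖ ^ 2 :=
    mollify_integrand n hsq.locallyIntegrable x
  have i2 := mollify_integrand n (locallyIntegrable_of_memLp_two hh) x
  have i3 : Integrable (fun t => mollKer n (x - t)) := (integrable_mollKer n).comp_sub_left x
  have i4 : Integrable (fun t => inner ℝ c (mollKer n (x - t) • h t)) := i2.const_inner c
  have key : 0 ≤ ∫ t, mollKer n (x - t) * ‖h t - c‖ ^ 2 :=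
    integral_nonneg fun t => mul_nonneg (mollKer_nonneg _ _) (by positivity)
  have e : ∀ t, mollKer n (x - t) * ‖h t - c‖ ^ 2 = mollKer n (x - t) • ‖h t‖ ^ 2
      - 2 * inner ℝ c (mollKer n (x - t) • h t) + mollKer n (x - t) * ‖c‖ ^ 2 := by
    intro t
    rw [norm_sub_sq_real, real_inner_comm, real_inner_smul_right, smul_eq_mul]; ring
  simp_rw [e] at key
  have i5 : Integrable fun t => mollKer n (x - t) • ‖h t‖ ^ 2
      - 2 * inner ℝ c (mollKer n (x - t) • h t) := i1.sub (i4.const_mul 2)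
  rw [integral_add i5 (i3.mul_const _), integral_sub i1 (i4.const_mul 2),
    integral_const_mul, integral_mul_const, integral_mollKer_sub,
    integral_inner i2 c, ← mollify_apply, ← mollify_apply, ← hc, real_inner_self_eq_norm_sq] at key
  linarith

lemma integrable_mollify (n : ℕ) {h : ℂ → ℝ} (hh : Integrable h) : Integrable (mollify n h) :=
  (integrable_mollKer n).integrable_convolution _ hh

lemma integral_mollify (n : ℕ) {h : ℂ → ℝ} (hh : Integrable h) :
    ∫ x, mollify n h x = ∫ x, h x := by
  rw [mollify, integral_convolution _ (integrable_mollKer n) hh, integral_mollKer]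
  simp

lemma memLp_mollify (n : ℕ) {h : ℂ → ℂ} (hh : MemLp h 2) : MemLp (mollify n h) 2 := by
  have hm : AEStronglyMeasurable (mollify n h) :=
    (mollify_contDiff n (locallyIntegrable_of_memLp_two hh)).continuous.aestronglyMeasurable
  rw [memLp_two_iff_integrable_sq_norm hm]
  refine (integrable_mollify n (hh.integrable_norm_pow (p := 2) (by norm_num))).mono'
    (hm.norm.pow 2) (Eventually.of_forall fun x => ?_)
  rw [Real.norm_of_nonneg (by positivity)]
  exact sq_norm_mollify_le n hh x

/-- Mollifications of an `L²` function converge to it in `L²`. -/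
lemma tendsto_integral_mollify_sub {h : ℂ → ℂ} (hh : MemLp h 2) :
    Tendsto (fun n => ∫ x, ‖mollify n h x - h x‖ ^ 2) atTop (𝓝 0) := by
  set g : ℂ → ℝ := fun t => ‖h t‖ ^ 2 with hg
  have hgi : Integrable g := hh.integrable_norm_pow (by norm_num)
  have hdi : ∀ n, Integrable fun x => ‖mollify n h x - h x‖ ^ 2 := fun n =>
    ((memLp_mollify n hh).sub hh).integrable_norm_pow (p := 2) (by norm_num)
  set I := ∫ x, g x
  set a : ℕ → ℝ := fun n => ∫ x, ‖mollify n h x - h x‖ ^ 2 with ha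
  -- These functions are nonnegative, converge almost everywhere to 4|h|², and have integral 4I - a
  -- n because mollification preserves the integral of |h|². Fatou's lemma then gives limsup a n ≤
  -- 0, so no uniform continuity or density argument is needed.
  let G : ℕ → ℂ → ℝ := fun n x => 2 * mollify n g x + 2 * g x - ‖mollify n h x - h x‖ ^ 2
  have hG0 : ∀ n x, 0 ≤ G n x := by
    intro n x
    have h1 := sq_norm_mollify_le n hh x
    have h2 : ‖mollify n h x - h x‖ ^ 2 ≤ (‖mollify n h x‖ + ‖h x‖) ^ 2 := by
      gcongr; exact norm_sub_le _ _
    have h3 := sq_nonneg (‖mollify n h x‖ - ‖h x‖)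
    simp only [G, hg] at *
    nlinarith
  have hGi : ∀ n, Integrable (G n) := fun n =>
    (((integrable_mollify n hgi).const_mul 2).add (hgi.const_mul 2)).sub (hdi n)
  have hGint : ∀ n, ∫ x, G n x = 4 * I - a n := by
    intro n
    have i1 : Integrable fun x => 2 * mollify n g x + 2 * g x :=
      ((integrable_mollify n hgi).const_mul 2).add (hgi.const_mul 2)
    simp only [G]
    rw [integral_sub i1 (hdi n),
      integral_add ((integrable_mollify n hgi).const_mul 2) (hgi.const_mul 2), integral_const_mul,
      integral_const_mul, integral_mollify n hgi]
    ring
  have hlim : ∀ᵐ x, Tendsto (fun n => G n x) atTop (𝓝 (4 * g x)) := by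
    filter_upwards [mollify_ae_tendsto hgi.locallyIntegrable,
      mollify_ae_tendsto (locallyIntegrable_of_memLp_two hh)] with x h1 h2
    have := ((h1.const_mul 2).add_const (2 * g x)).sub (((h2.sub_const (h x)).norm).pow 2)
    simp only [sub_self, norm_zero] at this
    convert! this using 2
    ring
  have fatou : ENNReal.ofReal (4 * I) ≤ liminf (fun n => ENNReal.ofReal (4 * I - a n)) atTop := by
    have h1 := lintegral_liminf_le' (u := atTop) (μ := volume) (f := fun n x => ENNReal.ofReal (G n x))
      (fun n => (hGi n).aestronglyMeasurable.aemeasurable.ennreal_ofReal)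
    simp_rw [← ofReal_integral_eq_lintegral_ofReal (hGi _) (Eventually.of_forall (hG0 _)),
      hGint] at h1
    refine le_trans (le_of_eq ?_) h1
    rw [show 4 * I = ∫ x, 4 * g x from (integral_const_mul _ _).symm,
      ofReal_integral_eq_lintegral_ofReal (hgi.const_mul 4)
        (Eventually.of_forall fun x => by positivity)]
    refine lintegral_congr_ae ?_
    filter_upwards [hlim] with x hx
    exact ((ENNReal.continuous_ofReal.tendsto _).comp hx).liminf_eq.symm
  have ha0 : ∀ n, 0 ≤ a n := fun n => integral_nonneg fun x => by positivity
  have ha4 : ∀ n, a n ≤ 4 * I := fun n => by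
    have := integral_nonneg (μ := volume) (f := G n) (hG0 n)
    rw [hGint] at this; linarith
  rw [Metric.tendsto_atTop']
  intro δ hδ
  by_cases hcase : 4 * I < δ
  · exact ⟨0, fun n _ => by
      rw [Real.dist_0_eq_abs, abs_of_nonneg (ha0 n)]; exact (ha4 n).trans_lt hcase⟩
  · push Not at hcase
    have hlt : ENNReal.ofReal (4 * I - δ) < liminf (fun n => ENNReal.ofReal (4 * I - a n)) atTop :=
      lt_of_lt_of_le ((ENNReal.ofReal_lt_ofReal_iff (by linarith)).2 (by linarith)) fatou
    obtain ⟨N, hN⟩ := eventually_atTop.1 (eventually_lt_of_lt_liminf hlt)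
    refine ⟨N, fun n hn => ?_⟩
    rw [Real.dist_0_eq_abs, abs_of_nonneg (ha0 n)]
    have := (ENNReal.ofReal_lt_ofReal_iff_of_nonneg (by linarith)).1 (hN n hn.le)
    linarith

lemma tendsto_eLpNorm_mollify_sub {h : ℂ → ℂ} (hh : MemLp h 2) :
    Tendsto (fun n => eLpNorm (mollify n h - h) 2 volume) atTop (𝓝 0) := by
  have h1 := tendsto_integral_mollify_sub hh
  have e : ∀ n, eLpNorm (mollify n h - h) 2 volume
      = ENNReal.ofReal ((∫ x, ‖mollify n h x - h x‖ ^ 2) ^ (1 / 2 : ℝ)) := fun n => by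
    rw [((memLp_mollify n hh).sub hh).eLpNorm_eq_integral_rpow_norm (by norm_num) (by norm_num)]
    simp
  simp_rw [e]
  have := (ENNReal.continuous_ofReal.tendsto _).comp
    (h1.rpow_const (p := (1 / 2 : ℝ)) (Or.inr (by norm_num)))
  simpa [Function.comp_def] using this

/-! ### Weak derivatives -/

/-- Away from the boundary, mollification commutes with weak derivatives. -/
lemma fderiv_mollify {X : Set ℂ} (hX : MeasurableSet X) {e : ℂ} {f u : ℂ → ℂ}
    (hf : LocallyIntegrable (X.indicator f)) (hw : IsWeakPartial X e f u)
    (n : ℕ) {z : ℂ} (hz : Metric.closedBall z (mollBump n).rOut ⊆ X) :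
    fderiv ℝ (mollify n (X.indicator f)) z e = mollify n (X.indicator u) z := by
  have hk : ContDiff ℝ 1 (mollKer n) := (mollKer_contDiff n).of_le (by norm_cast)
  have hd := (mollKer_hasCompactSupport n).hasFDerivAt_convolution_left
    (ContinuousLinearMap.lsmul ℝ ℝ) hk hf z
  -- The reflected and translated kernel is itself an admissible test function, because its support
  -- is the closed ball assumed to lie in `X`.
  set φ : ℂ → ℝ := fun t => mollKer n (z - t) with hφ
  have hφd : ∀ t, fderiv ℝ φ t e = - fderiv ℝ (mollKer n) (z - t) e := by
    intro t
    have h1 : HasFDerivAt φ ((fderiv ℝ (mollKer n) (z - t)).comp (-ContinuousLinearMap.id ℝ ℂ)) t :=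
      ((hk.differentiable one_ne_zero).differentiableAt.hasFDerivAt).comp t
        ((hasFDerivAt_id t).const_sub z)
    rw [h1.fderiv]; simp
  have hφc : ContDiff ℝ ∞ φ := (mollKer_contDiff n).comp (contDiff_const.sub contDiff_id)
  have hφs : tsupport φ ⊆ Metric.closedBall z (mollBump n).rOut := by
    refine closure_minimal (fun t ht => ?_) Metric.isClosed_closedBall
    have : z - t ∈ tsupport (mollKer n) := subset_closure ht
    rw [mollKer_tsupport, mem_closedBall_zero_iff] at this
    rwa [Metric.mem_closedBall, dist_comm, dist_eq_norm]
  have hφK : HasCompactSupport φ := (isCompact_closedBall z _).of_isClosed_subset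
    (isClosed_tsupport _) hφs
  have h1 := hw φ hφc hφK (hφs.trans hz)
  have hind : ∀ (a : ℂ → ℝ) (b : ℂ → ℂ), ∫ t, a t • X.indicator b t = ∫ t in X, a t • b t := by
    intro a b
    rw [← integral_indicator hX]
    congr 1; ext t
    by_cases ht : t ∈ X <;> simp [ht]
  set L' : (ℂ →L[ℝ] ℝ) →L[ℝ] ℂ →L[ℝ] ℂ →L[ℝ] ℂ :=
    ContinuousLinearMap.precompL ℂ (ContinuousLinearMap.lsmul ℝ ℝ) with hL'
  have hi : Integrable fun t => L' (fderiv ℝ (mollKer n) (z - t)) (X.indicator f t) :=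
    (((mollKer_hasCompactSupport n).fderiv ℝ).convolutionExists_left L'
      (hk.continuous_fderiv one_ne_zero) hf z).integrable_swap
  have h2 : fderiv ℝ (mollify n (X.indicator f)) z
      = ∫ t, L' (fderiv ℝ (mollKer n) (z - t)) (X.indicator f t) := by
    have h3 := hd.fderiv
    rw [convolution_eq_swap] at h3
    exact h3
  rw [h2, ContinuousLinearMap.integral_apply hi, mollify_apply]
  calc (∫ t, (L' (fderiv ℝ (mollKer n) (z - t)) (X.indicator f t)) e)
      = ∫ t, (-fderiv ℝ φ t e) • X.indicator f t := by
        congr 1; ext1 t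
        rw [hφd, neg_neg]; rfl
    _ = ∫ t, φ t • X.indicator u t := by
        rw [hind (fun t => -fderiv ℝ φ t e) f, hind φ u]
        simp_rw [neg_smul]
        rw [integral_neg, h1, neg_neg]

lemma isOpen_annulus (a b : ℝ) : IsOpen (annulus a b) :=
  (isOpen_lt continuous_const continuous_norm).inter (isOpen_lt continuous_norm continuous_const)

lemma measurableSet_annulus (a b : ℝ) : MeasurableSet (annulus a b) :=
  (isOpen_annulus a b).measurableSet

lemma annulus_subset_ball (a b : ℝ) : annulus a b ⊆ Metric.ball 0 b := fun z hz => by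
  simpa using hz.2

instance isFiniteMeasure_restrict_annulus (a b : ℝ) :
    IsFiniteMeasure (volume.restrict (annulus a b)) :=
  ⟨by rw [Measure.restrict_apply_univ]
      exact (measure_mono (annulus_subset_ball a b)).trans_lt measure_ball_lt_top⟩

lemma weakPartial_spec {X : Set ℂ} {e : ℂ} {f : ℂ → ℂ} (h : HasL2WeakPartial X e f) :
    MemLp (weakPartial X e f) 2 (volume.restrict X) ∧
      IsWeakPartial X e f (weakPartial X e f) := by
  rw [weakPartial, dif_pos h]; exact h.choose_spec

lemma locallyIntegrableOn_of_memLp {X : Set ℂ} {u : ℂ → ℂ} (hu : MemLp u 2 (volume.restrict X)) :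
    LocallyIntegrableOn u X :=
  locallyIntegrableOn_of_locallyIntegrable_restrict (hu.locallyIntegrable (by norm_num))

lemma IsWeakPartial.ae_eq {X : Set ℂ} (hX : IsOpen X) {e : ℂ} {f u v : ℂ → ℂ}
    (hui : LocallyIntegrableOn u X) (hvi : LocallyIntegrableOn v X)
    (h1 : IsWeakPartial X e f u) (h2 : IsWeakPartial X e f v) :
    u =ᵐ[volume.restrict X] v := by
  have key : ∀ᵐ x, x ∈ X → (u - v) x = 0 := by
    refine hX.ae_eq_zero_of_integral_contDiff_smul_eq_zero (hui.sub hvi) ?_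
    intro φ hφ hφc hφs
    have e1 := h1 φ hφ hφc hφs
    rw [h2 φ hφ hφc hφs, neg_inj] at e1
    have hz : ∀ w : ℂ → ℂ, ∫ x, φ x • w x = ∫ x in X, φ x • w x := fun w => by
      refine (setIntegral_eq_integral_of_forall_compl_eq_zero fun x hx => ?_).symm
      rw [image_eq_zero_of_notMem_tsupport (fun h => hx (hφs h)), zero_smul]
    have hi : ∀ w : ℂ → ℂ, LocallyIntegrableOn w X → Integrable fun x => φ x • w x := by
      intro w hw
      have hK : IntegrableOn w (tsupport φ) := hw.integrableOn_compact_subset hφs hφc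
      have : IntegrableOn (fun x => φ x • w x) (tsupport φ) :=
        hK.continuousOn_smul hφ.continuous.continuousOn hφc
      refine (integrableOn_iff_integrable_of_support_subset fun x hx => ?_).1 this
      by_contra hn
      exact hx (by simp [image_eq_zero_of_notMem_tsupport hn])
    simp only [Pi.sub_apply, smul_sub]
    rw [integral_sub (hi u hui) (hi v hvi), hz u, hz v, e1, sub_self]
  rw [EventuallyEq, ae_restrict_iff' hX.measurableSet]
  filter_upwards [key] with x hx hxX
  exact sub_eq_zero.1 (hx hxX)

lemma weakPartial_ae_eq {X : Set ℂ} (hX : IsOpen X) {e : ℂ} {f u : ℂ → ℂ}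
    (hu : MemLp u 2 (volume.restrict X)) (h : IsWeakPartial X e f u) :
    weakPartial X e f =ᵐ[volume.restrict X] u :=
  have hs := weakPartial_spec ⟨u, hu, h⟩
  IsWeakPartial.ae_eq hX (locallyIntegrableOn_of_memLp hs.1) (locallyIntegrableOn_of_memLp hu) hs.2 h

/-- The integral of a directional derivative of a compactly supported `C¹` function vanishes. -/
lemma integral_fderiv_eq_zero_of_hasCompactSupport {E : Type*} [NormedAddCommGroup E]
    [NormedSpace ℝ E] {g : ℂ → E} (hg : ContDiff ℝ 1 g)
    (hc : HasCompactSupport g) (e : ℂ) : ∫ z, fderiv ℝ g z e = 0 := by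
  have h := integral_bilinear_hasFDerivAt_right_eq_neg_left_of_integrable (μ := (volume : Measure ℂ))
    (f := fun _ : ℂ => (1 : ℝ)) (f' := fun _ => 0) (g := g) (g' := fun z => fderiv ℝ g z) (v := e)
    (B := ContinuousLinearMap.lsmul ℝ ℝ) (by simp)
    (by simpa using ((hg.continuous_fderiv one_ne_zero).clm_apply
          continuous_const).integrable_of_hasCompactSupport (hc.fderiv_apply ℝ e))
    (by simpa using hg.continuous.integrable_of_hasCompactSupport hc)
    (fun x _ => hasFDerivAt_const _ _)
    (fun x _ => (hg.differentiable one_ne_zero x).hasFDerivAt)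
  simpa using h

/-- A product with a compactly supported factor is `C¹` if the other one is `C¹` near the
support. -/
lemma contDiff_smul_of_tsupport_subset {E : Type*} [NormedAddCommGroup E] [NormedSpace ℝ E]
    {X : Set ℂ} (hX : IsOpen X) {φ : ℂ → ℝ} {f : ℂ → E}
    (hφ : ContDiff ℝ 1 φ) (hs : tsupport φ ⊆ X) (hf : ContDiffOn ℝ 1 f X) :
    ContDiff ℝ 1 (fun z => φ z • f z) := by
  rw [contDiff_iff_contDiffAt]
  intro z
  by_cases hz : z ∈ tsupport φ
  · exact hφ.contDiffAt.smul (hf.contDiffAt (hX.mem_nhds (hs hz)))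
  · have : (fun z => φ z • f z) =ᶠ[𝓝 z] fun _ => 0 := by
      filter_upwards [(isClosed_tsupport φ).isOpen_compl.mem_nhds hz] with w hw
      rw [image_eq_zero_of_notMem_tsupport hw, zero_smul]
    exact contDiffAt_const.congr_of_eventuallyEq this

lemma isWeakPartial_of_contDiffOn {X : Set ℂ} (hX : IsOpen X) {f : ℂ → ℂ}
    (hf : ContDiffOn ℝ 1 f X) (e : ℂ) : IsWeakPartial X e f (fun z => fderiv ℝ f z e) := by
  intro φ hφ hc hs
  have hφ1 : ContDiff ℝ 1 φ := hφ.of_le (by norm_cast)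
  have hg := contDiff_smul_of_tsupport_subset hX hφ1 hs hf
  have hgc : HasCompactSupport (fun z => φ z • f z) := hc.smul_right
  have h0 := integral_fderiv_eq_zero_of_hasCompactSupport hg hgc e
  have hφf := contDiff_smul_of_tsupport_subset hX hφ1 hs hf
  have hfc : ContinuousOn (fun z => fderiv ℝ f z e) X :=
    (hf.continuousOn_fderiv_of_isOpen hX le_rfl).clm_apply continuousOn_const
  have hcont : ∀ {a : ℂ → ℝ} {b : ℂ → ℂ}, Continuous a → tsupport a ⊆ tsupport φ →
      ContinuousOn b X → Integrable (fun z => a z • b z) := by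
    intro a b ha hta hb
    have hK : IsCompact (tsupport a) := hc.of_isClosed_subset (isClosed_tsupport _) hta
    have : IntegrableOn (fun x => a x • b x) (tsupport a) :=
      (ha.continuousOn.smul (hb.mono (hta.trans hs))).integrableOn_compact hK
    refine (integrableOn_iff_integrable_of_support_subset fun x hx => ?_).1 this
    by_contra hn
    exact hx (by simp [image_eq_zero_of_notMem_tsupport hn])
  have ht : tsupport (fun z => fderiv ℝ φ z e) ⊆ tsupport φ :=
    closure_minimal (fun z hz => by
      by_contra hn
      exact hz (by simp [fderiv_of_notMem_tsupport ℝ hn])) (isClosed_tsupport _)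
  have hi1 : Integrable (fun z => fderiv ℝ φ z e • f z) :=
    hcont ((hφ1.continuous_fderiv one_ne_zero).clm_apply continuous_const) ht hf.continuousOn
  have hi2 : Integrable (fun z => φ z • fderiv ℝ f z e) := hcont hφ1.continuous subset_rfl hfc
  have hd : ∀ z, fderiv ℝ (fun z => φ z • f z) z e
      = φ z • fderiv ℝ f z e + fderiv ℝ φ z e • f z := by
    intro z
    by_cases hz : z ∈ tsupport φ
    · rw [fderiv_fun_smul (hφ1.differentiable one_ne_zero z)
        ((hf.contDiffAt (hX.mem_nhds (hs hz))).differentiableAt one_ne_zero)]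
      simp
    · have : (fun z => φ z • f z) =ᶠ[𝓝 z] fun _ => 0 := by
        filter_upwards [(isClosed_tsupport φ).isOpen_compl.mem_nhds hz] with w hw
        rw [image_eq_zero_of_notMem_tsupport hw, zero_smul]
      rw [this.fderiv_eq, image_eq_zero_of_notMem_tsupport hz, fderiv_of_notMem_tsupport ℝ hz]
      simp
  simp_rw [hd] at h0
  rw [integral_add hi2 hi1] at h0
  rw [setIntegral_eq_integral_of_forall_compl_eq_zero, setIntegral_eq_integral_of_forall_compl_eq_zero]
  · linear_combination h0
  · intro x hx; rw [image_eq_zero_of_notMem_tsupport (fun h => hx (hs h)), zero_smul]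
  · intro x hx; rw [fderiv_of_notMem_tsupport ℝ (fun h => hx (hs h))]; simp

/-! ### Smooth approximation and limits of integrals -/

/-- Mollifications of `f` extended by zero, with the first `N` indices dropped so that all smoothing
balls around points of `K` stay in `X`. The uniform bound `M` survives because the kernels are
probability densities; it is what later permits nonlinear functions of `f`. -/
lemma exists_smooth_approx {X : Set ℂ} (hX : IsOpen X) {f u v : ℂ → ℂ}
    (hf : MemLp f 2 (volume.restrict X)) (hu : MemLp u 2 (volume.restrict X))
    (hv : MemLp v 2 (volume.restrict X)) (wu : IsWeakPartial X 1 f u)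
    (wv : IsWeakPartial X Complex.I f v) {M : ℝ} (hM0 : 0 ≤ M)
    (hM : ∀ᵐ z ∂(volume.restrict X), ‖f z‖ ≤ M) {K : Set ℂ} (hK : IsCompact K) (hKX : K ⊆ X) :
    ∃ F : ℕ → ℂ → ℂ, (∀ n, ContDiff ℝ ∞ (F n)) ∧ (∀ n z, ‖F n z‖ ≤ M) ∧
      (∀ᵐ z ∂(volume.restrict K), Tendsto (fun n => F n z) atTop (𝓝 (f z))) ∧
      Tendsto (fun n => eLpNorm (fun z => fderiv ℝ (F n) z 1 - u z) 2 (volume.restrict K))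
        atTop (𝓝 0) ∧
      Tendsto (fun n => eLpNorm (fun z => fderiv ℝ (F n) z Complex.I - v z) 2 (volume.restrict K))
        atTop (𝓝 0) := by
  have hXm := hX.measurableSet
  have hf' : MemLp (X.indicator f) 2 := (memLp_indicator_iff_restrict hXm).2 hf
  have hu' : MemLp (X.indicator u) 2 := (memLp_indicator_iff_restrict hXm).2 hu
  have hv' : MemLp (X.indicator v) 2 := (memLp_indicator_iff_restrict hXm).2 hv
  have hfl := locallyIntegrable_of_memLp_two hf'
  obtain ⟨δ, hδ, hδX⟩ := hK.exists_cthickening_subset_open hX hKX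
  obtain ⟨N, hN⟩ := eventually_atTop.1 (mollBump_rOut_tendsto.eventually_le_const hδ)
  have hball : ∀ n, ∀ z ∈ K, Metric.closedBall z (mollBump (n + N)).rOut ⊆ X := fun n z hz =>
    ((Metric.closedBall_subset_closedBall (hN _ (by omega))).trans
      (Metric.closedBall_subset_cthickening hz δ)).trans hδX
  have hbd : ∀ᵐ z, ‖X.indicator f z‖ ≤ M := by
    rw [ae_restrict_iff' hXm] at hM
    filter_upwards [hM] with z hz
    by_cases h : z ∈ X
    · rw [indicator_of_mem h]; exact hz h
    · rw [indicator_of_notMem h, norm_zero]; exact hM0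
  have hshift : Tendsto (fun n => n + N) atTop atTop := tendsto_add_atTop_nat N
  have hconv : ∀ {e : ℂ} {w : ℂ → ℂ}, MemLp (X.indicator w) 2 → IsWeakPartial X e f w →
      Tendsto (fun n => eLpNorm (fun z => fderiv ℝ (mollify (n + N) (X.indicator f)) z e - w z) 2
        (volume.restrict K)) atTop (𝓝 0) := by
    intro e w hw ww
    refine tendsto_of_tendsto_of_tendsto_of_le_of_le tendsto_const_nhds
      ((tendsto_eLpNorm_mollify_sub hw).comp hshift) (fun _ => zero_le) fun n => ?_
    simp only [Function.comp_apply]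
    refine le_trans (le_of_eq ?_) 
      (eLpNorm_mono_measure _ (Measure.restrict_le_self (s := K)))
    refine eLpNorm_congr_ae ?_
    refine (ae_restrict_mem hK.measurableSet).mono fun z hz => ?_
    beta_reduce
    rw [fderiv_mollify hXm hfl ww _ (hball n z hz), Pi.sub_apply, indicator_of_mem (hKX hz)]
  refine ⟨fun n => mollify (n + N) (X.indicator f), fun n => mollify_contDiff _ hfl,
    fun n z => norm_mollify_le _ hbd z, ?_, hconv hu' wu, hconv hv' wv⟩
  rw [ae_restrict_iff' hK.measurableSet]
  filter_upwards [mollify_ae_tendsto hfl] with z hz hzK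
  rw [indicator_of_mem (hKX hzK)] at hz
  exact hz.comp hshift

/-- The factor `a n` converges only pointwise but is bounded, the factor `b n` converges in L¹.
Replacing `b n` by its limit costs at most C times the L¹ distance, after which dominated
convergence applies. -/
lemma tendsto_integral_mul_of_bounded {μ : Measure ℂ} {a : ℕ → ℂ → ℂ} {a' : ℂ → ℂ}
    {b : ℕ → ℂ → ℂ} {b' : ℂ → ℂ} {C : ℝ} (ham : ∀ n, AEStronglyMeasurable (a n) μ)
    (hC : ∀ n z, ‖a n z‖ ≤ C) (hlim : ∀ᵐ z ∂μ, Tendsto (fun n => a n z) atTop (𝓝 (a' z)))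
    (hb : ∀ n, Integrable (b n) μ) (hb' : Integrable b' μ)
    (hbl : Tendsto (fun n => eLpNorm (fun z => b n z - b' z) 1 μ) atTop (𝓝 0)) :
    Tendsto (fun n => ∫ z, a n z * b n z ∂μ) atTop (𝓝 (∫ z, a' z * b' z ∂μ)) := by
  have h1 : Tendsto (fun n => ∫ z, a n z * b' z ∂μ) atTop (𝓝 (∫ z, a' z * b' z ∂μ)) := by
    refine tendsto_integral_of_dominated_convergence (fun z => C * ‖b' z‖)
      (fun n => (ham n).mul hb'.1) (hb'.norm.const_mul C) (fun n => Eventually.of_forall fun z => ?_)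
      ?_
    · rw [norm_mul]; exact mul_le_mul_of_nonneg_right (hC n z) (norm_nonneg _)
    · filter_upwards [hlim] with z hz using hz.mul_const _
  have hi1 : ∀ n, Integrable (fun z => a n z * b n z) μ := fun n =>
    (hb n).bdd_mul (ham n) (Eventually.of_forall (hC n))
  have hi2 : ∀ n, Integrable (fun z => a n z * b' z) μ := fun n =>
    hb'.bdd_mul (ham n) (Eventually.of_forall (hC n))
  have h2 : Tendsto (fun n => ∫ z, a n z * b n z ∂μ - ∫ z, a n z * b' z ∂μ) atTop (𝓝 0) := by
    have h3 : Tendsto (fun n => C * (eLpNorm (fun z => b n z - b' z) 1 μ).toReal) atTop (𝓝 0) := by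
      have := ((ENNReal.tendsto_toReal ENNReal.zero_ne_top).comp hbl).const_mul C
      simpa using this
    refine squeeze_zero_norm (fun n => ?_) h3
    have hd : Integrable (fun z => b n z - b' z) μ := (hb n).sub hb'
    rw [← integral_sub (hi1 n) (hi2 n), eLpNorm_one_eq_lintegral_enorm,
      ← integral_norm_eq_lintegral_enorm hd.1, ← integral_const_mul]
    refine norm_integral_le_of_norm_le (hd.norm.const_mul C) (Eventually.of_forall fun z => ?_)
    rw [← mul_sub, norm_mul]
    exact mul_le_mul_of_nonneg_right (hC n z) (norm_nonneg _)
  simpa using h2.add h1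

lemma tendsto_eLpNorm_one_of_two {μ : Measure ℂ} [IsFiniteMeasure μ] {b : ℕ → ℂ → ℂ} {b' : ℂ → ℂ}
    (hb : ∀ n, AEStronglyMeasurable (b n) μ) (hb' : AEStronglyMeasurable b' μ)
    (h : Tendsto (fun n => eLpNorm (fun z => b n z - b' z) 2 μ) atTop (𝓝 0)) :
    Tendsto (fun n => eLpNorm (fun z => b n z - b' z) 1 μ) atTop (𝓝 0) := by
  have hle : ∀ n, eLpNorm (fun z => b n z - b' z) 1 μ
      ≤ eLpNorm (fun z => b n z - b' z) 2 μ * μ univ ^ (1 / 2 : ℝ) := fun n => by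
    have := eLpNorm_le_eLpNorm_mul_rpow_measure_univ (p := 1) (q := 2) (μ := μ) (by norm_num)
      ((hb n).sub hb')
    convert! this using 3
    norm_num
  have hfin : μ univ ^ (1 / 2 : ℝ) ≠ ⊤ := ENNReal.rpow_ne_top_of_nonneg (by norm_num)
    (measure_ne_top _ _)
  have := ENNReal.Tendsto.mul_const h (Or.inr hfin)
  rw [zero_mul] at this
  exact tendsto_of_tendsto_of_tendsto_of_le_of_le tendsto_const_nhds this (fun _ => zero_le) hle

/-- Hölder's inequality after splitting the difference of products. The imaginary part of conj f_x ·
f_y is the Jacobian, so this is its L¹ convergence along the approximation. -/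
lemma tendsto_eLpNorm_conj_mul {μ : Measure ℂ} {b c : ℕ → ℂ → ℂ} {b' c' : ℂ → ℂ}
    (hb : ∀ n, AEStronglyMeasurable (b n) μ) (hb' : MemLp b' 2 μ)
    (hc : ∀ n, AEStronglyMeasurable (c n) μ) (hc' : MemLp c' 2 μ)
    (h1 : Tendsto (fun n => eLpNorm (fun z => b n z - b' z) 2 μ) atTop (𝓝 0))
    (h2 : Tendsto (fun n => eLpNorm (fun z => c n z - c' z) 2 μ) atTop (𝓝 0)) :
    Tendsto (fun n => eLpNorm (fun z => conj (b n z) * c n z - conj (b' z) * c' z) 1 μ)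
      atTop (𝓝 0) := by
  have hprod : ∀ (p q : ℂ → ℂ), AEStronglyMeasurable p μ → AEStronglyMeasurable q μ →
      eLpNorm (fun z => conj (p z) * q z) 1 μ ≤ eLpNorm p 2 μ * eLpNorm q 2 μ := by
    intro p q hp hq
    have := eLpNorm_le_eLpNorm_mul_eLpNorm'_of_norm (p := 2) (q := 2) (r := 1) hp hq
      (fun x y => conj x * y) 1 (Eventually.of_forall fun z => by simp)
    simpa using this
  have hle : ∀ n, eLpNorm (fun z => conj (b n z) * c n z - conj (b' z) * c' z) 1 μ
      ≤ eLpNorm (fun z => b n z - b' z) 2 μ * (eLpNorm (fun z => c n z - c' z) 2 μ + eLpNorm c' 2 μ)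
        + eLpNorm b' 2 μ * eLpNorm (fun z => c n z - c' z) 2 μ := by
    intro n
    have hbm := (hb n).sub hb'.1
    have hcm := (hc n).sub hc'.1
    have e : (fun z => conj (b n z) * c n z - conj (b' z) * c' z)
        = (fun z => conj (b n z - b' z) * c n z) + fun z => conj (b' z) * (c n z - c' z) := by
      ext z; simp only [Pi.add_apply, map_sub]; ring
    have m1 : AEStronglyMeasurable (fun z => conj (b n z - b' z) * c n z) μ :=
      (Complex.continuous_conj.comp_aestronglyMeasurable hbm).mul (hc n)
    have m2 : AEStronglyMeasurable (fun z => conj (b' z) * (c n z - c' z)) μ :=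
      (Complex.continuous_conj.comp_aestronglyMeasurable hb'.1).mul hcm
    rw [e]
    refine (eLpNorm_add_le m1 m2 le_rfl).trans (add_le_add ((hprod _ _ hbm (hc n)).trans ?_)
      (hprod _ _ hb'.1 hcm))
    refine mul_le_mul' le_rfl ?_
    have : c n = (fun z => c n z - c' z) + c' := by ext z; simp
    conv_lhs => rw [this]
    exact eLpNorm_add_le hcm hc'.1 (by norm_num)
  have hlim := (ENNReal.Tendsto.mul h1 (Or.inr (by simpa using hc'.2.ne))
    (h2.add_const (eLpNorm c' 2 μ)) (Or.inr ENNReal.zero_ne_top)).add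
    (ENNReal.Tendsto.const_mul (a := eLpNorm b' 2 μ) h2 (Or.inr hb'.2.ne))
  simp only [zero_mul, mul_zero, add_zero] at hlim
  exact tendsto_of_tendsto_of_tendsto_of_le_of_le tendsto_const_nhds hlim (fun _ => zero_le) hle

/-! ### Chain rules -/

lemma contDiff_one_of_hasDerivAt {F F' : ℝ → ℝ} (hF : ∀ s, HasDerivAt F (F' s) s)
    (hF' : Continuous F') : ContDiff ℝ 1 F := by
  rw [contDiff_one_iff_deriv]
  exact ⟨fun s => (hF s).differentiableAt, by rwa [show deriv F = F' from funext fun s => (hF s).deriv]⟩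

lemma fderiv_apply_eq_of_hasLineDerivAt {A : ℂ → ℝ} (hA : ContDiff ℝ 1 A) {z e : ℂ} {d : ℝ}
    (h : HasDerivAt (fun t : ℝ => A (z + t • e)) d 0) : fderiv ℝ A z e = d :=
  ((hA.differentiable one_ne_zero z).hasFDerivAt.hasLineDerivAt e).unique h

lemma hasDerivAt_line {E : Type*} [NormedAddCommGroup E] [NormedSpace ℝ E] {g : ℂ → E}
    (hg : ContDiff ℝ 1 g) (z e : ℂ) :
    HasDerivAt (fun t : ℝ => g (z + t • e)) (fderiv ℝ g z e) 0 :=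
  (hg.differentiable one_ne_zero z).hasFDerivAt.hasLineDerivAt e

lemma HasDerivAt.comp_norm_sq {F F' : ℝ → ℝ} (hF : ∀ s, HasDerivAt F (F' s) s) {g : ℝ → ℂ} {d : ℂ}
    {t : ℝ} (hg : HasDerivAt g d t) :
    HasDerivAt (fun t => F (‖g t‖ ^ 2)) (F' (‖g t‖ ^ 2) * (2 * (conj (g t) * d).re)) t := by
  have h := hg.norm_sq
  rw [Complex.inner, mul_comm d] at h
  exact (hF _).comp t h

/-- The chain rule for `F(|g|²)` in weak form, for smooth `g`. -/
lemma integral_fderiv_mul_comp_norm_sq_of_smooth {χ : ℂ → ℝ} (hχ : ContDiff ℝ 1 χ)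
    (hc : HasCompactSupport χ) {F F' : ℝ → ℝ} (hF : ∀ s, HasDerivAt F (F' s) s)
    (hF' : Continuous F') {g : ℂ → ℂ} (hg : ContDiff ℝ ∞ g) (e : ℂ) :
    ∫ z, fderiv ℝ χ z e * F (‖g z‖ ^ 2)
      = - ∫ z, χ z * (F' (‖g z‖ ^ 2) * (2 * (conj (g z) * fderiv ℝ g z e).re)) := by
  have hg1 : ContDiff ℝ 1 g := hg.of_le (by norm_cast)
  have hFc := contDiff_one_of_hasDerivAt hF hF'
  have hA : ContDiff ℝ 1 (fun z => χ z * F (‖g z‖ ^ 2)) :=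
    hχ.mul (hFc.comp (hg1.norm_sq ℝ))
  have h0 := integral_fderiv_eq_zero_of_hasCompactSupport hA hc.mul_right e
  have hd : ∀ z, fderiv ℝ (fun z => χ z * F (‖g z‖ ^ 2)) z e = fderiv ℝ χ z e * F (‖g z‖ ^ 2)
      + χ z * (F' (‖g z‖ ^ 2) * (2 * (conj (g z) * fderiv ℝ g z e).re)) := by
    intro z
    refine fderiv_apply_eq_of_hasLineDerivAt hA ?_
    have := (hasDerivAt_line hχ z e).mul (HasDerivAt.comp_norm_sq hF (hasDerivAt_line hg1 z e))
    simp only [zero_smul, add_zero] at this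
    exact this
  have cg := hg1.continuous
  have cdg : Continuous fun z => fderiv ℝ g z e :=
    (hg1.continuous_fderiv one_ne_zero).clm_apply continuous_const
  have cχ := (hχ.continuous_fderiv one_ne_zero).clm_apply (continuous_const (y := e))
  have cF := hFc.continuous
  simp_rw [hd] at h0
  rw [integral_add] at h0
  · linarith
  · exact Continuous.integrable_of_hasCompactSupport (by fun_prop) (hc.fderiv_apply ℝ e).mul_right
  · exact Continuous.integrable_of_hasCompactSupport (by have := hχ.continuous; fun_prop) hc.mul_right

/-- The pull back of `F(|w|²) Im (conj w dw)` under a smooth map, and its exterior derivative. -/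
lemma integral_angular_form_of_smooth {χ : ℂ → ℝ} (hχ : ContDiff ℝ 1 χ)
    (hc : HasCompactSupport χ) {F F' : ℝ → ℝ} (hF : ∀ s, HasDerivAt F (F' s) s)
    (hF' : Continuous F') {g : ℂ → ℂ} (hg : ContDiff ℝ ∞ g) :
    ∫ z, (fderiv ℝ χ z 1 * F (‖g z‖ ^ 2) * (conj (g z) * fderiv ℝ g z Complex.I).im
        - fderiv ℝ χ z Complex.I * F (‖g z‖ ^ 2) * (conj (g z) * fderiv ℝ g z 1).im)
      = - ∫ z, χ z * (2 * F' (‖g z‖ ^ 2) * ‖g z‖ ^ 2 + 2 * F (‖g z‖ ^ 2))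
          * (conj (fderiv ℝ g z 1) * fderiv ℝ g z Complex.I).im := by
  have hg1 : ContDiff ℝ 1 g := hg.of_le (by norm_cast)
  have hg2 : ContDiff ℝ 2 g := hg.of_le (by norm_cast)
  have hFc := contDiff_one_of_hasDerivAt hF hF'
  have hdg : ∀ e, ContDiff ℝ 1 (fun z => fderiv ℝ g z e) := fun e =>
    (hg2.fderiv_right (m := 1) (by norm_num)).clm_apply contDiff_const
  have hconj : ContDiff ℝ 1 (fun z => conj (g z)) := Complex.conjCLE.contDiff.comp hg1
  have hIm : ∀ e, ContDiff ℝ 1 (fun z => (conj (g z) * fderiv ℝ g z e).im) := fun e =>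
    Complex.imCLM.contDiff.comp (hconj.mul (hdg e))
  have hA : ∀ e, ContDiff ℝ 1
      (fun z => χ z * F (‖g z‖ ^ 2) * (conj (g z) * fderiv ℝ g z e).im) := fun e =>
    (hχ.mul (hFc.comp (hg1.norm_sq ℝ))).mul (hIm e)
  have hAc : ∀ e, HasCompactSupport
      (fun z => χ z * F (‖g z‖ ^ 2) * (conj (g z) * fderiv ℝ g z e).im) := fun e =>
    hc.mul_right.mul_right
  have hd : ∀ z e e', fderiv ℝ
      (fun z => χ z * F (‖g z‖ ^ 2) * (conj (g z) * fderiv ℝ g z e).im) z e'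
      = (fderiv ℝ χ z e' * F (‖g z‖ ^ 2)
        + χ z * (F' (‖g z‖ ^ 2) * (2 * (conj (g z) * fderiv ℝ g z e').re)))
          * (conj (g z) * fderiv ℝ g z e).im
        + χ z * F (‖g z‖ ^ 2) * (conj (fderiv ℝ g z e') * fderiv ℝ g z e
          + conj (g z) * fderiv ℝ (fun z => fderiv ℝ g z e) z e').im := by
    intro z e e'
    refine fderiv_apply_eq_of_hasLineDerivAt (hA e) ?_
    have l1 := hasDerivAt_line hg1 z e'
    have l2 := hasDerivAt_line (hdg e) z e'
    have l3 : HasDerivAt (fun t : ℝ => conj (g (z + t • e'))) (conj (fderiv ℝ g z e')) 0 :=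
      Complex.conjCLE.toContinuousLinearMap.hasFDerivAt.comp_hasDerivAt 0 l1
    have l4 := Complex.imCLM.hasFDerivAt.comp_hasDerivAt 0 (l3.mul l2)
    have := ((hasDerivAt_line hχ z e').mul (HasDerivAt.comp_norm_sq hF l1)).mul l4
    simp only [zero_smul, add_zero] at this
    refine this.congr_deriv ?_
    simp [Complex.add_im]
  -- The mixed second derivatives enter the exterior derivative with opposite signs, so by symmetry
  -- they cancel and only first derivatives survive the passage to Sobolev maps.
  have hsymm : ∀ z, fderiv ℝ (fun z => fderiv ℝ g z Complex.I) z 1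
      = fderiv ℝ (fun z => fderiv ℝ g z 1) z Complex.I := by
    intro z
    have hdd : DifferentiableAt ℝ (fderiv ℝ g) z :=
      (hg2.fderiv_right (m := 1) (by norm_num)).differentiable one_ne_zero z
    rw [fderiv_clm_apply hdd (differentiableAt_const _),
      fderiv_clm_apply hdd (differentiableAt_const _)]
    have := (hg2.contDiffAt (x := z)).isSymmSndFDerivAt (by simp)
    simpa using this 1 Complex.I
  have h1 := integral_fderiv_eq_zero_of_hasCompactSupport (hA Complex.I) (hAc Complex.I) 1
  have h2 := integral_fderiv_eq_zero_of_hasCompactSupport (hA 1) (hAc 1) Complex.I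
  have hi : ∀ e e', Integrable (fun z => fderiv ℝ
      (fun z => χ z * F (‖g z‖ ^ 2) * (conj (g z) * fderiv ℝ g z e).im) z e') := fun e e' =>
    (((hA e).continuous_fderiv one_ne_zero).clm_apply
      continuous_const).integrable_of_hasCompactSupport ((hAc e).fderiv_apply ℝ e')
  have h3 := integral_sub (hi Complex.I 1) (hi 1 Complex.I)
  rw [h1, h2, sub_zero] at h3
  have cdg := fun e => (hdg e).continuous
  have c1 := cdg 1
  have c2 := cdg Complex.I
  have cg := hg1.continuous
  have cχ' := fun e => (hχ.continuous_fderiv one_ne_zero).clm_apply (continuous_const (y := e))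
  have cχ1 := cχ' 1
  have cχ2 := cχ' Complex.I
  have cF := hFc.continuous
  have cχ := hχ.continuous
  have hcj := Complex.continuous_conj
  rw [← add_eq_zero_iff_eq_neg, ← integral_add, ← h3]
  · congr 1; ext1 z
    rw [hd, hd, hsymm]
    have hn : ‖g z‖ ^ 2 = (g z).re ^ 2 + (g z).im ^ 2 := by
      rw [← Complex.normSq_eq_norm_sq, Complex.normSq_apply]; ring
    simp only [Complex.mul_re, Complex.mul_im, Complex.conj_re, Complex.conj_im, Complex.add_im]
    have e2 : χ z * (2 * F' (‖g z‖ ^ 2) * ‖g z‖ ^ 2 + 2 * F (‖g z‖ ^ 2))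
      = χ z * (2 * F' (‖g z‖ ^ 2) * ((g z).re ^ 2 + (g z).im ^ 2) + 2 * F (‖g z‖ ^ 2)) := by rw [← hn]
    rw [e2]
    ring
  · refine Continuous.integrable_of_hasCompactSupport (by fun_prop) ?_
    exact HasCompactSupport.sub (hc.fderiv_apply ℝ 1).mul_right.mul_right
      (hc.fderiv_apply ℝ Complex.I).mul_right.mul_right
  · exact Continuous.integrable_of_hasCompactSupport (by fun_prop) hc.mul_right.mul_right

/-- A bounded function with square integrable weak partial derivatives `u`, `v`. -/
structure BddSobolev (X : Set ℂ) (f u v : ℂ → ℂ) (M : ℝ) : Prop where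
  isOpen : IsOpen X
  memLp : MemLp f 2 (volume.restrict X)
  memLp_x : MemLp u 2 (volume.restrict X)
  memLp_y : MemLp v 2 (volume.restrict X)
  weak_x : IsWeakPartial X 1 f u
  weak_y : IsWeakPartial X Complex.I f v
  nonneg : 0 ≤ M
  bound : ∀ᵐ z ∂(volume.restrict X), ‖f z‖ ≤ M

lemma setIntegral_eq_of_support {X K : Set ℂ} (hKX : K ⊆ X) {E : Type*} [NormedAddCommGroup E]
    [NormedSpace ℝ E] {G : ℂ → E} (hG : ∀ z ∉ K, G z = 0) :
    ∫ z in X, G z = ∫ z in K, G z := by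
  rw [setIntegral_eq_integral_of_forall_compl_eq_zero hG,
    setIntegral_eq_integral_of_forall_compl_eq_zero fun z hz => hG z fun h => hz (hKX h)]

lemma integral_eq_of_support {K : Set ℂ} {E : Type*} [NormedAddCommGroup E]
    [NormedSpace ℝ E] {G : ℂ → E} (hG : ∀ z ∉ K, G z = 0) :
    ∫ z, G z = ∫ z in K, G z :=
  (setIntegral_eq_integral_of_forall_compl_eq_zero hG).symm

lemma exists_bound_of_continuous {F : ℝ → ℝ} (hF : Continuous F) (M : ℝ) :
    ∃ C, 0 ≤ C ∧ ∀ w : ℂ, ‖w‖ ≤ M → |F (‖w‖ ^ 2)| ≤ C := by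
  obtain ⟨C, hC⟩ := (isCompact_Icc (a := 0) (b := M ^ 2)).exists_bound_of_continuousOn
    hF.continuousOn
  refine ⟨max C 0, le_max_right _ _, fun w hw => (hC _ ⟨by positivity, ?_⟩).trans (le_max_left _ _)⟩
  gcongr

lemma exists_bound_of_compactSupport {χ : ℂ → ℝ} (hχ : Continuous χ) (hc : HasCompactSupport χ) :
    ∃ C, 0 ≤ C ∧ ∀ z, |χ z| ≤ C := by
  obtain ⟨C, hC⟩ := hc.exists_bound_of_continuous hχ
  exact ⟨C, (norm_nonneg _).trans (hC 0), hC⟩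

lemma memLp_fderiv_apply {g : ℂ → ℂ} (hg : ContDiff ℝ ∞ g) {K : Set ℂ} (hK : IsCompact K) (e : ℂ) :
    MemLp (fun z => fderiv ℝ g z e) 2 (volume.restrict K) := by
  have hg1 : ContDiff ℝ 1 g := hg.of_le (by norm_cast)
  have hc : Continuous fun z => fderiv ℝ g z e :=
    (hg1.continuous_fderiv one_ne_zero).clm_apply continuous_const
  obtain ⟨C, hC⟩ := hK.exists_bound_of_continuousOn hc.continuousOn
  have : IsFiniteMeasure (volume.restrict K) :=
    ⟨by rw [Measure.restrict_apply_univ]; exact hK.measure_lt_top⟩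
  exact MemLp.of_bound hc.aestronglyMeasurable C
    ((ae_restrict_mem hK.measurableSet).mono fun z hz => hC z hz)

section chain
variable {X : Set ℂ} {f u v : ℂ → ℂ} {M : ℝ}

/-- Chain rule for `F(|f|²)` along a smooth approximating sequence. -/
lemma integral_fderiv_mul_comp_norm_sq_aux {w : ℂ → ℂ} {χ : ℂ → ℝ} (hχ : ContDiff ℝ 1 χ)
    (hc : HasCompactSupport χ) (hs : tsupport χ ⊆ X) {F F' : ℝ → ℝ}
    (hF : ∀ s, HasDerivAt F (F' s) s) (hF' : Continuous F') {g : ℕ → ℂ → ℂ} {e : ℂ}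
    (hg : ∀ n, ContDiff ℝ ∞ (g n)) (hgM : ∀ n z, ‖g n z‖ ≤ M)
    (hgf : ∀ᵐ z ∂(volume.restrict (tsupport χ)), Tendsto (fun n => g n z) atTop (𝓝 (f z)))
    (hw : MemLp w 2 (volume.restrict X))
    (hd : Tendsto (fun n => eLpNorm (fun z => fderiv ℝ (g n) z e - w z) 2
      (volume.restrict (tsupport χ))) atTop (𝓝 0)) :
    ∫ z in X, fderiv ℝ χ z e * F (‖f z‖ ^ 2)
      = - ∫ z in X, χ z * (F' (‖f z‖ ^ 2) * (2 * (conj (f z) * w z).re)) := by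
  have hFc := (contDiff_one_of_hasDerivAt hF hF').continuous
  have : IsFiniteMeasure (volume.restrict (tsupport χ)) :=
    ⟨by rw [Measure.restrict_apply_univ]; exact hc.measure_lt_top⟩
  have hwK : MemLp w 2 (volume.restrict (tsupport χ)) := hw.mono_measure (Measure.restrict_mono_set _ hs)
  have h0 : ∀ n, ∫ z in tsupport χ, fderiv ℝ χ z e * F (‖g n z‖ ^ 2)
      = - ∫ z in tsupport χ, χ z * (F' (‖g n z‖ ^ 2) * (2 * (conj (g n z) * fderiv ℝ (g n) z e).re)) := by
    intro n
    have := integral_fderiv_mul_comp_norm_sq_of_smooth hχ hc hF hF' (hg n) e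
    rw [integral_eq_of_support (K := tsupport χ), integral_eq_of_support (K := tsupport χ)] at this
    · exact this
    · intro z hz; rw [image_eq_zero_of_notMem_tsupport hz, zero_mul]
    · intro z hz; rw [fderiv_of_notMem_tsupport ℝ hz]; simp
  rw [setIntegral_eq_of_support hs, setIntegral_eq_of_support hs]
  rotate_left
  · intro z hz; rw [image_eq_zero_of_notMem_tsupport hz, zero_mul]
  · intro z hz; rw [fderiv_of_notMem_tsupport ℝ hz]; simp
  obtain ⟨C1, hC1, hFb⟩ := exists_bound_of_continuous hFc M
  obtain ⟨C2, hC2, hFb'⟩ := exists_bound_of_continuous hF' M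
  obtain ⟨C3, hC3, hχb⟩ := exists_bound_of_compactSupport hχ.continuous hc
  have cg : ∀ n, Continuous (g n) := fun n => (hg n).continuous
  have cχ := (hχ.continuous_fderiv one_ne_zero).clm_apply (continuous_const (y := e))
  have cχ0 := hχ.continuous
  have L1 : Tendsto (fun n => ∫ z in tsupport χ, fderiv ℝ χ z e * F (‖g n z‖ ^ 2)) atTop
      (𝓝 (∫ z in tsupport χ, fderiv ℝ χ z e * F (‖f z‖ ^ 2))) := by
    refine tendsto_integral_of_dominated_convergence (fun z => |fderiv ℝ χ z e| * C1) (fun n => ?_)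
      ?_ (fun n => Eventually.of_forall fun z => ?_) ?_
    · have := cg n
      exact Continuous.aestronglyMeasurable (by fun_prop)
    · exact ((cχ.abs.mul continuous_const).continuousOn).integrableOn_compact hc
    · rw [Real.norm_eq_abs, abs_mul]
      exact mul_le_mul_of_nonneg_left (hFb _ (hgM n z)) (abs_nonneg _)
    · filter_upwards [hgf] with z hz
      exact ((hFc.tendsto _).comp (hz.norm.pow 2)).const_mul _
  have key := tendsto_integral_mul_of_bounded (μ := volume.restrict (tsupport χ))
    (a := fun n z => ((χ z * (F' (‖g n z‖ ^ 2) * 2) : ℝ) : ℂ) * conj (g n z))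
    (a' := fun z => ((χ z * (F' (‖f z‖ ^ 2) * 2) : ℝ) : ℂ) * conj (f z))
    (b := fun n z => fderiv ℝ (g n) z e) (b' := w) (C := C3 * (C2 * 2) * M)
    (fun n => by
      have := cg n
      have hcj := Complex.continuous_conj
      have hor := Complex.continuous_ofReal
      exact Continuous.aestronglyMeasurable (by fun_prop))
    (fun n z => by
      rw [norm_mul, RCLike.norm_conj, Complex.norm_real, Real.norm_eq_abs, abs_mul, abs_mul, abs_two]
      have h1 := hχb z
      have h2 := hFb' _ (hgM n z)
      have h3 := hgM n z
      gcongr)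
    (by
      filter_upwards [hgf] with z hz
      refine Tendsto.mul ?_ ((Complex.continuous_conj.tendsto _).comp hz)
      exact (Complex.continuous_ofReal.tendsto _).comp
        ((((hF'.tendsto _).comp (hz.norm.pow 2)).mul_const 2).const_mul _))
    (fun n => (memLp_fderiv_apply (hg n) hc e).integrable (by norm_num))
    (hwK.integrable (by norm_num))
    (tendsto_eLpNorm_one_of_two (fun n => (memLp_fderiv_apply (hg n) hc e).1) hwK.1 hd)
  have hfm : AEStronglyMeasurable f (volume.restrict (tsupport χ)) :=
    aestronglyMeasurable_of_tendsto_ae atTop (fun n => (cg n).aestronglyMeasurable) hgf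
  have hfM : ∀ᵐ z ∂(volume.restrict (tsupport χ)), ‖f z‖ ≤ M := by
    filter_upwards [hgf] with z hz
    exact le_of_tendsto hz.norm (Eventually.of_forall fun n => hgM n z)
  have re_int : ∀ {p q : ℂ → ℂ}, AEStronglyMeasurable p (volume.restrict (tsupport χ)) →
      (∀ᵐ z ∂(volume.restrict (tsupport χ)), ‖p z‖ ≤ M) →
      MemLp q 2 (volume.restrict (tsupport χ)) →
      ∫ z in tsupport χ, χ z * (F' (‖p z‖ ^ 2) * (2 * (conj (p z) * q z).re))
        = (∫ z in tsupport χ, ((χ z * (F' (‖p z‖ ^ 2) * 2) : ℝ) : ℂ) * conj (p z) * q z).re := by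
    intro p q hp hpM hq
    have hi : Integrable (fun z => ((χ z * (F' (‖p z‖ ^ 2) * 2) : ℝ) : ℂ) * conj (p z) * q z)
        (volume.restrict (tsupport χ)) := by
      refine (hq.integrable (by norm_num)).bdd_mul (c := C3 * (C2 * 2) * M) ?_ ?_
      · refine (Complex.continuous_ofReal.comp_aestronglyMeasurable ?_).mul
          (Complex.continuous_conj.comp_aestronglyMeasurable hp)
        exact cχ0.aestronglyMeasurable.mul
          ((hF'.comp_aestronglyMeasurable (hp.norm.pow 2)).mul_const 2)
      · filter_upwards [hpM] with z h3
        rw [norm_mul, RCLike.norm_conj, Complex.norm_real, Real.norm_eq_abs, abs_mul, abs_mul, abs_two]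
        have h1 := hχb z
        have h2 := hFb' _ h3
        gcongr
    have := Complex.reCLM.integral_comp_comm hi
    simp only [Complex.reCLM_apply] at this
    rw [← this]
    congr 1; ext1 z
    rw [mul_assoc, Complex.re_ofReal_mul]; ring
  refine tendsto_nhds_unique L1 ?_
  simp_rw [h0]
  refine Tendsto.neg ?_
  rw [re_int hfm hfM hwK]
  have := (Complex.continuous_re.tendsto _).comp key
  refine this.congr fun n => ?_
  exact (re_int (cg n).aestronglyMeasurable (Eventually.of_forall (hgM n))
    (memLp_fderiv_apply (hg n) hc e)).symm

/-- The chain rule for `F(|f|²)` in weak form, for bounded Sobolev functions `f`. -/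
lemma BddSobolev.integral_fderiv_mul_comp_norm_sq (h : BddSobolev X f u v M) {χ : ℂ → ℝ}
    (hχ : ContDiff ℝ 1 χ) (hc : HasCompactSupport χ) (hs : tsupport χ ⊆ X) {F F' : ℝ → ℝ}
    (hF : ∀ s, HasDerivAt F (F' s) s) (hF' : Continuous F') :
    ∫ z in X, fderiv ℝ χ z 1 * F (‖f z‖ ^ 2)
      = - ∫ z in X, χ z * (F' (‖f z‖ ^ 2) * (2 * (conj (f z) * u z).re)) ∧
    ∫ z in X, fderiv ℝ χ z Complex.I * F (‖f z‖ ^ 2)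
      = - ∫ z in X, χ z * (F' (‖f z‖ ^ 2) * (2 * (conj (f z) * v z).re)) := by
  obtain ⟨g, hg, hgM, hgf, h1, h2⟩ := exists_smooth_approx h.isOpen h.memLp h.memLp_x h.memLp_y
    h.weak_x h.weak_y h.nonneg h.bound hc hs
  exact ⟨integral_fderiv_mul_comp_norm_sq_aux hχ hc hs hF hF' hg hgM hgf h.memLp_x h1,
    integral_fderiv_mul_comp_norm_sq_aux hχ hc hs hF hF' hg hgM hgf h.memLp_y h2⟩

/-- The pull back of `F(|w|²) Im (conj w dw)` under a bounded Sobolev map, and its weak exterior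
derivative. -/
lemma BddSobolev.integral_angular_form (h : BddSobolev X f u v M) {χ : ℂ → ℝ}
    (hχ : ContDiff ℝ 1 χ) (hc : HasCompactSupport χ) (hs : tsupport χ ⊆ X) {F F' : ℝ → ℝ}
    (hF : ∀ s, HasDerivAt F (F' s) s) (hF' : Continuous F') :
    ∫ z in X, (fderiv ℝ χ z 1 * F (‖f z‖ ^ 2) * (conj (f z) * v z).im
        - fderiv ℝ χ z Complex.I * F (‖f z‖ ^ 2) * (conj (f z) * u z).im)
      = - ∫ z in X, χ z * (2 * F' (‖f z‖ ^ 2) * ‖f z‖ ^ 2 + 2 * F (‖f z‖ ^ 2))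
          * (conj (u z) * v z).im := by
  obtain ⟨g, hg, hgM, hgf, hd1, hd2⟩ := exists_smooth_approx h.isOpen h.memLp h.memLp_x h.memLp_y
    h.weak_x h.weak_y h.nonneg h.bound hc hs
  have hFc := (contDiff_one_of_hasDerivAt hF hF').continuous
  set μ := volume.restrict (tsupport χ) with hμ
  have : IsFiniteMeasure μ :=
    ⟨by rw [hμ, Measure.restrict_apply_univ]; exact hc.measure_lt_top⟩
  have huK : MemLp u 2 μ := h.memLp_x.mono_measure (Measure.restrict_mono_set _ hs)
  have hvK : MemLp v 2 μ := h.memLp_y.mono_measure (Measure.restrict_mono_set _ hs)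
  have hχ0 : ∀ z ∉ tsupport χ, χ z = 0 := fun z hz => image_eq_zero_of_notMem_tsupport hz
  have hχ1 : ∀ e, ∀ z ∉ tsupport χ, fderiv ℝ χ z e = 0 := fun e z hz => by
    rw [fderiv_of_notMem_tsupport ℝ hz]; simp
  have h0 : ∀ n, ∫ z, (fderiv ℝ χ z 1 * F (‖g n z‖ ^ 2) * (conj (g n z) * fderiv ℝ (g n) z Complex.I).im
        - fderiv ℝ χ z Complex.I * F (‖g n z‖ ^ 2) * (conj (g n z) * fderiv ℝ (g n) z 1).im) ∂μ
      = - ∫ z, χ z * (2 * F' (‖g n z‖ ^ 2) * ‖g n z‖ ^ 2 + 2 * F (‖g n z‖ ^ 2))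
          * (conj (fderiv ℝ (g n) z 1) * fderiv ℝ (g n) z Complex.I).im ∂μ := by
    intro n
    have := integral_angular_form_of_smooth hχ hc hF hF' (hg n)
    rw [integral_eq_of_support (K := tsupport χ), integral_eq_of_support (K := tsupport χ)] at this
    · exact this
    · intro z hz; rw [hχ0 z hz, zero_mul, zero_mul]
    · intro z hz; rw [hχ1 _ z hz, hχ1 _ z hz]; ring
  rw [setIntegral_eq_of_support hs, setIntegral_eq_of_support hs]
  rotate_left
  · intro z hz; rw [hχ0 z hz, zero_mul, zero_mul]
  · intro z hz; rw [hχ1 _ z hz, hχ1 _ z hz]; ring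
  obtain ⟨C1, hC1, hFb⟩ := exists_bound_of_continuous hFc M
  have cF2 : Continuous fun s => 2 * F' s * s + 2 * F s := by fun_prop
  obtain ⟨C2, hC2, hFb'⟩ := exists_bound_of_continuous cF2 M
  obtain ⟨C3, hC3, hχb⟩ := exists_bound_of_compactSupport hχ.continuous hc
  have cg : ∀ n, Continuous (g n) := fun n => (hg n).continuous
  have cχ := fun e => (hχ.continuous_fderiv one_ne_zero).clm_apply (continuous_const (y := e))
  have hχb' := fun e => exists_bound_of_compactSupport (cχ e) (hc.fderiv_apply ℝ e)
  have hfm : AEStronglyMeasurable f μ :=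
    aestronglyMeasurable_of_tendsto_ae atTop (fun n => (cg n).aestronglyMeasurable) hgf
  have hfM : ∀ᵐ z ∂μ, ‖f z‖ ≤ M := by
    filter_upwards [hgf] with z hz
    exact le_of_tendsto hz.norm (Eventually.of_forall fun n => hgM n z)
  have hgd : ∀ n e, MemLp (fun z => fderiv ℝ (g n) z e) 2 μ := fun n e =>
    memLp_fderiv_apply (hg n) hc e
  -- The first order terms
  have lin_int : ∀ (e : ℂ) {p q : ℂ → ℂ}, AEStronglyMeasurable p μ → (∀ᵐ z ∂μ, ‖p z‖ ≤ M) →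
      MemLp q 2 μ →
      Integrable (fun z => ((fderiv ℝ χ z e * F (‖p z‖ ^ 2) : ℝ) : ℂ) * conj (p z) * q z) μ := by
    intro e p q hp hpM hq
    obtain ⟨C, hC, hb⟩ := hχb' e
    refine (hq.integrable (by norm_num)).bdd_mul (c := C * C1 * M) ?_ ?_
    · refine (Complex.continuous_ofReal.comp_aestronglyMeasurable ?_).mul
        (Complex.continuous_conj.comp_aestronglyMeasurable hp)
      exact (cχ e).aestronglyMeasurable.mul (hFc.comp_aestronglyMeasurable (hp.norm.pow 2))
    · filter_upwards [hpM] with z h3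
      rw [norm_mul, RCLike.norm_conj, Complex.norm_real, Real.norm_eq_abs, abs_mul]
      have h1 := hb z
      have h2 := hFb _ h3
      gcongr
  have lin_im : ∀ (e : ℂ) {p q : ℂ → ℂ}, AEStronglyMeasurable p μ → (∀ᵐ z ∂μ, ‖p z‖ ≤ M) →
      MemLp q 2 μ →
      Integrable (fun z => fderiv ℝ χ z e * F (‖p z‖ ^ 2) * (conj (p z) * q z).im) μ ∧
      ∫ z, fderiv ℝ χ z e * F (‖p z‖ ^ 2) * (conj (p z) * q z).im ∂μ
        = (∫ z, ((fderiv ℝ χ z e * F (‖p z‖ ^ 2) : ℝ) : ℂ) * conj (p z) * q z ∂μ).im := by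
    intro e p q hp hpM hq
    have hi := lin_int e hp hpM hq
    have e1 : (fun z => fderiv ℝ χ z e * F (‖p z‖ ^ 2) * (conj (p z) * q z).im)
        = fun z => Complex.imCLM (((fderiv ℝ χ z e * F (‖p z‖ ^ 2) : ℝ) : ℂ) * conj (p z) * q z) := by
      ext1 z
      rw [Complex.imCLM_apply, mul_assoc (_ : ℂ), Complex.im_ofReal_mul]
    rw [e1]
    exact ⟨Complex.imCLM.integrable_comp hi, Complex.imCLM.integral_comp_comm hi⟩
  have lin_lim : ∀ (e e' : ℂ) {w : ℂ → ℂ}, MemLp w 2 μ →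
      Tendsto (fun n => eLpNorm (fun z => fderiv ℝ (g n) z e' - w z) 2 μ) atTop (𝓝 0) →
      Tendsto (fun n => ∫ z, fderiv ℝ χ z e * F (‖g n z‖ ^ 2)
          * (conj (g n z) * fderiv ℝ (g n) z e').im ∂μ) atTop
        (𝓝 (∫ z, fderiv ℝ χ z e * F (‖f z‖ ^ 2) * (conj (f z) * w z).im ∂μ)) := by
    intro e e' w hw hlim
    obtain ⟨C, hC, hb⟩ := hχb' e
    have key := tendsto_integral_mul_of_bounded (μ := μ)
      (a := fun n z => ((fderiv ℝ χ z e * F (‖g n z‖ ^ 2) : ℝ) : ℂ) * conj (g n z))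
      (a' := fun z => ((fderiv ℝ χ z e * F (‖f z‖ ^ 2) : ℝ) : ℂ) * conj (f z))
      (b := fun n z => fderiv ℝ (g n) z e') (b' := w) (C := C * C1 * M)
      (fun n => by
        have := cg n
        have := cχ e
        have hcj := Complex.continuous_conj
        have hor := Complex.continuous_ofReal
        exact Continuous.aestronglyMeasurable (by fun_prop))
      (fun n z => by
        rw [norm_mul, RCLike.norm_conj, Complex.norm_real, Real.norm_eq_abs, abs_mul]
        have h1 := hb z
        have h2 := hFb _ (hgM n z)
        have h3 := hgM n z
        gcongr)
      (by
        filter_upwards [hgf] with z hz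
        refine Tendsto.mul ?_ ((Complex.continuous_conj.tendsto _).comp hz)
        exact (Complex.continuous_ofReal.tendsto _).comp
          (((hFc.tendsto _).comp (hz.norm.pow 2)).const_mul _))
      (fun n => (hgd n e').integrable (by norm_num)) (hw.integrable (by norm_num))
      (tendsto_eLpNorm_one_of_two (fun n => (hgd n e').1) hw.1 hlim)
    rw [(lin_im e hfm hfM hw).2]
    refine ((Complex.continuous_im.tendsto _).comp key).congr fun n => ?_
    exact (lin_im e (cg n).aestronglyMeasurable (Eventually.of_forall (hgM n)) (hgd n e')).2.symm
  -- the Jacobian term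
  have jac_im : ∀ {p q q' : ℂ → ℂ}, AEStronglyMeasurable p μ → (∀ᵐ z ∂μ, ‖p z‖ ≤ M) →
      MemLp q 2 μ → MemLp q' 2 μ →
      ∫ z, χ z * (2 * F' (‖p z‖ ^ 2) * ‖p z‖ ^ 2 + 2 * F (‖p z‖ ^ 2)) * (conj (q z) * q' z).im ∂μ
        = (∫ z, ((χ z * (2 * F' (‖p z‖ ^ 2) * ‖p z‖ ^ 2 + 2 * F (‖p z‖ ^ 2)) : ℝ) : ℂ)
            * (conj (q z) * q' z) ∂μ).im := by
    intro p q q' hp hpM hq hq'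
    have hqq : Integrable (fun z => conj (q z) * q' z) μ := hq.star.integrable_mul hq'
    have hi : Integrable (fun z => ((χ z * (2 * F' (‖p z‖ ^ 2) * ‖p z‖ ^ 2 + 2 * F (‖p z‖ ^ 2)) : ℝ) : ℂ)
            * (conj (q z) * q' z)) μ := by
      refine hqq.bdd_mul (c := C3 * C2) ?_ ?_
      · refine Complex.continuous_ofReal.comp_aestronglyMeasurable ?_
        exact hχ.continuous.aestronglyMeasurable.mul (cF2.comp_aestronglyMeasurable (hp.norm.pow 2))
      · filter_upwards [hpM] with z h3
        rw [Complex.norm_real, Real.norm_eq_abs, abs_mul]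
        have h1 := hχb z
        have h2 := hFb' _ h3
        gcongr
    have := Complex.imCLM.integral_comp_comm hi
    simp only [Complex.imCLM_apply] at this
    rw [← this]
    congr 1; ext1 z
    rw [Complex.im_ofReal_mul]
  have jac_lim : Tendsto (fun n => ∫ z, χ z * (2 * F' (‖g n z‖ ^ 2) * ‖g n z‖ ^ 2
        + 2 * F (‖g n z‖ ^ 2)) * (conj (fderiv ℝ (g n) z 1) * fderiv ℝ (g n) z Complex.I).im ∂μ) atTop
      (𝓝 (∫ z, χ z * (2 * F' (‖f z‖ ^ 2) * ‖f z‖ ^ 2 + 2 * F (‖f z‖ ^ 2))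
        * (conj (u z) * v z).im ∂μ)) := by
    have key := tendsto_integral_mul_of_bounded (μ := μ)
      (a := fun n z => ((χ z * (2 * F' (‖g n z‖ ^ 2) * ‖g n z‖ ^ 2 + 2 * F (‖g n z‖ ^ 2)) : ℝ) : ℂ))
      (a' := fun z => ((χ z * (2 * F' (‖f z‖ ^ 2) * ‖f z‖ ^ 2 + 2 * F (‖f z‖ ^ 2)) : ℝ) : ℂ))
      (b := fun n z => conj (fderiv ℝ (g n) z 1) * fderiv ℝ (g n) z Complex.I)
      (b' := fun z => conj (u z) * v z) (C := C3 * C2)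
      (fun n => by
        have := cg n
        have := hχ.continuous
        have hor := Complex.continuous_ofReal
        exact Continuous.aestronglyMeasurable (by fun_prop))
      (fun n z => by
        rw [Complex.norm_real, Real.norm_eq_abs, abs_mul]
        have h1 := hχb z
        have h2 := hFb' _ (hgM n z)
        gcongr)
      (by
        filter_upwards [hgf] with z hz
        exact (Complex.continuous_ofReal.tendsto _).comp
          (((cF2.tendsto _).comp (hz.norm.pow 2)).const_mul _))
      (fun n => (hgd n 1).star.integrable_mul (hgd n Complex.I)) (huK.star.integrable_mul hvK)
      (tendsto_eLpNorm_conj_mul (fun n => (hgd n 1).1) huK (fun n => (hgd n Complex.I).1) hvK hd1 hd2)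
    rw [jac_im hfm hfM huK hvK]
    refine ((Complex.continuous_im.tendsto _).comp key).congr fun n => ?_
    exact (jac_im (cg n).aestronglyMeasurable (Eventually.of_forall (hgM n)) (hgd n 1)
      (hgd n Complex.I)).symm
  have lhs := (lin_lim 1 Complex.I hvK hd2).sub (lin_lim Complex.I 1 huK hd1)
  rw [← integral_sub (lin_im 1 hfm hfM hvK).1 (lin_im Complex.I hfm hfM huK).1] at lhs
  refine tendsto_nhds_unique lhs (jac_lim.neg.congr fun n => ?_)
  rw [← h0 n, integral_sub (lin_im 1 (cg n).aestronglyMeasurable (Eventually.of_forall (hgM n))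
    (hgd n Complex.I)).1 (lin_im Complex.I (cg n).aestronglyMeasurable
      (Eventually.of_forall (hgM n)) (hgd n 1)).1]

end chain

/-! ### Radial test functions and strips along the boundary circles -/

lemma mem_annulus_iff_sq {r : ℝ} (hr : 1 < r) {z : ℂ} :
    z ∈ annulus 1 r ↔ ‖z‖ ^ 2 ∈ Ioo 1 (r ^ 2) := by
  have h0 := norm_nonneg z
  constructor
  · rintro ⟨h1, h2⟩
    exact ⟨by nlinarith, by nlinarith⟩
  · rintro ⟨h1, h2⟩
    exact ⟨by nlinarith, by nlinarith⟩

/-- `Z` is a `C¹` function on `[1, r²]` with derivative `Z'`; it is used as a function of `|z|²`. -/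
structure RadialTest (r : ℝ) (Z Z' : ℝ → ℝ) : Prop where
  cont : ContinuousOn Z (Icc 1 (r ^ 2))
  cont' : ContinuousOn Z' (Icc 1 (r ^ 2))
  deriv : ∀ τ ∈ Ioo 1 (r ^ 2), HasDerivAt Z (Z' τ) τ

lemma RadialTest.of_global {r : ℝ} {Z Z' : ℝ → ℝ} (h : ∀ τ, HasDerivAt Z (Z' τ) τ)
    (h' : Continuous Z') : RadialTest r Z Z' :=
  ⟨(continuous_iff_continuousAt.2 fun τ => (h τ).continuousAt).continuousOn, h'.continuousOn,
    fun τ _ => h τ⟩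

lemma RadialTest.mul {r : ℝ} {Z Z' W W' : ℝ → ℝ} (h : RadialTest r Z Z') (k : RadialTest r W W') :
    RadialTest r (fun τ => Z τ * W τ) (fun τ => Z' τ * W τ + Z τ * W' τ) :=
  ⟨h.cont.mul k.cont, (h.cont'.mul k.cont).add (h.cont.mul k.cont'),
    fun τ hτ => (h.deriv τ hτ).mul (k.deriv τ hτ)⟩

lemma RadialTest.const_mul {r : ℝ} {Z Z' : ℝ → ℝ} (h : RadialTest r Z Z') (c : ℝ) :
    RadialTest r (fun τ => c * Z τ) (fun τ => c * Z' τ) :=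
  ⟨continuousOn_const.mul h.cont, continuousOn_const.mul h.cont',
    fun τ hτ => (h.deriv τ hτ).const_mul c⟩

lemma RadialTest.exists_bound {r : ℝ} {Z Z' : ℝ → ℝ} (h : RadialTest r Z Z') :
    ∃ C, 0 ≤ C ∧ ∀ τ ∈ Icc 1 (r ^ 2), |Z τ| ≤ C ∧ |Z' τ| ≤ C := by
  obtain ⟨C1, h1⟩ := isCompact_Icc.exists_bound_of_continuousOn h.cont
  obtain ⟨C2, h2⟩ := isCompact_Icc.exists_bound_of_continuousOn h.cont'
  exact ⟨max (max C1 C2) 0, le_max_right _ _, fun τ hτ =>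
    ⟨(h1 τ hτ).trans ((le_max_left _ _).trans (le_max_left _ _)),
      (h2 τ hτ).trans ((le_max_right _ _).trans (le_max_left _ _))⟩⟩

lemma aestronglyMeasurable_comp_normSq {r : ℝ} (hr : 1 < r) {Z : ℝ → ℝ}
    (hZ : ContinuousOn Z (Icc 1 (r ^ 2))) :
    AEStronglyMeasurable (fun z : ℂ => Z (‖z‖ ^ 2)) (volume.restrict (annulus 1 r)) := by
  refine ContinuousOn.aestronglyMeasurable ?_ (measurableSet_annulus 1 r)
  exact hZ.comp (by fun_prop) fun z hz => Ioo_subset_Icc_self ((mem_annulus_iff_sq hr).1 hz)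

lemma integrable_mul_comp_normSq {r : ℝ} (hr : 1 < r) {Z : ℝ → ℝ}
    (hZ : ContinuousOn Z (Icc 1 (r ^ 2))) {a : ℂ → ℝ} (ha : IntegrableOn a (annulus 1 r)) :
    IntegrableOn (fun z => a z * Z (‖z‖ ^ 2)) (annulus 1 r) := by
  obtain ⟨C, hC⟩ := isCompact_Icc.exists_bound_of_continuousOn hZ
  refine Integrable.mul_bdd (c := C) ha (aestronglyMeasurable_comp_normSq hr hZ) ?_
  refine (ae_restrict_mem (measurableSet_annulus 1 r)).mono fun z hz => ?_
  exact hC _ (Ioo_subset_Icc_self ((mem_annulus_iff_sq hr).1 hz))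

lemma integrable_comp_normSq {r : ℝ} (hr : 1 < r) {Z : ℝ → ℝ}
    (hZ : ContinuousOn Z (Icc 1 (r ^ 2))) :
    IntegrableOn (fun z : ℂ => Z (‖z‖ ^ 2)) (annulus 1 r) := by
  have := integrable_mul_comp_normSq hr hZ (a := fun _ => 1) (integrable_const _)
  simpa using this

/-- Integration of radial functions over an annulus. -/
lemma integral_annulus_comp_normSq {r : ℝ} (hr : 1 < r) {h : ℝ → ℝ}
    (hh : ContinuousOn h (Icc 1 (r ^ 2))) :
    ∫ z in annulus 1 r, h (‖z‖ ^ 2) = Real.pi * ∫ τ in (1 : ℝ)..(r ^ 2), h τ := by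
  have h1 : ∫ z in annulus 1 r, h (‖z‖ ^ 2)
      = ∫ z, (annulus 1 r).indicator (fun z => h (‖z‖ ^ 2)) z :=
    (integral_indicator (measurableSet_annulus 1 r)).symm
  rw [h1, ← Complex.integral_comp_polarCoord_symm]
  have h2 : ∀ p ∈ polarCoord.target, p.1 • (annulus 1 r).indicator (fun z => h (‖z‖ ^ 2))
      (Complex.polarCoord.symm p) = ((Ioo 1 r).indicator (fun t => t * h (t ^ 2)) p.1) * (1 : ℝ) := by
    intro p hp
    rw [polarCoord_target] at hp
    have hp0 : 0 < p.1 := hp.1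
    have hn : ‖Complex.polarCoord.symm p‖ = p.1 := by
      rw [Complex.norm_polarCoord_symm, abs_of_pos hp0]
    by_cases hin : p.1 ∈ Ioo 1 r
    · have : Complex.polarCoord.symm p ∈ annulus 1 r := by
        change 1 < ‖_‖ ∧ ‖_‖ < r; rw [hn]; exact hin
      rw [indicator_of_mem this, indicator_of_mem hin, hn]; simp
    · have : Complex.polarCoord.symm p ∉ annulus 1 r := by
        change ¬ (1 < ‖_‖ ∧ ‖_‖ < r); rw [hn]; exact hin
      rw [indicator_of_notMem this, indicator_of_notMem hin]; simp
  rw [setIntegral_congr_fun (polarCoord.open_target.measurableSet) h2, polarCoord_target,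
    Measure.volume_eq_prod, setIntegral_prod_mul (fun t => (Ioo 1 r).indicator (fun t => t * h (t ^ 2)) t)
      (fun _ => (1 : ℝ))]
  have h3 : ∫ t in Ioi 0, (Ioo 1 r).indicator (fun t => t * h (t ^ 2)) t
      = ∫ t in (1 : ℝ)..r, t * h (t ^ 2) := by
    rw [setIntegral_indicator measurableSet_Ioo, intervalIntegral.integral_of_le hr.le,
      integral_Ioc_eq_integral_Ioo]
    congr 2
    ext t; simp only [mem_inter_iff, mem_Ioi, mem_Ioo]
    exact ⟨fun h => h.2, fun h => ⟨by linarith [h.1], h⟩⟩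
  -- The substitution τ = t² produces the factor 2t, so the angular factor 2π turns into π.
  have h4 : ∫ t in (1 : ℝ)..r, (h ∘ fun t => t ^ 2) t * (2 * t) = ∫ τ in ((1 : ℝ) ^ 2)..(r ^ 2), h τ := by
    refine intervalIntegral.integral_comp_mul_deriv'' (by fun_prop)
      (fun t _ => ?_) (by fun_prop) ?_
    · simpa using (hasDerivAt_pow 2 t).hasDerivWithinAt
    · refine hh.mono ?_
      rw [uIcc_of_le hr.le]
      rintro _ ⟨t, ht, rfl⟩
      exact ⟨by nlinarith [ht.1], by nlinarith [ht.1, ht.2]⟩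
  rw [one_pow] at h4
  rw [h3, ← h4, ← intervalIntegral.integral_const_mul]
  simp only [integral_const, MeasurableSet.univ, measureReal_restrict_apply, univ_inter,
    Real.volume_real_Ioo, smul_eq_mul, mul_one, Function.comp_apply]
  rw [max_eq_left (by linarith [Real.pi_pos]), ← intervalIntegral.integral_mul_const]
  congr 1; ext t; ring

lemma RadialTest.integral_deriv {r : ℝ} (hr : 1 < r) {Z Z' : ℝ → ℝ} (h : RadialTest r Z Z') :
    ∫ z in annulus 1 r, Z' (‖z‖ ^ 2) = Real.pi * (Z (r ^ 2) - Z 1) := by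
  have h1 : (1 : ℝ) ≤ r ^ 2 := by nlinarith
  rw [integral_annulus_comp_normSq hr h.cont',
    intervalIntegral.integral_eq_sub_of_hasDerivAt_of_le h1 h.cont h.deriv]
  exact ContinuousOn.intervalIntegrable (by rw [uIcc_of_le h1]; exact h.cont')

/-- The part of the annulus where `|z|²` is `ε`-close to `τ₀`. -/
def strip (r τ₀ ε : ℝ) : Set ℂ := {z ∈ annulus 1 r | |‖z‖ ^ 2 - τ₀| < ε}

lemma measurableSet_strip (r τ₀ ε : ℝ) : MeasurableSet (strip r τ₀ ε) :=
  (measurableSet_annulus 1 r).inter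
    (isOpen_lt (by fun_prop : Continuous fun z : ℂ => |‖z‖ ^ 2 - τ₀|) continuous_const).measurableSet

lemma strip_subset (r τ₀ ε : ℝ) : strip r τ₀ ε ⊆ annulus 1 r := fun _ h => h.1

/-- The mean of `|a|` over thin strips along the circle `|z|² = τ₀` tends to zero. -/
def StripVanish (r τ₀ : ℝ) (a : ℂ → ℝ) : Prop :=
  Tendsto (fun ε : ℝ => ε⁻¹ * ∫ z in strip r τ₀ ε, |a z|) (𝓝[>] 0) (𝓝 0)

/-- The strips shrink to the circle |z|² = τ₀, which the open annulus does not meet, so dominated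
convergence applies. -/
lemma tendsto_integral_strip {r τ₀ : ℝ} (hr : 1 < r) (hτ : τ₀ ∉ Ioo 1 (r ^ 2)) {a : ℂ → ℝ}
    (ha : IntegrableOn a (annulus 1 r)) :
    Tendsto (fun ε : ℝ => ∫ z in strip r τ₀ ε, |a z|) (𝓝[>] 0) (𝓝 0) := by
  have e : ∀ ε, ∫ z in strip r τ₀ ε, |a z|
      = ∫ z in annulus 1 r, (strip r τ₀ ε).indicator (fun z => |a z|) z := by
    intro ε
    rw [setIntegral_indicator (measurableSet_strip r τ₀ ε),
      inter_eq_self_of_subset_right (strip_subset r τ₀ ε)]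
  simp_rw [e]
  have hz : (𝓝 (0 : ℝ)) = 𝓝 (∫ z in annulus 1 r, (0 : ℝ)) := by simp
  rw [hz]
  refine tendsto_integral_filter_of_dominated_convergence (fun z => |a z|)
    (Eventually.of_forall fun ε => (ha.1.norm.indicator (measurableSet_strip r τ₀ ε)))
    (Eventually.of_forall fun ε => Eventually.of_forall fun z => ?_) ha.abs ?_
  · refine (norm_indicator_le_norm_self _ _).trans ?_
    simp
  · refine (ae_restrict_mem (measurableSet_annulus 1 r)).mono fun z hz => ?_
    have hne : 0 < |‖z‖ ^ 2 - τ₀| := by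
      rw [abs_pos, sub_ne_zero]
      rintro rfl
      exact hτ ((mem_annulus_iff_sq hr).1 hz)
    refine tendsto_const_nhds.congr' ?_
    filter_upwards [nhdsWithin_le_nhds (Iio_mem_nhds hne)] with ε hε
    rw [indicator_of_notMem]
    exact fun h => lt_asymm h.2 hε

/-- On the strip of width ε the factor | |z|² - τ₀ | is less than ε and cancels the ε⁻¹ of the mean.
An error term carrying this factor therefore needs only integrability of `w`. -/
lemma StripVanish.of_le {r τ₀ : ℝ} (hr : 1 < r) (hτ : τ₀ ∉ Ioo 1 (r ^ 2)) {a b w : ℂ → ℝ} {C : ℝ}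
    (hb : StripVanish r τ₀ b) (hbi : IntegrableOn b (annulus 1 r))
    (hwi : IntegrableOn w (annulus 1 r))
    (h : ∀ᵐ z ∂(volume.restrict (annulus 1 r)), |a z| ≤ C * |b z| + |‖z‖ ^ 2 - τ₀| * |w z|) :
    StripVanish r τ₀ a := by
  have h0 := (hb.const_mul C).add (tendsto_integral_strip hr hτ hwi)
  rw [mul_zero, add_zero] at h0
  refine tendsto_of_tendsto_of_tendsto_of_le_of_le' tendsto_const_nhds h0 ?_ ?_
  · filter_upwards [self_mem_nhdsWithin] with ε hε
    exact mul_nonneg (inv_nonneg.2 (le_of_lt hε)) (integral_nonneg fun z => abs_nonneg _)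
  · filter_upwards [self_mem_nhdsWithin] with ε hε
    have hε : 0 < ε := hε
    have ib : IntegrableOn (fun z => |b z|) (strip r τ₀ ε) := (hbi.mono_set (strip_subset r τ₀ ε)).abs
    have iw : IntegrableOn (fun z => |w z|) (strip r τ₀ ε) := (hwi.mono_set (strip_subset r τ₀ ε)).abs
    have hle : ∫ z in strip r τ₀ ε, |a z| ≤ ∫ z in strip r τ₀ ε, (C * |b z| + ε * |w z|) := by
      refine integral_mono_of_nonneg (Eventually.of_forall fun z => abs_nonneg _)
        ((ib.const_mul C).add (iw.const_mul ε)) ?_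
      filter_upwards [ae_restrict_of_ae_restrict_of_subset (strip_subset r τ₀ ε) h,
        ae_restrict_mem (measurableSet_strip r τ₀ ε)] with z hz hzs
      refine hz.trans (add_le_add le_rfl ?_)
      exact mul_le_mul_of_nonneg_right hzs.2.le (abs_nonneg _)
    rw [integral_add (ib.const_mul C) (iw.const_mul ε), integral_const_mul, integral_const_mul] at hle
    calc ε⁻¹ * ∫ z in strip r τ₀ ε, |a z|
        ≤ ε⁻¹ * (C * (∫ z in strip r τ₀ ε, |b z|) + ε * ∫ z in strip r τ₀ ε, |w z|) :=
          mul_le_mul_of_nonneg_left hle (inv_nonneg.2 hε.le)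
      _ = _ := by field_simp

/-! ### Cutoff functions -/

lemma deriv_smoothTransition_of_notMem {x : ℝ} (hx : x ∉ Ioo 0 1) :
    deriv Real.smoothTransition x = 0 := by
  rcases le_or_gt x 0 with h | h
  · exact IsLocalMin.deriv_eq_zero (Eventually.of_forall fun y => by
      rw [Real.smoothTransition.zero_of_nonpos h]; exact Real.smoothTransition.nonneg y)
  · have h1 : 1 ≤ x := by by_contra hn; exact hx ⟨h, not_le.1 hn⟩
    exact IsLocalMax.deriv_eq_zero (Eventually.of_forall fun y => by
      rw [Real.smoothTransition.one_of_one_le h1]; exact Real.smoothTransition.le_one y)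

lemma exists_bound_deriv_smoothTransition : ∃ C, 0 ≤ C ∧ ∀ x, |deriv Real.smoothTransition x| ≤ C := by
  have hc : Continuous (deriv Real.smoothTransition) :=
    (Real.smoothTransition.contDiff (n := 1)).continuous_deriv le_rfl
  obtain ⟨C, hC⟩ := (isCompact_Icc (a := (0 : ℝ)) (b := 1)).exists_bound_of_continuousOn
    hc.continuousOn
  refine ⟨max C 0, le_max_right _ _, fun x => ?_⟩
  by_cases hx : x ∈ Ioo 0 1
  · exact (hC x (Ioo_subset_Icc_self hx)).trans (le_max_left _ _)
  · rw [deriv_smoothTransition_of_notMem hx, abs_zero]; exact le_max_right _ _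

/-- A smooth cutoff function on `(1, b)` that equals `1` at distance at least `ε` from the ends. -/
def cutoff (b ε τ : ℝ) : ℝ :=
  Real.smoothTransition (2 / ε * (τ - 1) - 1) * Real.smoothTransition (2 / ε * (b - τ) - 1)

/-- The derivative of `cutoff`. -/
def cutoff' (b ε τ : ℝ) : ℝ :=
  deriv Real.smoothTransition (2 / ε * (τ - 1) - 1) * (2 / ε)
      * Real.smoothTransition (2 / ε * (b - τ) - 1)
    + Real.smoothTransition (2 / ε * (τ - 1) - 1)
      * (deriv Real.smoothTransition (2 / ε * (b - τ) - 1) * (-(2 / ε)))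

lemma hasDerivAt_cutoff (b ε τ : ℝ) : HasDerivAt (cutoff b ε) (cutoff' b ε τ) τ := by
  have hs : ∀ x, HasDerivAt Real.smoothTransition (deriv Real.smoothTransition x) x := fun x =>
    ((Real.smoothTransition.contDiff (n := 1)).differentiable one_ne_zero x).hasDerivAt
  have l1 : HasDerivAt (fun τ => 2 / ε * (τ - 1) - 1) (2 / ε) τ := by
    simpa using (((hasDerivAt_id τ).sub_const 1).const_mul (2 / ε)).sub_const 1
  have l2 : HasDerivAt (fun τ => 2 / ε * (b - τ) - 1) (-(2 / ε)) τ := by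
    simpa using (((hasDerivAt_id τ).const_sub b).const_mul (2 / ε)).sub_const 1
  exact ((hs _).comp τ l1).mul ((hs _).comp τ l2)

lemma continuous_cutoff' (b ε : ℝ) : Continuous (cutoff' b ε) := by
  have hc : Continuous (deriv Real.smoothTransition) :=
    (Real.smoothTransition.contDiff (n := 1)).continuous_deriv le_rfl
  have hs := Real.smoothTransition.continuous
  unfold cutoff'
  fun_prop

lemma continuous_cutoff (b ε : ℝ) : Continuous (cutoff b ε) := by
  have hs := Real.smoothTransition.continuous
  unfold cutoff
  fun_prop

lemma abs_cutoff_le_one (b ε τ : ℝ) : |cutoff b ε τ| ≤ 1 := by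
  have h1 := Real.smoothTransition.nonneg (2 / ε * (τ - 1) - 1)
  have h2 := Real.smoothTransition.le_one (2 / ε * (τ - 1) - 1)
  have h3 := Real.smoothTransition.nonneg (2 / ε * (b - τ) - 1)
  have h4 := Real.smoothTransition.le_one (2 / ε * (b - τ) - 1)
  unfold cutoff
  rw [abs_of_nonneg (mul_nonneg h1 h3)]
  exact mul_le_one₀ h2 h3 h4

lemma cutoff_eq_zero {b ε τ : ℝ} (hε : 0 < ε) (h : τ ∉ Icc (1 + ε / 2) (b - ε / 2)) :
    cutoff b ε τ = 0 := by
  unfold cutoff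
  rw [mem_Icc, not_and_or, not_le, not_le] at h
  rcases h with h | h
  · rw [Real.smoothTransition.zero_of_nonpos, zero_mul]
    rw [sub_nonpos, div_mul_eq_mul_div, div_le_one hε]; linarith
  · rw [Real.smoothTransition.zero_of_nonpos (x := 2 / ε * (b - τ) - 1), mul_zero]
    rw [sub_nonpos, div_mul_eq_mul_div, div_le_one hε]; linarith

lemma cutoff_eventually_eq_one {b τ : ℝ} (h : τ ∈ Ioo 1 b) :
    ∀ᶠ ε in 𝓝[>] (0 : ℝ), cutoff b ε τ = 1 := by
  have h1 : 0 < τ - 1 := sub_pos.2 h.1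
  have h2 : 0 < b - τ := sub_pos.2 h.2
  filter_upwards [self_mem_nhdsWithin, nhdsWithin_le_nhds (Iio_mem_nhds h1),
    nhdsWithin_le_nhds (Iio_mem_nhds h2)] with ε hε he1 he2
  have hε : 0 < ε := hε
  have he1 : ε < τ - 1 := he1
  have he2 : ε < b - τ := he2
  unfold cutoff
  rw [Real.smoothTransition.one_of_one_le, Real.smoothTransition.one_of_one_le, one_mul]
  · rw [le_sub_iff_add_le, div_mul_eq_mul_div, le_div_iff₀ hε]; linarith
  · rw [le_sub_iff_add_le, div_mul_eq_mul_div, le_div_iff₀ hε]; linarith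

/-- The derivative of the cutoff is of size ε⁻¹ and lives within ε of the two ends, so integrals
against it are bounded by the strip means in `StripVanish`. -/
lemma abs_cutoff'_le {C : ℝ} (hC0 : 0 ≤ C) (hC : ∀ x, |deriv Real.smoothTransition x| ≤ C)
    {b ε τ : ℝ} (hε : 0 < ε) (hτ : τ ∈ Ioo 1 b) :
    |cutoff' b ε τ| ≤ 2 * C * ε⁻¹ * ((if |τ - 1| < ε then 1 else 0) + if |τ - b| < ε then 1 else 0) := by
  have key : ∀ x y : ℝ, |deriv Real.smoothTransition x * (2 / ε) * Real.smoothTransition y|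
      ≤ 2 * C * ε⁻¹ * if x ∈ Ioo (0 : ℝ) 1 then 1 else 0 := by
    intro x y
    split_ifs with hx
    · rw [abs_mul, abs_mul, abs_of_nonneg (Real.smoothTransition.nonneg y),
        abs_of_pos (by positivity : 0 < 2 / ε)]
      have h2 := Real.smoothTransition.le_one y
      calc _ ≤ C * (2 / ε) * 1 := by
            have h3 := Real.smoothTransition.nonneg y
            have := hC x
            gcongr
        _ = _ := by field_simp
    · rw [deriv_smoothTransition_of_notMem hx]; simp
  have mono : ∀ {p q : Prop} [Decidable p] [Decidable q], (p → q) →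
      2 * C * ε⁻¹ * (if p then (1 : ℝ) else 0) ≤ 2 * C * ε⁻¹ * (if q then (1 : ℝ) else 0) := by
    intro p q _ _ hpq
    refine mul_le_mul_of_nonneg_left ?_ (by positivity)
    split_ifs <;> simp_all
  unfold cutoff'
  refine (abs_add_le _ _).trans ?_
  rw [mul_add]
  refine add_le_add ((key _ _).trans (mono fun h => ?_)) ?_
  · rw [abs_of_pos (sub_pos.2 hτ.1)]
    have := h.2
    rw [sub_lt_iff_lt_add, div_mul_eq_mul_div, div_lt_iff₀ hε] at this
    linarith
  · rw [show Real.smoothTransition (2 / ε * (τ - 1) - 1)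
      * (deriv Real.smoothTransition (2 / ε * (b - τ) - 1) * (-(2 / ε)))
      = -(deriv Real.smoothTransition (2 / ε * (b - τ) - 1) * (2 / ε)
        * Real.smoothTransition (2 / ε * (τ - 1) - 1)) by ring, abs_neg]
    refine (key _ _).trans (mono fun h => ?_)
    rw [abs_sub_comm, abs_of_pos (sub_pos.2 hτ.2)]
    have := h.2
    rw [sub_lt_iff_lt_add, div_mul_eq_mul_div, div_lt_iff₀ hε] at this
    linarith

/-- An identity tested with compactly supported radial functions extends to all radial `C¹`
functions if the boundary terms vanish. -/
lemma radial_identity_of_stripVanish {r : ℝ} (hr : 1 < r) {A B : ℂ → ℝ}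
    (hA : IntegrableOn A (annulus 1 r)) (hB : IntegrableOn B (annulus 1 r))
    (H : ∀ Y Y' : ℝ → ℝ, (∀ τ, HasDerivAt Y (Y' τ) τ) → Continuous Y' → tsupport Y ⊆ Ioo 1 (r ^ 2) →
      ∫ z in annulus 1 r, (A z * Y' (‖z‖ ^ 2) + B z * Y (‖z‖ ^ 2)) = 0)
    {Z Z' : ℝ → ℝ} (hZ : RadialTest r Z Z')
    (h1 : StripVanish r 1 (fun z => A z * Z (‖z‖ ^ 2)))
    (h2 : StripVanish r (r ^ 2) (fun z => A z * Z (‖z‖ ^ 2))) :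
    ∫ z in annulus 1 r, (A z * Z' (‖z‖ ^ 2) + B z * Z (‖z‖ ^ 2)) = 0 := by
  obtain ⟨C, hC0, hC⟩ := exists_bound_deriv_smoothTransition
  set G : ℂ → ℝ := fun z => A z * Z' (‖z‖ ^ 2) + B z * Z (‖z‖ ^ 2) with hG
  have hGi : IntegrableOn G (annulus 1 r) :=
    (integrable_mul_comp_normSq hr hZ.cont' hA).add (integrable_mul_comp_normSq hr hZ.cont hB)
  have hAZ : IntegrableOn (fun z => A z * Z (‖z‖ ^ 2)) (annulus 1 r) :=
    integrable_mul_comp_normSq hr hZ.cont hA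
  have lim : Tendsto (fun ε => ∫ z in annulus 1 r, G z * cutoff (r ^ 2) ε (‖z‖ ^ 2)) (𝓝[>] 0)
      (𝓝 (∫ z in annulus 1 r, G z)) := by
    refine tendsto_integral_filter_of_dominated_convergence (fun z => |G z|)
      (Eventually.of_forall fun ε => hGi.1.mul ?_)
      (Eventually.of_forall fun ε => Eventually.of_forall fun z => ?_) hGi.abs ?_
    · exact ((continuous_cutoff _ _).comp (by fun_prop : Continuous fun z : ℂ => ‖z‖ ^ 2)).aestronglyMeasurable
    · rw [Real.norm_eq_abs, abs_mul]
      exact mul_le_of_le_one_right (abs_nonneg _) (abs_cutoff_le_one _ _ _)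
    · refine (ae_restrict_mem (measurableSet_annulus 1 r)).mono fun z hz => ?_
      refine tendsto_const_nhds.congr' ?_
      filter_upwards [cutoff_eventually_eq_one ((mem_annulus_iff_sq hr).1 hz)] with ε hε
      rw [hε, mul_one]
  -- The hypothesis is applied to Z times the cutoff. By the product rule the only term not
  -- containing the cutoff itself is the one with its derivative.
  have main : ∀ ε > 0, ∫ z in annulus 1 r, G z * cutoff (r ^ 2) ε (‖z‖ ^ 2)
      = - ∫ z in annulus 1 r, A z * Z (‖z‖ ^ 2) * cutoff' (r ^ 2) ε (‖z‖ ^ 2) := by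
    intro ε hε
    set Y : ℝ → ℝ := fun τ => Z τ * cutoff (r ^ 2) ε τ with hY
    -- `Z` is differentiable only inside the interval. Near and beyond the ends the cutoff vanishes
    -- identically, so the derivative of the product is zero there.
    set Y' : ℝ → ℝ := fun τ => if τ ∈ Ioo 1 (r ^ 2) then
      Z' τ * cutoff (r ^ 2) ε τ + Z τ * cutoff' (r ^ 2) ε τ else 0 with hY'
    have hsub : Icc (1 + ε / 2) (r ^ 2 - ε / 2) ⊆ Ioo 1 (r ^ 2) := fun τ hτ =>
      ⟨by linarith [hτ.1], by linarith [hτ.2]⟩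
    have hsupp : tsupport Y ⊆ Icc (1 + ε / 2) (r ^ 2 - ε / 2) := by
      refine closure_minimal (fun τ hτ => ?_) isClosed_Icc
      by_contra hn
      exact hτ (by simp [hY, cutoff_eq_zero hε hn])
    have hk' : ∀ τ ∉ Icc (1 + ε / 2) (r ^ 2 - ε / 2), cutoff' (r ^ 2) ε τ = 0 := by
      intro τ hτ
      have he : cutoff (r ^ 2) ε =ᶠ[𝓝 τ] fun _ => 0 := by
        filter_upwards [isClosed_Icc.isOpen_compl.mem_nhds hτ] with x hx
        exact cutoff_eq_zero hε hx
      rw [← (hasDerivAt_cutoff _ _ _).deriv, he.deriv_eq]; simp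
    have hYd : ∀ τ, HasDerivAt Y (Y' τ) τ := by
      intro τ
      by_cases hτ : τ ∈ Ioo 1 (r ^ 2)
      · simp only [hY', if_pos hτ]
        exact (hZ.deriv τ hτ).mul (hasDerivAt_cutoff _ _ _)
      · simp only [hY', if_neg hτ]
        have hn : τ ∉ Icc (1 + ε / 2) (r ^ 2 - ε / 2) := fun h => hτ (hsub h)
        refine (hasDerivAt_const τ (0 : ℝ)).congr_of_eventuallyEq ?_
        filter_upwards [isClosed_Icc.isOpen_compl.mem_nhds hn] with x hx
        simp [hY, cutoff_eq_zero hε hx]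
    have hYc : Continuous Y' := by
      rw [continuous_iff_continuousAt]
      intro τ
      by_cases hτ : τ ∈ Ioo 1 (r ^ 2)
      · have : Y' =ᶠ[𝓝 τ] fun τ => Z' τ * cutoff (r ^ 2) ε τ + Z τ * cutoff' (r ^ 2) ε τ := by
          filter_upwards [isOpen_Ioo.mem_nhds hτ] with x hx
          simp only [hY', if_pos hx]
        refine ContinuousAt.congr ?_ this.symm
        have n1 := Icc_mem_nhds hτ.1 hτ.2
        exact ((hZ.cont'.continuousAt n1).mul (continuous_cutoff _ _).continuousAt).add
          ((hZ.cont.continuousAt n1).mul (continuous_cutoff' _ _).continuousAt)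
      · have hn : τ ∉ Icc (1 + ε / 2) (r ^ 2 - ε / 2) := fun h => hτ (hsub h)
        refine (continuousAt_const (y := (0 : ℝ))).congr ?_
        filter_upwards [isClosed_Icc.isOpen_compl.mem_nhds hn] with x hx
        simp only [hY']
        split_ifs
        · rw [cutoff_eq_zero hε hx, hk' x hx]; ring
        · rfl
    have h0 := H Y Y' hYd hYc (hsupp.trans hsub)
    have hi1 : IntegrableOn (fun z => G z * cutoff (r ^ 2) ε (‖z‖ ^ 2)) (annulus 1 r) :=
      integrable_mul_comp_normSq hr (continuous_cutoff _ _).continuousOn hGi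
    have hi2 : IntegrableOn (fun z => A z * Z (‖z‖ ^ 2) * cutoff' (r ^ 2) ε (‖z‖ ^ 2)) (annulus 1 r) :=
      integrable_mul_comp_normSq hr (continuous_cutoff' _ _).continuousOn hAZ
    rw [eq_neg_iff_add_eq_zero, ← integral_add hi1 hi2, ← h0]
    refine setIntegral_congr_fun (measurableSet_annulus 1 r) fun z hz => ?_
    simp only [hY, hY', hG, if_pos ((mem_annulus_iff_sq hr).1 hz)]
    ring
  have bound : ∀ᶠ ε in 𝓝[>] (0 : ℝ), ‖∫ z in annulus 1 r, G z * cutoff (r ^ 2) ε (‖z‖ ^ 2)‖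
      ≤ 2 * C * (ε⁻¹ * (∫ z in strip r 1 ε, |A z * Z (‖z‖ ^ 2)|)
        + ε⁻¹ * ∫ z in strip r (r ^ 2) ε, |A z * Z (‖z‖ ^ 2)|) := by
    filter_upwards [self_mem_nhdsWithin] with ε hε
    have hε : 0 < ε := hε
    rw [main ε hε, norm_neg]
    have hind : ∀ τ₀, ∫ z in strip r τ₀ ε, |A z * Z (‖z‖ ^ 2)|
        = ∫ z in annulus 1 r, (strip r τ₀ ε).indicator (fun z => |A z * Z (‖z‖ ^ 2)|) z := by
      intro τ₀
      rw [setIntegral_indicator (measurableSet_strip r τ₀ ε),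
        inter_eq_self_of_subset_right (strip_subset r τ₀ ε)]
    have hii : ∀ τ₀, IntegrableOn ((strip r τ₀ ε).indicator (fun z => |A z * Z (‖z‖ ^ 2)|))
        (annulus 1 r) := fun τ₀ => hAZ.abs.indicator (measurableSet_strip r τ₀ ε)
    rw [hind, hind, ← mul_add, ← integral_add (hii _) (hii _), ← mul_assoc, ← integral_const_mul]
    refine norm_integral_le_of_norm_le (((hii _).add (hii _)).const_mul _) ?_
    refine (ae_restrict_mem (measurableSet_annulus 1 r)).mono fun z hz => ?_
    rw [norm_mul, Real.norm_eq_abs, Real.norm_eq_abs]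
    refine (mul_le_mul_of_nonneg_left (abs_cutoff'_le hC0 hC hε ((mem_annulus_iff_sq hr).1 hz))
      (abs_nonneg _)).trans (le_of_eq ?_)
    have hs : ∀ τ₀, (strip r τ₀ ε).indicator (fun z => |A z * Z (‖z‖ ^ 2)|) z
        = |A z * Z (‖z‖ ^ 2)| * if |‖z‖ ^ 2 - τ₀| < ε then 1 else 0 := by
      intro τ₀
      by_cases hin : |‖z‖ ^ 2 - τ₀| < ε
      · rw [indicator_of_mem (show z ∈ strip r τ₀ ε from ⟨hz, hin⟩), if_pos hin, mul_one]
      · rw [indicator_of_notMem (fun h : z ∈ strip r τ₀ ε => hin h.2), if_neg hin, mul_zero]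
    simp only [hs]
    ring
  have lim0 : Tendsto (fun ε => ∫ z in annulus 1 r, G z * cutoff (r ^ 2) ε (‖z‖ ^ 2)) (𝓝[>] 0)
      (𝓝 0) := by
    have := ((h1.add h2).const_mul (2 * C))
    rw [add_zero, mul_zero] at this
    exact squeeze_zero_norm' bound this
  exact tendsto_nhds_unique lim lim0

/-! ### A smooth substitute for the reciprocal -/

/-- A smooth positive function that equals `s` for `s ≥ 1 / 2`. -/
def posId (s : ℝ) : ℝ := s + (1 - Real.smoothTransition (2 * s)) * (1 + s ^ 2)

lemma posId_pos (s : ℝ) : 0 < posId s := by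
  unfold posId
  have h1 := Real.smoothTransition.le_one (2 * s)
  rcases lt_or_ge 0 s with h | h
  · have : 0 ≤ (1 - Real.smoothTransition (2 * s)) * (1 + s ^ 2) :=
      mul_nonneg (by linarith) (by positivity)
    linarith
  · rw [Real.smoothTransition.zero_of_nonpos (by linarith)]
    nlinarith [sq_nonneg (s + 1 / 2)]

lemma posId_eq {s : ℝ} (h : 1 / 2 ≤ s) : posId s = s := by
  unfold posId
  rw [Real.smoothTransition.one_of_one_le (by linarith)]; ring

/-- A smooth function that equals `s⁻¹` for `s ≥ 1 / 2`. -/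
def smoothInv (s : ℝ) : ℝ := (posId s)⁻¹

lemma smoothInv_contDiff : ContDiff ℝ 1 smoothInv := by
  have h : ContDiff ℝ 1 posId := by
    unfold posId
    have := (Real.smoothTransition.contDiff (n := 1)).comp
      (contDiff_const.mul contDiff_id : ContDiff ℝ 1 fun s : ℝ => 2 * s)
    exact contDiff_id.add ((contDiff_const.sub this).mul (contDiff_const.add (contDiff_id.pow 2)))
  exact h.inv fun s => (posId_pos s).ne'

lemma smoothInv_eq {s : ℝ} (h : 1 ≤ s) : smoothInv s = s⁻¹ := by
  rw [smoothInv, posId_eq (by linarith)]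

lemma hasDerivAt_smoothInv (s : ℝ) : HasDerivAt smoothInv (deriv smoothInv s) s :=
  (smoothInv_contDiff.differentiable one_ne_zero s).hasDerivAt

lemma continuous_deriv_smoothInv : Continuous (deriv smoothInv) :=
  smoothInv_contDiff.continuous_deriv le_rfl

lemma deriv_smoothInv {s : ℝ} (h : 1 ≤ s) : deriv smoothInv s = -(s ^ 2)⁻¹ := by
  have he : smoothInv =ᶠ[𝓝 s] fun s => s⁻¹ := by
    filter_upwards [lt_mem_nhds (show 1 / 2 < s by linarith)] with x hx
    rw [smoothInv, posId_eq hx.le]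
  rw [he.deriv_eq, deriv_inv]

/-! ### Extension of `C¹` functions on an interval -/

/-- The weak chain rules require functions that are C¹ on the whole line. The derivative is
continued by constants beyond the interval and integrated; since 1 ≤ |f|² ≤ R² almost everywhere,
the values outside never matter. -/
lemma RadialTest.exists_extension {R : ℝ} (hR : 1 < R) {K K' : ℝ → ℝ} (h : RadialTest R K K') :
    ∃ L L' : ℝ → ℝ, (∀ s, HasDerivAt L (L' s) s) ∧ Continuous L' ∧
      EqOn L K (Icc 1 (R ^ 2)) ∧ EqOn L' K' (Icc 1 (R ^ 2)) := by
  have h1 : (1 : ℝ) ≤ R ^ 2 := by nlinarith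
  set L' : ℝ → ℝ := IccExtend h1 ((Icc 1 (R ^ 2)).domRestrict K') with hL'
  have hc : Continuous L' := (continuousOn_iff_continuous_domRestrict.1 h.cont').Icc_extend'
  have he : EqOn L' K' (Icc 1 (R ^ 2)) := fun s hs => by
    rw [hL', IccExtend_of_mem _ _ hs]; rfl
  refine ⟨fun s => K 1 + ∫ t in (1 : ℝ)..s, L' t, L', fun s => ?_, hc, fun s hs => ?_, he⟩
  · exact ((hc.integral_hasStrictDerivAt 1 s).hasDerivAt).const_add _
  · have hsub : Icc 1 s ⊆ Icc 1 (R ^ 2) := Icc_subset_Icc_right hs.2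
    have : ∫ t in (1 : ℝ)..s, L' t = K s - K 1 := by
      refine intervalIntegral.integral_eq_sub_of_hasDerivAt_of_le hs.1 (h.cont.mono hsub)
        (fun t ht => ?_) (hc.intervalIntegrable _ _)
      have ht' : t ∈ Ioo 1 (R ^ 2) := ⟨ht.1, ht.2.trans_le hs.2⟩
      rw [he (Ioo_subset_Icc_self ht')]
      exact h.deriv t ht'
    simp only [this]; ring

lemma exists_lipschitz_bound {L L' : ℝ → ℝ} (hL : ∀ s, HasDerivAt L (L' s) s) (hc : Continuous L')
    (a b : ℝ) : ∃ C, 0 ≤ C ∧ ∀ x ∈ Icc a b, ∀ y ∈ Icc a b, |L x - L y| ≤ C * |x - y| := by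
  obtain ⟨C, hC⟩ := isCompact_Icc.exists_bound_of_continuousOn (hc.continuousOn (s := Icc a b))
  refine ⟨max C 0, le_max_right _ _, fun x hx y hy => ?_⟩
  exact (convex_Icc a b).norm_image_sub_le_of_norm_hasDerivWithin_le
    (fun s _ => (hL s).hasDerivWithinAt) (fun s hs => (hC s hs).trans (le_max_left _ _)) hy hx

/-! ### Radial and angular components -/

/-- The real part of `conj f` times the radial derivative `x f_x + y f_y`. -/
def radRe (f u v : ℂ → ℂ) (z : ℂ) : ℝ := (conj (f z) * (z.re * u z + z.im * v z)).re

/-- The imaginary part of `conj f` times the radial derivative `x f_x + y f_y`. -/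
def radIm (f u v : ℂ → ℂ) (z : ℂ) : ℝ := (conj (f z) * (z.re * u z + z.im * v z)).im

/-- The real part of `conj f` times the angular derivative `x f_y - y f_x`. -/
def angRe (f u v : ℂ → ℂ) (z : ℂ) : ℝ := (conj (f z) * (z.re * v z - z.im * u z)).re

/-- The imaginary part of `conj f` times the angular derivative `x f_y - y f_x`. -/
def angIm (f u v : ℂ → ℂ) (z : ℂ) : ℝ := (conj (f z) * (z.re * v z - z.im * u z)).im

/-- The Jacobian determinant of a map with partial derivatives `u`, `v`. -/
def jacDet (u v : ℂ → ℂ) (z : ℂ) : ℝ := (conj (u z) * v z).im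

/-- A Sobolev map of `annulus 1 r` into the closure of `annulus 1 R` that sends the inner and outer
boundary to the inner and outer boundary, with weak partial derivatives `u` and `v`. -/
structure AnnulusMap (r R : ℝ) (f u v : ℂ → ℂ) : Prop extends
    BddSobolev (annulus 1 r) f u v R where
  one_lt_r : 1 < r
  one_lt_R : 1 < R
  lower : ∀ᵐ z ∂(volume.restrict (annulus 1 r)), 1 ≤ ‖f z‖
  inner : StripVanish r 1 (fun z => ‖f z‖ ^ 2 - 1)
  outer : StripVanish r (r ^ 2) (fun z => ‖f z‖ ^ 2 - R ^ 2)

namespace AnnulusMap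

variable {r R : ℝ} {f u v : ℂ → ℂ}

lemma range (h : AnnulusMap r R f u v) :
    ∀ᵐ z ∂(volume.restrict (annulus 1 r)), ‖f z‖ ^ 2 ∈ Icc 1 (R ^ 2) := by
  filter_upwards [h.lower, h.bound] with z h1 h2
  exact ⟨by nlinarith, by gcongr⟩

lemma one_le_R_sq (h : AnnulusMap r R f u v) : (1 : ℝ) ≤ R ^ 2 := by
  have := h.one_lt_R; nlinarith

lemma aestronglyMeasurable_comp (h : AnnulusMap r R f u v) {K : ℝ → ℝ}
    (hK : ContinuousOn K (Icc 1 (R ^ 2))) :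
    AEStronglyMeasurable (fun z => K (‖f z‖ ^ 2)) (volume.restrict (annulus 1 r)) := by
  have hc : Continuous (IccExtend h.one_le_R_sq ((Icc 1 (R ^ 2)).domRestrict K)) :=
    (continuousOn_iff_continuous_domRestrict.1 hK).Icc_extend'
  refine (hc.comp_aestronglyMeasurable (h.memLp.1.norm.pow 2)).congr ?_
  filter_upwards [h.range] with z hz
  simp only [Pi.pow_apply, IccExtend_of_mem _ _ hz]; rfl

lemma integrable_mul_comp (h : AnnulusMap r R f u v) {K : ℝ → ℝ}
    (hK : ContinuousOn K (Icc 1 (R ^ 2))) {a : ℂ → ℝ} (ha : IntegrableOn a (annulus 1 r)) :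
    IntegrableOn (fun z => a z * K (‖f z‖ ^ 2)) (annulus 1 r) := by
  obtain ⟨C, hC⟩ := isCompact_Icc.exists_bound_of_continuousOn hK
  refine Integrable.mul_bdd (c := C) ha (h.aestronglyMeasurable_comp hK) ?_
  filter_upwards [h.range] with z hz using hC _ hz

lemma integrable_comp (h : AnnulusMap r R f u v) {K : ℝ → ℝ}
    (hK : ContinuousOn K (Icc 1 (R ^ 2))) :
    IntegrableOn (fun z => K (‖f z‖ ^ 2)) (annulus 1 r) := by
  have := h.integrable_mul_comp hK (a := fun _ => 1) (integrable_const _)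
  simpa using this

lemma memLp_conj_mul (h : AnnulusMap r R f u v) {w : ℂ → ℂ}
    (hw : MemLp w 2 (volume.restrict (annulus 1 r))) :
    MemLp (fun z => conj (f z) * w z) 2 (volume.restrict (annulus 1 r)) := by
  have hf : MemLp (fun z => conj (f z)) ⊤ (volume.restrict (annulus 1 r)) :=
    memLp_top_of_bound (Complex.continuous_conj.comp_aestronglyMeasurable h.memLp.1) R
      (h.bound.mono fun z hz => by rwa [RCLike.norm_conj])
  exact hw.mul hf

lemma memLp_coord_mul {r : ℝ} {w : ℂ → ℂ} (hw : MemLp w 2 (volume.restrict (annulus 1 r)))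
    {p : ℂ → ℝ} (hp : Continuous p) (hb : ∀ z, |p z| ≤ ‖z‖) :
    MemLp (fun z => (p z : ℂ) * w z) 2 (volume.restrict (annulus 1 r)) := by
  have hf : MemLp (fun z => (p z : ℂ)) ⊤ (volume.restrict (annulus 1 r)) := by
    refine memLp_top_of_bound (Complex.continuous_ofReal.comp hp).aestronglyMeasurable r
      ((ae_restrict_mem (measurableSet_annulus 1 r)).mono fun z hz => ?_)
    rw [Complex.norm_real]
    exact (hb z).trans hz.2.le
  exact hw.mul hf

lemma memLp_rad (h : AnnulusMap r R f u v) :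
    MemLp (fun z => conj (f z) * (z.re * u z + z.im * v z)) 2 (volume.restrict (annulus 1 r)) :=
  h.memLp_conj_mul ((memLp_coord_mul h.memLp_x Complex.continuous_re Complex.abs_re_le_norm).add
    (memLp_coord_mul h.memLp_y Complex.continuous_im Complex.abs_im_le_norm))

lemma memLp_ang (h : AnnulusMap r R f u v) :
    MemLp (fun z => conj (f z) * (z.re * v z - z.im * u z)) 2 (volume.restrict (annulus 1 r)) :=
  h.memLp_conj_mul ((memLp_coord_mul h.memLp_y Complex.continuous_re Complex.abs_re_le_norm).sub
    (memLp_coord_mul h.memLp_x Complex.continuous_im Complex.abs_im_le_norm))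

lemma memLp_radRe (h : AnnulusMap r R f u v) :
    MemLp (radRe f u v) 2 (volume.restrict (annulus 1 r)) := h.memLp_rad.re

lemma memLp_angIm (h : AnnulusMap r R f u v) :
    MemLp (angIm f u v) 2 (volume.restrict (annulus 1 r)) := h.memLp_ang.im

lemma integrable_radRe (h : AnnulusMap r R f u v) : IntegrableOn (radRe f u v) (annulus 1 r) :=
  h.memLp_radRe.integrable (by norm_num)

lemma integrable_angIm (h : AnnulusMap r R f u v) : IntegrableOn (angIm f u v) (annulus 1 r) :=
  h.memLp_angIm.integrable (by norm_num)

lemma integrable_jacDet (h : AnnulusMap r R f u v) : IntegrableOn (jacDet u v) (annulus 1 r) :=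
  (h.memLp_x.star.integrable_mul h.memLp_y).im

lemma tsupport_comp_normSq {Y : ℝ → ℝ} (hr : 1 < r) (hY : tsupport Y ⊆ Ioo 1 (r ^ 2)) :
    tsupport (fun z : ℂ => Y (‖z‖ ^ 2)) ⊆ annulus 1 r := by
  have hc : Continuous fun z : ℂ => ‖z‖ ^ 2 := by fun_prop
  have h1 : tsupport (fun z : ℂ => Y (‖z‖ ^ 2)) ⊆ (fun z : ℂ => ‖z‖ ^ 2) ⁻¹' tsupport Y :=
    closure_minimal (fun z hz => subset_closure hz) ((isClosed_tsupport Y).preimage hc)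
  exact fun z hz => (mem_annulus_iff_sq hr).2 (hY (h1 hz))

lemma hasCompactSupport_comp_normSq {Y : ℝ → ℝ} (hr : 1 < r) (hY : tsupport Y ⊆ Ioo 1 (r ^ 2)) :
    HasCompactSupport (fun z : ℂ => Y (‖z‖ ^ 2)) :=
  (isCompact_closedBall (0 : ℂ) r).of_isClosed_subset (isClosed_tsupport _)
    ((tsupport_comp_normSq hr hY).trans ((annulus_subset_ball 1 r).trans Metric.ball_subset_closedBall))

/-- The line derivative of `|z|²`. -/
lemma hasDerivAt_normSq_line (z e : ℂ) :
    HasDerivAt (fun t : ℝ => ‖z + t • e‖ ^ 2) (2 * (conj z * e).re) 0 := by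
  have h1 : HasDerivAt (fun t : ℝ => z + t • e) e 0 := by
    simpa using ((hasDerivAt_id (0 : ℝ)).smul_const e).const_add z
  have h2 := h1.norm_sq
  rw [Complex.inner, mul_comm e] at h2
  simpa using h2

/-- The field z/|z|² is divergence free, so testing the chain rule for F(|f|²) with the two
components of Y(|z|²) z/|z|² leaves 2Y' on one side and the radial derivative of F(|f|²) on the
other. Using `smoothInv` keeps the test field C¹ at the origin. -/
lemma radial_weak (h : AnnulusMap r R f u v) {F F' : ℝ → ℝ} (hF : ∀ s, HasDerivAt F (F' s) s)
    (hF' : Continuous F') {Y Y' : ℝ → ℝ} (hY : ∀ τ, HasDerivAt Y (Y' τ) τ) (hY' : Continuous Y')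
    (hYs : tsupport Y ⊆ Ioo 1 (r ^ 2)) :
    ∫ z in annulus 1 r, (F (‖f z‖ ^ 2) * Y' (‖z‖ ^ 2)
      + F' (‖f z‖ ^ 2) * radRe f u v z * smoothInv (‖z‖ ^ 2) * Y (‖z‖ ^ 2)) = 0 := by
  have hr := h.one_lt_r
  have hFc := (contDiff_one_of_hasDerivAt hF hF').continuous
  have hYc := contDiff_one_of_hasDerivAt hY hY'
  have hYsq : ContDiff ℝ 1 (fun z : ℂ => Y (‖z‖ ^ 2) * smoothInv (‖z‖ ^ 2)) :=
    (hYc.comp (contDiff_norm_sq ℝ)).mul (smoothInv_contDiff.comp (contDiff_norm_sq ℝ))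
  have hts : tsupport (fun z : ℂ => Y (‖z‖ ^ 2) * smoothInv (‖z‖ ^ 2)) ⊆ annulus 1 r :=
    (tsupport_mul_subset_left (f := fun z : ℂ => Y (‖z‖ ^ 2))).trans (tsupport_comp_normSq hr hYs)
  have hcs : HasCompactSupport (fun z : ℂ => Y (‖z‖ ^ 2) * smoothInv (‖z‖ ^ 2)) :=
    (hasCompactSupport_comp_normSq hr hYs).mul_right
  have hχ1 : ContDiff ℝ 1 (fun z : ℂ => Y (‖z‖ ^ 2) * smoothInv (‖z‖ ^ 2) * z.re) :=
    hYsq.mul Complex.reCLM.contDiff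
  have hχ2 : ContDiff ℝ 1 (fun z : ℂ => Y (‖z‖ ^ 2) * smoothInv (‖z‖ ^ 2) * z.im) :=
    hYsq.mul Complex.imCLM.contDiff
  have e1 := (h.integral_fderiv_mul_comp_norm_sq hχ1 hcs.mul_right
    ((tsupport_mul_subset_left).trans hts) hF hF').1
  have e2 := (h.integral_fderiv_mul_comp_norm_sq hχ2 hcs.mul_right
    ((tsupport_mul_subset_left).trans hts) hF hF').2
  have hd : ∀ (p : ℂ →L[ℝ] ℝ) (e z : ℂ),
      fderiv ℝ (fun z : ℂ => Y (‖z‖ ^ 2) * smoothInv (‖z‖ ^ 2) * p z) z e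
      = (Y' (‖z‖ ^ 2) * (2 * (conj z * e).re) * smoothInv (‖z‖ ^ 2)
        + Y (‖z‖ ^ 2) * (deriv smoothInv (‖z‖ ^ 2) * (2 * (conj z * e).re))) * p z
        + Y (‖z‖ ^ 2) * smoothInv (‖z‖ ^ 2) * p e := by
    intro p e z
    refine fderiv_apply_eq_of_hasLineDerivAt (hYsq.mul p.contDiff) ?_
    have l0 := hasDerivAt_normSq_line z e
    have l1 : HasDerivAt (fun t : ℝ => p (z + t • e)) (p e) 0 := by
      have := hasDerivAt_line (p.contDiff (n := 1)) z e
      simpa using this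
    have l2 := (hY (‖z + (0 : ℝ) • e‖ ^ 2)).comp (0 : ℝ) l0
    have l3 := (hasDerivAt_smoothInv (‖z + (0 : ℝ) • e‖ ^ 2)).comp (0 : ℝ) l0
    have := (l2.mul l3).mul l1
    simp only [zero_smul, add_zero, Function.comp_apply] at this
    refine this.congr_deriv ?_
    simp
  have ifd : ∀ (χ : ℂ → ℝ) (e : ℂ), ContDiff ℝ 1 χ → HasCompactSupport χ →
      IntegrableOn (fun z => fderiv ℝ χ z e * F (‖f z‖ ^ 2)) (annulus 1 r) := by
    intro χ e hχ hc
    exact h.integrable_mul_comp hFc.continuousOn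
      (((hχ.continuous_fderiv one_ne_zero).clm_apply
        continuous_const).integrable_of_hasCompactSupport (hc.fderiv_apply ℝ e)).integrableOn
  have ipd : ∀ (χ : ℂ → ℝ) (w : ℂ → ℂ), ContDiff ℝ 1 χ → HasCompactSupport χ →
      MemLp w 2 (volume.restrict (annulus 1 r)) →
      IntegrableOn (fun z => χ z * (F' (‖f z‖ ^ 2) * (2 * (conj (f z) * w z).re))) (annulus 1 r) := by
    intro χ w hχ hc hw
    have i1 : IntegrableOn (fun z => (conj (f z) * w z).re) (annulus 1 r) :=
      ((h.memLp_conj_mul hw).re).integrable (by norm_num)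
    obtain ⟨C, -, hC⟩ := exists_bound_of_compactSupport hχ.continuous hc
    have i2 := Integrable.bdd_mul (c := C) (h.integrable_mul_comp hF'.continuousOn i1)
      hχ.continuous.aestronglyMeasurable (Eventually.of_forall hC)
    refine (i2.const_mul 2).congr (Eventually.of_forall fun z => ?_)
    simp only; ring
  have e3 := congrArg₂ (· + ·) e1 e2
  rw [← neg_add, ← integral_add (ifd _ _ hχ1 hcs.mul_right) (ifd _ _ hχ2 hcs.mul_right),
    ← integral_add (ipd _ _ hχ1 hcs.mul_right h.memLp_x) (ipd _ _ hχ2 hcs.mul_right h.memLp_y),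
    ← add_eq_zero_iff_eq_neg, ← integral_add
      ((ifd _ _ hχ1 hcs.mul_right).fun_add (ifd _ _ hχ2 hcs.mul_right))
      ((ipd _ _ hχ1 hcs.mul_right h.memLp_x).fun_add (ipd _ _ hχ2 hcs.mul_right h.memLp_y))] at e3
  have e4 : (2 : ℝ) * ∫ z in annulus 1 r, (F (‖f z‖ ^ 2) * Y' (‖z‖ ^ 2)
      + F' (‖f z‖ ^ 2) * radRe f u v z * smoothInv (‖z‖ ^ 2) * Y (‖z‖ ^ 2)) = 0 := by
    rw [← e3, ← integral_const_mul]
    refine setIntegral_congr_fun (measurableSet_annulus 1 r) fun z hz => ?_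
    have hτ := (mem_annulus_iff_sq hr).1 hz
    have hτ0 : ‖z‖ ^ 2 ≠ 0 := by linarith [hτ.1]
    have d1 := hd Complex.reCLM 1 z
    have d2 := hd Complex.imCLM Complex.I z
    simp only [Complex.reCLM_apply, Complex.imCLM_apply] at d1 d2
    simp only [d1, d2]
    rw [smoothInv_eq hτ.1.le, deriv_smoothInv hτ.1.le]
    have hn : ‖z‖ ^ 2 = z.re ^ 2 + z.im ^ 2 := by
      rw [← Complex.normSq_eq_norm_sq, Complex.normSq_apply]; ring
    have c1 : (conj z * 1).re = z.re := by simp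
    have c2 : (conj z * Complex.I).re = z.im := by simp
    rw [c1, c2, Complex.one_re, Complex.I_im]
    have e5 : radRe f u v z = z.re * (conj (f z) * u z).re + z.im * (conj (f z) * v z).re := by
      simp [radRe]; ring
    rw [e5]
    generalize (conj (f z) * u z).re = a
    generalize (conj (f z) * v z).re = b
    generalize Y (‖z‖ ^ 2) = y at *
    generalize Y' (‖z‖ ^ 2) = y' at *
    generalize F (‖f z‖ ^ 2) = F0 at *
    generalize F' (‖f z‖ ^ 2) = F1 at *
    rw [hn] at hτ0 ⊢
    field_simp
    ring
  linarith

/-- The form F(|w|²) Im(conj w dw), pulled back by `f`, is tested with Y(|z|²). The differential of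
the test function is 2Y'(x dx + y dy), which singles out the angular component of the form. -/
lemma angular_weak (h : AnnulusMap r R f u v) {F F' : ℝ → ℝ} (hF : ∀ s, HasDerivAt F (F' s) s)
    (hF' : Continuous F') {Y Y' : ℝ → ℝ} (hY : ∀ τ, HasDerivAt Y (Y' τ) τ) (hY' : Continuous Y')
    (hYs : tsupport Y ⊆ Ioo 1 (r ^ 2)) :
    ∫ z in annulus 1 r, (F (‖f z‖ ^ 2) * angIm f u v z * Y' (‖z‖ ^ 2)
      + (F' (‖f z‖ ^ 2) * ‖f z‖ ^ 2 + F (‖f z‖ ^ 2)) * jacDet u v z * Y (‖z‖ ^ 2)) = 0 := by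
  have hr := h.one_lt_r
  have hFc := (contDiff_one_of_hasDerivAt hF hF').continuous
  have hYc := contDiff_one_of_hasDerivAt hY hY'
  have hχ : ContDiff ℝ 1 (fun z : ℂ => Y (‖z‖ ^ 2)) := hYc.comp (contDiff_norm_sq ℝ)
  have e1 := h.integral_angular_form hχ (hasCompactSupport_comp_normSq hr hYs)
    (tsupport_comp_normSq hr hYs) hF hF'
  have hd : ∀ e z : ℂ, fderiv ℝ (fun z : ℂ => Y (‖z‖ ^ 2)) z e
      = Y' (‖z‖ ^ 2) * (2 * (conj z * e).re) := by
    intro e z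
    refine fderiv_apply_eq_of_hasLineDerivAt hχ ?_
    have l2 := (hY (‖z + (0 : ℝ) • e‖ ^ 2)).comp (0 : ℝ) (hasDerivAt_normSq_line z e)
    simp only [zero_smul, add_zero] at l2
    exact l2
  have cF : Continuous fun s => F' s * s + F s := by fun_prop
  have i1 : IntegrableOn (fun z => F (‖f z‖ ^ 2) * angIm f u v z * Y' (‖z‖ ^ 2)) (annulus 1 r) := by
    refine (integrable_mul_comp_normSq hr hY'.continuousOn
      (h.integrable_mul_comp hFc.continuousOn h.integrable_angIm)).congr
      (Eventually.of_forall fun z => ?_)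
    simp only; ring
  have i2 : IntegrableOn (fun z => (F' (‖f z‖ ^ 2) * ‖f z‖ ^ 2 + F (‖f z‖ ^ 2)) * jacDet u v z
      * Y (‖z‖ ^ 2)) (annulus 1 r) := by
    refine (integrable_mul_comp_normSq hr hYc.continuous.continuousOn
      (h.integrable_mul_comp cF.continuousOn h.integrable_jacDet)).congr
      (Eventually.of_forall fun z => ?_)
    simp only; ring
  rw [integral_add i1 i2]
  have l : 2 * ∫ z in annulus 1 r, F (‖f z‖ ^ 2) * angIm f u v z * Y' (‖z‖ ^ 2)
      = ∫ z in annulus 1 r, (fderiv ℝ (fun z : ℂ => Y (‖z‖ ^ 2)) z 1 * F (‖f z‖ ^ 2)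
          * (conj (f z) * v z).im
        - fderiv ℝ (fun z : ℂ => Y (‖z‖ ^ 2)) z Complex.I * F (‖f z‖ ^ 2)
          * (conj (f z) * u z).im) := by
    rw [← integral_const_mul]
    congr 1; ext1 z
    rw [hd, hd]
    simp [angIm]; ring
  have l2 : 2 * ∫ z in annulus 1 r, (F' (‖f z‖ ^ 2) * ‖f z‖ ^ 2 + F (‖f z‖ ^ 2)) * jacDet u v z
      * Y (‖z‖ ^ 2) = ∫ z in annulus 1 r, Y (‖z‖ ^ 2) * (2 * F' (‖f z‖ ^ 2) * ‖f z‖ ^ 2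
        + 2 * F (‖f z‖ ^ 2)) * (conj (u z) * v z).im := by
    rw [← integral_const_mul]
    congr 1; ext1 z
    unfold jacDet; ring
  linarith

end AnnulusMap

/-! ### Free Lagrangians -/

namespace AnnulusMap

variable {r R : ℝ} {f u v : ℂ → ℂ}

/-- Squaring removes the corner of the truncation, so the squared tent function in the boundary
estimate is an admissible C¹ test. -/
lemma hasDerivAt_sq_max_zero (x : ℝ) : HasDerivAt (fun x : ℝ => (max 0 x) ^ 2) (2 * max 0 x) x := by
  rcases lt_trichotomy x 0 with hx | rfl | hx
  · rw [max_eq_left hx.le, mul_zero]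
    refine (hasDerivAt_const x (0 : ℝ)).congr_of_eventuallyEq ?_
    filter_upwards [gt_mem_nhds hx] with y hy
    rw [max_eq_left (le_of_lt hy)]; norm_num
  · rw [max_self, mul_zero, hasDerivAt_iff_isLittleO_nhds_zero]
    simp only [zero_add, max_self, smul_zero, sub_zero]
    refine Asymptotics.IsBigO.trans_isLittleO (g := fun h : ℝ => h ^ 2) ?_
      (Asymptotics.isLittleO_pow_id one_lt_two)
    refine Asymptotics.IsBigO.of_bound 1 (Eventually.of_forall fun y => ?_)
    rw [one_mul, zero_pow two_ne_zero, sub_zero, norm_pow, norm_pow, Real.norm_eq_abs,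
      Real.norm_eq_abs]
    refine pow_le_pow_left₀ (abs_nonneg _) ?_ 2
    rcases le_total 0 y with h | h
    · rw [max_eq_right h]
    · rw [max_eq_left h, abs_zero]; exact abs_nonneg _
  · rw [max_eq_right hx.le]
    have := (hasDerivAt_pow 2 x)
    refine (this.congr_deriv (by norm_num)).congr_of_eventuallyEq ?_
    filter_upwards [lt_mem_nhds hx] with y hy
    rw [max_eq_right (le_of_lt hy)]

/-- Interpolation of two numbers by an affine function on `[1, r²]`. -/
def interp (r a b τ : ℝ) : ℝ := a + (b - a) / (r ^ 2 - 1) * (τ - 1)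

lemma hasDerivAt_interp (r a b τ : ℝ) : HasDerivAt (interp r a b) ((b - a) / (r ^ 2 - 1)) τ := by
  have := (((hasDerivAt_id τ).sub_const 1).const_mul ((b - a) / (r ^ 2 - 1))).const_add a
  rw [mul_one] at this
  exact this

lemma interp_one (r a b : ℝ) : interp r a b 1 = a := by simp [interp]

lemma interp_sq (hr : 1 < r) (a b : ℝ) : interp r a b (r ^ 2) = b := by
  have : r ^ 2 - 1 ≠ 0 := by nlinarith
  unfold interp
  field_simp
  ring

lemma radialTest_interp (r a b : ℝ) :
    RadialTest r (interp r a b) (fun _ => (b - a) / (r ^ 2 - 1)) :=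
  RadialTest.of_global (hasDerivAt_interp r a b) continuous_const

lemma abs_interp_sub (r a b τ τ₀ : ℝ) :
    |interp r a b τ - interp r a b τ₀| = |(b - a) / (r ^ 2 - 1)| * |τ - τ₀| := by
  rw [← abs_mul]; congr 1; unfold interp; ring

lemma one_notMem_Ioo (r : ℝ) : (1 : ℝ) ∉ Ioo 1 (r ^ 2) := fun h => lt_irrefl _ h.1

lemma sq_notMem_Ioo (r : ℝ) : r ^ 2 ∉ Ioo 1 (r ^ 2) := fun h => lt_irrefl _ h.2

lemma eq_zero_of_tsupport_subset {Y : ℝ → ℝ} {S : Set ℝ} (hY : tsupport Y ⊆ S) {x : ℝ} (hx : x ∉ S) :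
    Y x = 0 := image_eq_zero_of_notMem_tsupport fun h => hx (hY h)

lemma integrable_radRe_comp (h : AnnulusMap r R f u v) {K : ℝ → ℝ}
    (hK : ContinuousOn K (Icc 1 (R ^ 2))) :
    IntegrableOn (fun z => K (‖f z‖ ^ 2) * radRe f u v z * smoothInv (‖z‖ ^ 2)) (annulus 1 r) :=
  (integrable_mul_comp_normSq h.one_lt_r smoothInv_contDiff.continuous.continuousOn
    (h.integrable_mul_comp hK h.integrable_radRe)).congr (Eventually.of_forall fun z => by
      simp only; ring)

/-- The radial free Lagrangian. -/
theorem integral_radial (h : AnnulusMap r R f u v) {K K' Z Z' : ℝ → ℝ} (hK : RadialTest R K K')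
    (hZ : RadialTest r Z Z') :
    ∫ z in annulus 1 r, (K (‖f z‖ ^ 2) * Z' (‖z‖ ^ 2)
      + K' (‖f z‖ ^ 2) * radRe f u v z * (‖z‖ ^ 2)⁻¹ * Z (‖z‖ ^ 2))
      = Real.pi * (K (R ^ 2) * Z (r ^ 2) - K 1 * Z 1) := by
  have hr := h.one_lt_r
  obtain ⟨L, L', hL, hL', hLK, hLK'⟩ := hK.exists_extension h.one_lt_R
  have hLc := (contDiff_one_of_hasDerivAt hL hL').continuous
  have m1 : (1 : ℝ) ∈ Icc 1 (R ^ 2) := left_mem_Icc.2 h.one_le_R_sq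
  have m2 : R ^ 2 ∈ Icc 1 (R ^ 2) := right_mem_Icc.2 h.one_le_R_sq
  -- `X` is a function of |z|² alone with the boundary values that K(|f|²) should have. Subtracting
  -- it makes the difference vanish at both circles in the mean, while the contribution of `X`
  -- itself is the one-dimensional fundamental theorem of calculus and supplies the right side.
  set X := interp r (L 1) (L (R ^ 2)) with hX
  set m := (L (R ^ 2) - L 1) / (r ^ 2 - 1) with hm
  have hXt : RadialTest r X (fun _ => m) := radialTest_interp _ _ _
  set P : ℂ → ℝ := fun z => L' (‖f z‖ ^ 2) * radRe f u v z * smoothInv (‖z‖ ^ 2) with hP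
  have hPi : IntegrableOn P (annulus 1 r) := h.integrable_radRe_comp hL'.continuousOn
  have hLi : IntegrableOn (fun z => L (‖f z‖ ^ 2)) (annulus 1 r) := h.integrable_comp hLc.continuousOn
  have split : ∀ {W W' : ℝ → ℝ}, RadialTest r W W' →
      ∫ z in annulus 1 r, ((L (‖f z‖ ^ 2) - X (‖z‖ ^ 2)) * W' (‖z‖ ^ 2) + (P z - m) * W (‖z‖ ^ 2))
        = (∫ z in annulus 1 r, (L (‖f z‖ ^ 2) * W' (‖z‖ ^ 2) + P z * W (‖z‖ ^ 2)))
          - Real.pi * (X (r ^ 2) * W (r ^ 2) - X 1 * W 1) := by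
    intro W W' hW
    rw [← (hXt.mul hW).integral_deriv hr, ← integral_sub]
    · congr 1; ext1 z; ring
    · exact (integrable_mul_comp_normSq hr hW.cont' hLi).add
        (integrable_mul_comp_normSq hr hW.cont hPi)
    · exact integrable_comp_normSq hr (hXt.mul hW).cont'
  have key := radial_identity_of_stripVanish hr (A := fun z => L (‖f z‖ ^ 2) - X (‖z‖ ^ 2))
    (B := fun z => P z - m)
    (hLi.sub (integrable_comp_normSq hr hXt.cont)) (hPi.sub (integrable_const m)) (fun Y Y' hY hY' hYs => by
      rw [split (RadialTest.of_global hY hY'), eq_zero_of_tsupport_subset hYs (one_notMem_Ioo r),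
        eq_zero_of_tsupport_subset hYs (sq_notMem_Ioo r)]
      simp only [mul_zero, sub_zero]
      exact h.radial_weak hL hL' hY hY' hYs) hZ
  obtain ⟨C, hC0, hC⟩ := exists_lipschitz_bound hL hL' 1 (R ^ 2)
  obtain ⟨C', hC'0, hC'⟩ := hZ.exists_bound
  have vanish : ∀ {τ₀ S₀ : ℝ}, τ₀ ∉ Ioo 1 (r ^ 2) → S₀ ∈ Icc 1 (R ^ 2) → X τ₀ = L S₀ →
      StripVanish r τ₀ (fun z => ‖f z‖ ^ 2 - S₀) →
      StripVanish r τ₀ (fun z => (L (‖f z‖ ^ 2) - X (‖z‖ ^ 2)) * Z (‖z‖ ^ 2)) := by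
    intro τ₀ S₀ hτ hS hXS hv
    refine hv.of_le hr hτ (C := C * C') (w := fun _ => m * C')
      ((h.integrable_comp continuousOn_id).sub (integrable_const _)) (integrable_const _) ?_
    filter_upwards [h.range, ae_restrict_mem (measurableSet_annulus 1 r)] with z hz hzA
    have h1 := hC _ hz _ hS
    have h2 := abs_interp_sub r (L 1) (L (R ^ 2)) (‖z‖ ^ 2) τ₀
    have h3 := (hC' _ (Ioo_subset_Icc_self ((mem_annulus_iff_sq hr).1 hzA))).1
    rw [← hX, hXS, ← hm] at h2
    calc |(L (‖f z‖ ^ 2) - X (‖z‖ ^ 2)) * Z (‖z‖ ^ 2)|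
        = |(L (‖f z‖ ^ 2) - L S₀) - (X (‖z‖ ^ 2) - L S₀)| * |Z (‖z‖ ^ 2)| := by
          rw [abs_mul]; ring_nf
      _ ≤ (C * |‖f z‖ ^ 2 - S₀| + |m| * |‖z‖ ^ 2 - τ₀|) * C' := by
          refine mul_le_mul ((abs_sub _ _).trans (add_le_add h1 h2.le)) h3 (abs_nonneg _)
            (by positivity)
      _ = _ := by rw [abs_mul, abs_of_nonneg hC'0]; ring
  have key2 := key (vanish (one_notMem_Ioo r) m1 (interp_one _ _ _) h.inner)
    (vanish (sq_notMem_Ioo r) m2 (interp_sq hr _ _) h.outer)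
  rw [split hZ, sub_eq_zero, hX, interp_one, interp_sq hr, hLK m1, hLK m2] at key2
  rw [← key2]
  refine integral_congr_ae ?_
  filter_upwards [h.range, ae_restrict_mem (measurableSet_annulus 1 r)] with z hz hzA
  simp only [hP]
  rw [hLK hz, hLK' hz, smoothInv_eq ((mem_annulus_iff_sq hr).1 hzA).1.le]

/-- A Poincaré type estimate along the boundary circles. -/
lemma stripVanish_mul (h : AnnulusMap r R f u v) {τ₀ S₀ σ : ℝ}
    (hcase : (τ₀ = 1 ∧ S₀ = 1 ∧ σ = -1) ∨ (τ₀ = r ^ 2 ∧ S₀ = R ^ 2 ∧ σ = 1)) {W : ℂ → ℝ}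
    (hW : MemLp W 2 (volume.restrict (annulus 1 r))) :
    StripVanish r τ₀ (fun z => (‖f z‖ ^ 2 - S₀) * W z) := by
  have hr := h.one_lt_r
  have hr2 : 0 < r ^ 2 - 1 := by nlinarith
  have hσ2 : σ * σ = 1 := by rcases hcase with ⟨_, _, rfl⟩ | ⟨_, _, rfl⟩ <;> norm_num
  have hτ0 : τ₀ ∉ Ioo 1 (r ^ 2) := by
    rcases hcase with ⟨rfl, _, _⟩ | ⟨rfl, _, _⟩
    exacts [one_notMem_Ioo r, sq_notMem_Ioo r]
  have habs : ∀ τ ∈ Ioo 1 (r ^ 2), |τ - τ₀| = σ * (τ₀ - τ) := by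
    intro τ hτ
    rcases hcase with ⟨rfl, _, rfl⟩ | ⟨rfl, _, rfl⟩
    · rw [abs_of_pos (by linarith [hτ.1])]; ring
    · rw [abs_of_neg (by linarith [hτ.2])]; ring
  have hPsq : IntegrableOn (fun z => radRe f u v z ^ 2) (annulus 1 r) := h.memLp_radRe.integrable_sq
  have hWsq : IntegrableOn (fun z => W z ^ 2) (annulus 1 r) := hW.integrable_sq
  -- the main estimate
  have main : ∀ ε, 0 < ε → 2 * ε < r ^ 2 - 1 →
      ε * ∫ z in strip r τ₀ ε, (‖f z‖ ^ 2 - S₀) ^ 2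
        ≤ (2 * ε) ^ 3 * ∫ z in strip r τ₀ (2 * ε), radRe f u v z ^ 2 := by
    intro ε hε hε2
    -- Inside the annulus `g` is the tent max(0, 2ε - |τ - τ₀|): at least ε on the strip of width ε,
    -- at most 2ε everywhere, zero beyond width 2ε. The sign σ makes it affine before truncation.
    set g : ℝ → ℝ := fun τ => max 0 (2 * ε - σ * (τ₀ - τ)) with hg
    have hgc : Continuous g := by fun_prop
    have hg0 : ∀ τ, 0 ≤ g τ := fun τ => le_max_left _ _
    have hgτ : g τ₀ = 2 * ε := by simp [hg, hε.le]
    have hZ : RadialTest r (fun τ => g τ ^ 2) (fun τ => 2 * g τ * σ) := by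
      refine RadialTest.of_global (fun τ => ?_) (by fun_prop)
      have l : HasDerivAt (fun τ => 2 * ε - σ * (τ₀ - τ)) σ τ := by
        simpa using (((hasDerivAt_id τ).const_sub τ₀).const_mul σ).const_sub (2 * ε)
      exact (hasDerivAt_sq_max_zero _).comp τ l
    have hK : RadialTest R (fun s => (s - S₀) ^ 2) (fun s => 2 * (s - S₀)) := by
      refine RadialTest.of_global (fun s => ?_) (by fun_prop)
      exact (((hasDerivAt_id s).sub_const S₀).pow 2).congr_deriv (by simp)
    have e1 := h.integral_radial hK hZ
    -- No boundary term survives: at the circle in question the factor (s - S₀)² is zero, and at the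
    -- opposite one `g` vanishes because 2ε < r² - 1.
    have e2 : Real.pi * ((R ^ 2 - S₀) ^ 2 * g (r ^ 2) ^ 2 - (1 - S₀) ^ 2 * g 1 ^ 2) = 0 := by
      rcases hcase with ⟨rfl, rfl, rfl⟩ | ⟨rfl, rfl, rfl⟩
      · have : g (r ^ 2) = 0 := by
          simp only [hg]; rw [max_eq_left]; linarith
        rw [this]; ring
      · have : g 1 = 0 := by
          simp only [hg]; rw [max_eq_left]; linarith
        rw [this]; ring
    rw [e2] at e1
    have c2 : ContinuousOn (fun s => (s - S₀) ^ 2) (Icc 1 (R ^ 2)) := by fun_prop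
    have i1 : IntegrableOn (fun z => (‖f z‖ ^ 2 - S₀) ^ 2 * g (‖z‖ ^ 2)) (annulus 1 r) :=
      integrable_mul_comp_normSq hr hgc.continuousOn (h.integrable_comp c2)
    have i2 : IntegrableOn (fun z => radRe f u v z ^ 2 * g (‖z‖ ^ 2) ^ 3) (annulus 1 r) :=
      integrable_mul_comp_normSq hr (Z := fun τ => g τ ^ 3) (by fun_prop) hPsq
    have i3 : IntegrableOn (fun z => (‖f z‖ ^ 2 - S₀) ^ 2 * (2 * g (‖z‖ ^ 2) * σ)
      + 2 * (‖f z‖ ^ 2 - S₀) * radRe f u v z * (‖z‖ ^ 2)⁻¹ * g (‖z‖ ^ 2) ^ 2) (annulus 1 r) := by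
      refine ((i1.const_mul (2 * σ)).add (integrable_mul_comp_normSq hr
        (Z := fun τ => g τ ^ 2) (by fun_prop)
        (h.integrable_radRe_comp (K := fun s => 2 * (s - S₀)) (by fun_prop)))).congr ?_
      filter_upwards [ae_restrict_mem (measurableSet_annulus 1 r)] with z hz
      simp only [Pi.add_apply, smoothInv_eq ((mem_annulus_iff_sq hr).1 hz).1.le]
      ring
    have e3 : ∫ z in annulus 1 r, (‖f z‖ ^ 2 - S₀) ^ 2 * g (‖z‖ ^ 2)
        ≤ ∫ z in annulus 1 r, radRe f u v z ^ 2 * g (‖z‖ ^ 2) ^ 3 := by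
      have e4 : 0 ≤ ∫ z in annulus 1 r, (radRe f u v z ^ 2 * g (‖z‖ ^ 2) ^ 3
          - (‖f z‖ ^ 2 - S₀) ^ 2 * g (‖z‖ ^ 2)
          + σ * ((‖f z‖ ^ 2 - S₀) ^ 2 * (2 * g (‖z‖ ^ 2) * σ)
            + 2 * (‖f z‖ ^ 2 - S₀) * radRe f u v z * (‖z‖ ^ 2)⁻¹ * g (‖z‖ ^ 2) ^ 2)) := by
        refine setIntegral_nonneg (measurableSet_annulus 1 r) fun z hz => ?_
        have hτ := (mem_annulus_iff_sq hr).1 hz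
        have hi0 : 0 ≤ (‖z‖ ^ 2)⁻¹ := by positivity
        have hi1 : (‖z‖ ^ 2)⁻¹ ≤ 1 := inv_le_one_of_one_le₀ hτ.1.le
        have hG := hg0 (‖z‖ ^ 2)
        generalize (‖z‖ ^ 2)⁻¹ = t at *
        generalize ‖f z‖ ^ 2 - S₀ = U at *
        generalize radRe f u v z = p at *
        generalize g (‖z‖ ^ 2) = G at *
        -- Here U = |f|² - S₀, and t = 1/|z|² is at most 1. Adding σ times the integrand of the
        -- vanishing free Lagrangian completes the square, which yields ∫ U² g ≤ ∫ P² g³.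
        have e5 : p ^ 2 * G ^ 3 - U ^ 2 * G + σ * (U ^ 2 * (2 * G * σ) + 2 * U * p * t * G ^ 2)
            = G * ((σ * U + p * t * G) ^ 2 + (1 - t ^ 2) * (p * G) ^ 2)
              + (σ * σ - 1) * (U ^ 2 * G) := by ring
        rw [e5, hσ2, sub_self, zero_mul, add_zero]
        have : 0 ≤ 1 - t ^ 2 := by nlinarith
        positivity
      rw [integral_add (i2.fun_sub i1) (i3.const_mul σ), integral_const_mul, e1,
        integral_sub i2 i1] at e4
      linarith
    have e6 : ε * ∫ z in strip r τ₀ ε, (‖f z‖ ^ 2 - S₀) ^ 2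
        ≤ ∫ z in annulus 1 r, (‖f z‖ ^ 2 - S₀) ^ 2 * g (‖z‖ ^ 2) := by
      rw [← integral_const_mul]
      refine le_trans ?_ (setIntegral_mono_set i1 (Eventually.of_forall fun z =>
        mul_nonneg (sq_nonneg _) (hg0 _)) (strip_subset r τ₀ ε).eventuallyLE)
      refine setIntegral_mono_on (((h.integrable_comp c2).mono_set (strip_subset _ _ _)).const_mul ε)
        (i1.mono_set (strip_subset _ _ _)) (measurableSet_strip _ _ _) fun z hz => ?_
      rw [mul_comm]
      refine mul_le_mul_of_nonneg_left ?_ (sq_nonneg _)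
      have := hz.2
      rw [habs _ ((mem_annulus_iff_sq hr).1 hz.1)] at this
      exact le_max_of_le_right (by linarith)
    have e7 : ∫ z in annulus 1 r, radRe f u v z ^ 2 * g (‖z‖ ^ 2) ^ 3
        ≤ (2 * ε) ^ 3 * ∫ z in strip r τ₀ (2 * ε), radRe f u v z ^ 2 := by
      rw [← integral_const_mul, setIntegral_eq_of_subset_of_forall_sdiff_eq_zero
        (measurableSet_annulus 1 r) (strip_subset r τ₀ (2 * ε))]
      · refine setIntegral_mono_on (i2.mono_set (strip_subset _ _ _))
          ((hPsq.mono_set (strip_subset _ _ _)).const_mul _) (measurableSet_strip _ _ _) fun z hz => ?_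
        rw [mul_comm]
        refine mul_le_mul_of_nonneg_right (pow_le_pow_left₀ (hg0 _) ?_ 3) (sq_nonneg _)
        refine max_le (by linarith) ?_
        have : 0 ≤ σ * (τ₀ - ‖z‖ ^ 2) := by
          rw [← habs _ ((mem_annulus_iff_sq hr).1 hz.1)]; exact abs_nonneg _
        linarith
      · intro z hz
        have hn : ¬ |‖z‖ ^ 2 - τ₀| < 2 * ε := fun hh => hz.2 ⟨hz.1, hh⟩
        rw [habs _ ((mem_annulus_iff_sq hr).1 hz.1)] at hn
        have : g (‖z‖ ^ 2) = 0 := max_eq_left (by linarith)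
        rw [this]; ring
    linarith
  have lim1 : Tendsto (fun ε : ℝ => ∫ z in strip r τ₀ (2 * ε), radRe f u v z ^ 2) (𝓝[>] 0) (𝓝 0) := by
    have t := tendsto_integral_strip hr hτ0 hPsq
    simp only [abs_pow, sq_abs] at t
    refine t.comp (tendsto_nhdsWithin_iff.2 ⟨?_, ?_⟩)
    · have : Tendsto (fun ε : ℝ => 2 * ε) (𝓝 0) (𝓝 (2 * 0)) := by
        exact (continuous_const.mul continuous_id).tendsto 0
      rw [mul_zero] at this
      exact this.mono_left nhdsWithin_le_nhds
    · filter_upwards [self_mem_nhdsWithin] with ε hε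
      have : 0 < ε := hε
      exact mul_pos two_pos this
  have lim2 : Tendsto (fun ε : ℝ => ∫ z in strip r τ₀ ε, W z ^ 2) (𝓝[>] 0) (𝓝 0) := by
    have t := tendsto_integral_strip hr hτ0 hWsq
    simpa only [abs_pow, sq_abs] using t
  have lim := (lim1.const_mul 4).add (lim2.const_mul (1 / 2))
  rw [mul_zero, mul_zero, add_zero] at lim
  refine tendsto_of_tendsto_of_tendsto_of_le_of_le' tendsto_const_nhds lim ?_ ?_
  · filter_upwards [self_mem_nhdsWithin] with ε hε
    exact mul_nonneg (inv_nonneg.2 (le_of_lt hε)) (integral_nonneg fun z => abs_nonneg _)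
  · filter_upwards [self_mem_nhdsWithin,
      nhdsWithin_le_nhds (Iio_mem_nhds (show 0 < (r ^ 2 - 1) / 2 by linarith))] with ε hε hε2
    have hε : 0 < ε := hε
    have hε2 : ε < (r ^ 2 - 1) / 2 := hε2
    have hm := main ε hε (by linarith)
    have c2 : ContinuousOn (fun s => (s - S₀) ^ 2) (Icc 1 (R ^ 2)) := by fun_prop
    have j1 : IntegrableOn (fun z => (‖f z‖ ^ 2 - S₀) ^ 2) (strip r τ₀ ε) :=
      (h.integrable_comp c2).mono_set (strip_subset _ _ _)
    have j2 : IntegrableOn (fun z => W z ^ 2) (strip r τ₀ ε) := hWsq.mono_set (strip_subset _ _ _)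
    -- Young's inequality with weight ε. By the main estimate, ∫ (|f|² - S₀)² over the strip is of
    -- order ε² times the integral of P² over the doubled strip, so after division by ε both terms
    -- are integrals of fixed integrable functions over shrinking strips.
    have hle : ∫ z in strip r τ₀ ε, |(‖f z‖ ^ 2 - S₀) * W z|
        ≤ ∫ z in strip r τ₀ ε, (1 / (2 * ε) * (‖f z‖ ^ 2 - S₀) ^ 2 + ε / 2 * W z ^ 2) := by
      refine integral_mono_of_nonneg (Eventually.of_forall fun z => abs_nonneg _)
        ((j1.const_mul _).add (j2.const_mul _)) (Eventually.of_forall fun z => ?_)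
      simp only
      rw [abs_mul, ← sq_abs (‖f z‖ ^ 2 - S₀), ← sq_abs (W z)]
      have := sq_nonneg (|‖f z‖ ^ 2 - S₀| - ε * |W z|)
      rw [div_mul_eq_mul_div, div_mul_eq_mul_div, div_add_div _ _ (by positivity) (by positivity),
        le_div_iff₀ (by positivity)]
      nlinarith
    rw [integral_add (j1.const_mul _) (j2.const_mul _), integral_const_mul, integral_const_mul] at hle
    have hm2 : 1 / (2 * ε) * ∫ z in strip r τ₀ ε, (‖f z‖ ^ 2 - S₀) ^ 2
        ≤ 4 * ε * ∫ z in strip r τ₀ (2 * ε), radRe f u v z ^ 2 := by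
      rw [div_mul_eq_mul_div, one_mul, div_le_iff₀ (by positivity)]
      refine le_of_mul_le_mul_left ?_ hε
      refine hm.trans (le_of_eq ?_)
      ring
    rw [inv_mul_le_iff₀ hε]
    linarith

/-- The winding number of a Sobolev map of annuli, in integrated form. -/
theorem exists_winding (h : AnnulusMap r R f u v) :
    ∃ D : ℝ, ∀ {Z Z' : ℝ → ℝ}, RadialTest r Z Z' →
      ∫ z in annulus 1 r, smoothInv (‖f z‖ ^ 2) * angIm f u v z * Z' (‖z‖ ^ 2)
        = D * (Real.pi * (Z (r ^ 2) - Z 1)) := by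
  have hr := h.one_lt_r
  have hr2 : 0 < r ^ 2 - 1 := by nlinarith
  set A : ℂ → ℝ := fun z => smoothInv (‖f z‖ ^ 2) * angIm f u v z with hA
  have hAi : IntegrableOn A (annulus 1 r) :=
    (h.integrable_mul_comp smoothInv_contDiff.continuous.continuousOn h.integrable_angIm).congr
      (Eventually.of_forall fun z => by simp only [hA]; ring)
  -- The choice F(s) = 1/s gives F's + F = 0 for s ≥ 1, so the Jacobian term disappears: away from
  -- zero, d arg w is closed.
  have closed : ∀ Y Y' : ℝ → ℝ, (∀ τ, HasDerivAt Y (Y' τ) τ) → Continuous Y' →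
      tsupport Y ⊆ Ioo 1 (r ^ 2) → ∫ z in annulus 1 r, (A z * Y' (‖z‖ ^ 2) + 0 * Y (‖z‖ ^ 2)) = 0 := by
    intro Y Y' hY hY' hYs
    refine Eq.trans (integral_congr_ae ?_)
      (h.angular_weak hasDerivAt_smoothInv continuous_deriv_smoothInv hY hY' hYs)
    filter_upwards [h.range] with z hz
    simp only [hA, smoothInv_eq hz.1, deriv_smoothInv hz.1]
    generalize ‖f z‖ ^ 2 = s at hz
    have : s ≠ 0 := by linarith [hz.1]
    field_simp
    ring
  have zero : ∀ {Z Z' : ℝ → ℝ}, RadialTest r Z Z' → Z 1 = 0 → Z (r ^ 2) = 0 →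
      ∫ z in annulus 1 r, A z * Z' (‖z‖ ^ 2) = 0 := by
    intro Z Z' hZ h1 h2
    obtain ⟨L, L', hL, hL', hLZ, -⟩ := hZ.exists_extension hr
    obtain ⟨C, hC0, hC⟩ := exists_lipschitz_bound hL hL' 1 (r ^ 2)
    -- `Z` vanishes at the end and is Lipschitz, hence is bounded by a multiple of |τ - τ₀|. The
    -- boundary term thus vanishes from the integrability of `A` alone, without any boundary
    -- condition on `f`.
    have v : ∀ {τ₀}, τ₀ ∈ Icc 1 (r ^ 2) → τ₀ ∉ Ioo 1 (r ^ 2) → Z τ₀ = 0 →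
        StripVanish r τ₀ (fun z => A z * Z (‖z‖ ^ 2)) := by
      intro τ₀ hτI hτ hZ0
      have v0 : StripVanish r τ₀ (fun _ => 0) := by simp [StripVanish]
      refine v0.of_le hr hτ (C := 0) (w := fun z => C * A z) (integrable_const _)
        (hAi.const_mul C) ?_
      filter_upwards [ae_restrict_mem (measurableSet_annulus 1 r)] with z hz
      have hτz := Ioo_subset_Icc_self ((mem_annulus_iff_sq hr).1 hz)
      have := hC _ hτz _ hτI
      rw [hLZ hτz, hLZ hτI, hZ0, sub_zero] at this
      rw [abs_mul (A z), abs_mul C, abs_of_nonneg hC0, zero_mul, zero_add]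
      nlinarith [abs_nonneg (A z)]
    have := radial_identity_of_stripVanish hr hAi (integrable_const (0 : ℝ)) closed hZ
      (v (left_mem_Icc.2 (by linarith)) (one_notMem_Ioo r) h1)
      (v (right_mem_Icc.2 (by linarith)) (sq_notMem_Ioo r) h2)
    simpa using this
  -- The constant is forced by Z(τ) = τ. A general `Z` differs from its affine interpolant by a
  -- function vanishing at both ends.
  refine ⟨(∫ z in annulus 1 r, A z) / (Real.pi * (r ^ 2 - 1)), fun {Z Z'} hZ => ?_⟩
  set X := interp r (Z 1) (Z (r ^ 2))
  set m := (Z (r ^ 2) - Z 1) / (r ^ 2 - 1) with hm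
  have hXt : RadialTest r X (fun _ => m) := radialTest_interp _ _ _
  have hs : RadialTest r (fun τ => Z τ - X τ) (fun τ => Z' τ - m) :=
    ⟨hZ.cont.sub hXt.cont, hZ.cont'.sub hXt.cont', fun τ hτ => (hZ.deriv τ hτ).sub (hXt.deriv τ hτ)⟩
  have := zero hs (by simp [X, interp_one]) (by simp [X, interp_sq hr])
  have i1 := integrable_mul_comp_normSq hr hZ.cont' hAi
  simp only [mul_sub] at this
  rw [integral_sub i1 (hAi.mul_const m), integral_mul_const, sub_eq_zero] at this
  change ∫ z in annulus 1 r, A z * Z' (‖z‖ ^ 2) = _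
  rw [this, hm]
  have hpi := Real.pi_pos.ne'
  field_simp

/-- The angular free Lagrangian. -/
theorem integral_angular (h : AnnulusMap r R f u v) {D : ℝ}
    (hD : ∀ {Z Z' : ℝ → ℝ}, RadialTest r Z Z' →
      ∫ z in annulus 1 r, smoothInv (‖f z‖ ^ 2) * angIm f u v z * Z' (‖z‖ ^ 2)
        = D * (Real.pi * (Z (r ^ 2) - Z 1)))
    {K K' Z Z' : ℝ → ℝ} (hK : RadialTest R K K') (hZ : RadialTest r Z Z') :
    ∫ z in annulus 1 r, (K (‖f z‖ ^ 2) * angIm f u v z * (‖f z‖ ^ 2)⁻¹ * Z' (‖z‖ ^ 2)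
      + K' (‖f z‖ ^ 2) * jacDet u v z * Z (‖z‖ ^ 2))
      = D * (Real.pi * (K (R ^ 2) * Z (r ^ 2) - K 1 * Z 1)) := by
  have hr := h.one_lt_r
  obtain ⟨L, L', hL, hL', hLK, hLK'⟩ := hK.exists_extension h.one_lt_R
  have hLc := (contDiff_one_of_hasDerivAt hL hL').continuous
  have m1 : (1 : ℝ) ∈ Icc 1 (R ^ 2) := left_mem_Icc.2 h.one_le_R_sq
  have m2 : R ^ 2 ∈ Icc 1 (R ^ 2) := right_mem_Icc.2 h.one_le_R_sq
  set X := interp r (L 1) (L (R ^ 2)) with hX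
  set m := (L (R ^ 2) - L 1) / (r ^ 2 - 1) with hm
  have hXt : RadialTest r X (fun _ => m) := radialTest_interp _ _ _
  set N : ℂ → ℝ := fun z => smoothInv (‖f z‖ ^ 2) * angIm f u v z with hN
  have hNi : IntegrableOn N (annulus 1 r) :=
    (h.integrable_mul_comp smoothInv_contDiff.continuous.continuousOn h.integrable_angIm).congr
      (Eventually.of_forall fun z => by simp only [hN]; ring)
  set J : ℂ → ℝ := fun z => jacDet u v z * L' (‖f z‖ ^ 2) with hJ
  have hJi : IntegrableOn J (annulus 1 r) := h.integrable_mul_comp hL'.continuousOn h.integrable_jacDet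
  have hLN : IntegrableOn (fun z => N z * L (‖f z‖ ^ 2)) (annulus 1 r) :=
    h.integrable_mul_comp hLc.continuousOn hNi
  have hXN : IntegrableOn (fun z => N z * X (‖z‖ ^ 2)) (annulus 1 r) :=
    integrable_mul_comp_normSq hr hXt.cont hNi
  have split : ∀ {W W' : ℝ → ℝ}, RadialTest r W W' →
      ∫ z in annulus 1 r, ((N z * L (‖f z‖ ^ 2) - N z * X (‖z‖ ^ 2)) * W' (‖z‖ ^ 2)
          + (J z - N z * m) * W (‖z‖ ^ 2))
        = (∫ z in annulus 1 r, (N z * L (‖f z‖ ^ 2) * W' (‖z‖ ^ 2) + J z * W (‖z‖ ^ 2)))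
          - D * (Real.pi * (X (r ^ 2) * W (r ^ 2) - X 1 * W 1)) := by
    intro W W' hW
    rw [← hD (hXt.mul hW), ← integral_sub]
    · congr 1; ext1 z; simp only [hN]; ring
    · exact (integrable_mul_comp_normSq hr hW.cont' hLN).add
        (integrable_mul_comp_normSq hr hW.cont hJi)
    · exact integrable_mul_comp_normSq hr (hXt.mul hW).cont' hNi
  -- For F = L/s one has F's + F = L', so the exterior derivative of L(|f|²) d arg f carries exactly
  -- the Jacobian weighted by L'.
  have hF : ∀ s, HasDerivAt (fun s => L s * smoothInv s)
      (L' s * smoothInv s + L s * deriv smoothInv s) s := fun s => (hL s).mul (hasDerivAt_smoothInv s)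
  have hFc : Continuous fun s => L' s * smoothInv s + L s * deriv smoothInv s :=
    (hL'.mul smoothInv_contDiff.continuous).add (hLc.mul continuous_deriv_smoothInv)
  have key := radial_identity_of_stripVanish hr
    (A := fun z => N z * L (‖f z‖ ^ 2) - N z * X (‖z‖ ^ 2)) (B := fun z => J z - N z * m)
    (hLN.sub hXN) (hJi.sub (hNi.mul_const m)) (fun Y Y' hY hY' hYs => by
      rw [split (RadialTest.of_global hY hY'), eq_zero_of_tsupport_subset hYs (one_notMem_Ioo r),
        eq_zero_of_tsupport_subset hYs (sq_notMem_Ioo r)]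
      simp only [mul_zero, sub_zero]
      refine Eq.trans (integral_congr_ae ?_) (h.angular_weak hF hFc hY hY' hYs)
      filter_upwards [h.range] with z hz
      simp only [hN, hJ, deriv_smoothInv hz.1, smoothInv_eq hz.1]
      generalize ‖f z‖ ^ 2 = s at hz
      have : s ≠ 0 := by linarith [hz.1]
      field_simp
      ring) hZ
  obtain ⟨C, hC0, hC⟩ := exists_lipschitz_bound hL hL' 1 (R ^ 2)
  obtain ⟨C', hC'0, hC'⟩ := hZ.exists_bound
  have vanish : ∀ {τ₀ S₀ σ : ℝ},
      ((τ₀ = 1 ∧ S₀ = 1 ∧ σ = -1) ∨ (τ₀ = r ^ 2 ∧ S₀ = R ^ 2 ∧ σ = 1)) → τ₀ ∉ Ioo 1 (r ^ 2) →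
      S₀ ∈ Icc 1 (R ^ 2) → X τ₀ = L S₀ →
      StripVanish r τ₀ (fun z => (N z * L (‖f z‖ ^ 2) - N z * X (‖z‖ ^ 2)) * Z (‖z‖ ^ 2)) := by
    intro τ₀ S₀ σ hcase hτ hS hXS
    -- The factor `N` is only square integrable, so the trace of |f| in the mean does not control
    -- the product; the Poincaré type estimate does.
    refine (h.stripVanish_mul hcase h.memLp_angIm).of_le hr hτ (C := C * C')
      (w := fun z => m * C' * angIm f u v z) ?_ (h.integrable_angIm.const_mul _) ?_
    · exact (h.integrable_mul_comp (K := fun s => s - S₀) (by fun_prop) h.integrable_angIm).congr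
        (Eventually.of_forall fun z => by simp only; ring)
    filter_upwards [h.range, ae_restrict_mem (measurableSet_annulus 1 r)] with z hz hzA
    have h1 := hC _ hz _ hS
    have h2 := abs_interp_sub r (L 1) (L (R ^ 2)) (‖z‖ ^ 2) τ₀
    have h3 := (hC' _ (Ioo_subset_Icc_self ((mem_annulus_iff_sq hr).1 hzA))).1
    rw [← hX, hXS, ← hm] at h2
    have h4 : |N z| ≤ |angIm f u v z| := by
      simp only [hN]
      rw [abs_mul, smoothInv_eq hz.1]
      refine mul_le_of_le_one_left (abs_nonneg _) ?_
      rw [abs_of_nonneg (by positivity)]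
      exact inv_le_one_of_one_le₀ hz.1
    calc |(N z * L (‖f z‖ ^ 2) - N z * X (‖z‖ ^ 2)) * Z (‖z‖ ^ 2)|
        = |N z| * (|(L (‖f z‖ ^ 2) - L S₀) - (X (‖z‖ ^ 2) - L S₀)| * |Z (‖z‖ ^ 2)|) := by
          rw [← abs_mul, ← abs_mul]; ring_nf
      _ ≤ |angIm f u v z| * ((C * |‖f z‖ ^ 2 - S₀| + |m| * |‖z‖ ^ 2 - τ₀|) * C') := by
          refine mul_le_mul h4 (mul_le_mul ((abs_sub _ _).trans (add_le_add h1 h2.le)) h3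
            (abs_nonneg _) (by positivity)) (by positivity) (abs_nonneg _)
      _ = _ := by rw [abs_mul, abs_mul, abs_mul, abs_of_nonneg hC'0]; ring
  have key2 := key (vanish (Or.inl ⟨rfl, rfl, rfl⟩) (one_notMem_Ioo r) m1 (interp_one _ _ _))
    (vanish (Or.inr ⟨rfl, rfl, rfl⟩) (sq_notMem_Ioo r) m2 (interp_sq hr _ _))
  rw [split hZ, sub_eq_zero, hX, interp_one, interp_sq hr, hLK m1, hLK m2] at key2
  rw [← key2]
  refine integral_congr_ae ?_
  filter_upwards [h.range] with z hz
  simp only [hN, hJ]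
  rw [hLK hz, hLK' hz, smoothInv_eq hz.1]
  ring

end AnnulusMap

/-! ### Degree by counting and degree by integration -/

lemma det_eq_of_apply (A : ℂ →L[ℝ] ℂ) :
    A.det = (A 1).re * (A Complex.I).im - (A 1).im * (A Complex.I).re := by
  rw [ContinuousLinearMap.det, ← LinearMap.det_toMatrix Complex.basisOneI, Matrix.det_fin_two]
  simp [LinearMap.toMatrix_apply]
  ring

lemma continuousOn_det_fderiv {X : Set ℂ} (hX : IsOpen X) {f : ℂ → ℂ} (hf : ContDiffOn ℝ 1 f X) :
    ContinuousOn (fun z => (fderiv ℝ f z).det) X := by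
  have hd := hf.continuousOn_fderiv_of_isOpen hX le_rfl
  have h1 := hd.clm_apply (continuousOn_const (c := (1 : ℂ)))
  have h2 := hd.clm_apply (continuousOn_const (c := Complex.I))
  simp only [det_eq_of_apply]
  exact ((Complex.continuous_re.comp_continuousOn h1).mul
    (Complex.continuous_im.comp_continuousOn h2)).sub
    ((Complex.continuous_im.comp_continuousOn h1).mul (Complex.continuous_re.comp_continuousOn h2))

/-- The regular points of a `C¹` map are covered by countably many disjoint measurable sets on each
of which the map is injective and the sign of the Jacobian is constant. -/
lemma exists_injective_partition {X : Set ℂ} (hX : IsOpen X) {f : ℂ → ℂ} (hf : ContDiffOn ℝ 1 f X) :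
    ∃ (A : ℕ → Set ℂ) (σ : ℕ → ℤ), (∀ n, MeasurableSet (A n)) ∧ Pairwise (Function.onFun Disjoint A) ∧
      (⋃ n, A n) = {z ∈ X | (fderiv ℝ f z).det ≠ 0} ∧
      ∀ n, InjOn f (A n) ∧ ∀ z ∈ A n, (SignType.sign (fderiv ℝ f z).det : ℤ) = σ n := by
  set d : ℂ → ℝ := fun z => (fderiv ℝ f z).det with hd
  set S : Set ℂ := {z ∈ X | d z ≠ 0} with hS
  have hdc := continuousOn_det_fderiv hX hf
  -- Near a regular point the inverse function theorem gives injectivity and continuity of the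
  -- determinant gives a constant sign. Countably many such neighbourhoods suffice by the Lindelöf
  -- property and are then made disjoint.
  have hloc : ∀ z, ∃ U : Set ℂ, ∃ σ : ℤ, z ∈ S → IsOpen U ∧ z ∈ U ∧ U ⊆ S ∧ InjOn f U ∧
      ∀ w ∈ U, (SignType.sign (d w) : ℤ) = σ := by
    intro z
    by_cases hz : z ∈ S
    swap
    · exact ⟨∅, 0, fun h => absurd h hz⟩
    have hzX := hX.mem_nhds hz.1
    have hst := (hf.contDiffAt hzX).hasStrictFDerivAt one_ne_zero
    set e := (fderiv ℝ f z).toContinuousLinearEquivOfDetNeZero hz.2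
    have hst' : HasStrictFDerivAt f (e : ℂ →L[ℝ] ℂ) z := hst
    set Φ := hst'.toOpenPartialHomeomorph f
    have hsrc : z ∈ Φ.source := hst'.mem_toOpenPartialHomeomorph_source
    have hsign : ∃ V : Set ℂ, IsOpen V ∧ z ∈ V ∧ V ⊆ S ∧
        ∀ w ∈ V, (SignType.sign (d w) : ℤ) = SignType.sign (d z) := by
      rcases lt_or_gt_of_ne hz.2 with h | h
      · refine ⟨X ∩ d ⁻¹' Iio 0, hdc.isOpen_inter_preimage hX isOpen_Iio, ⟨hz.1, h⟩,
          fun w hw => ⟨hw.1, ne_of_lt hw.2⟩, fun w hw => ?_⟩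
        rw [sign_neg hw.2, sign_neg h]
      · refine ⟨X ∩ d ⁻¹' Ioi 0, hdc.isOpen_inter_preimage hX isOpen_Ioi, ⟨hz.1, h⟩,
          fun w hw => ⟨hw.1, ne_of_gt hw.2⟩, fun w hw => ?_⟩
        rw [sign_pos hw.2, sign_pos h]
    obtain ⟨V, hVo, hzV, hVS, hVs⟩ := hsign
    exact ⟨Φ.source ∩ V, _, fun _ => ⟨Φ.open_source.inter hVo, ⟨hsrc, hzV⟩,
      inter_subset_right.trans hVS, Φ.injOn.mono inter_subset_left, fun w hw => hVs w hw.2⟩⟩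
  choose U σ hU using hloc
  obtain ⟨t, htS, htc, htcov⟩ := TopologicalSpace.countable_cover_nhdsWithin (s := S) (f := U)
    fun z hz => mem_nhdsWithin_of_mem_nhds ((hU z hz).1.mem_nhds (hU z hz).2.1)
  rcases t.eq_empty_or_nonempty with rfl | hne
  · refine ⟨fun _ => ∅, fun _ => 0, fun _ => MeasurableSet.empty, fun _ _ _ => disjoint_bot_left, ?_,
      fun n => ⟨injOn_empty _, fun z hz => absurd hz (notMem_empty z)⟩⟩
    simp only [mem_empty_iff_false, iUnion_of_empty, iUnion_empty] at htcov ⊢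
    exact (subset_empty_iff.1 htcov).symm
  obtain ⟨p, hp⟩ := htc.exists_eq_range hne
  have hpS : ∀ n, p n ∈ S := fun n => htS (hp ▸ mem_range_self n)
  refine ⟨disjointed fun n => U (p n), fun n => σ (p n),
    fun n => MeasurableSet.disjointed (fun i => (hU _ (hpS i)).1.measurableSet) n,
    disjoint_disjointed _, ?_, fun n => ⟨(hU _ (hpS n)).2.2.2.1.mono (disjointed_subset _ n),
      fun z hz => (hU _ (hpS n)).2.2.2.2 z (disjointed_subset _ n hz)⟩⟩
  rw [iUnion_disjointed]
  refine Subset.antisymm (iUnion_subset fun n => (hU _ (hpS n)).2.2.1) ?_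
  rwa [hp, biUnion_range] at htcov

/-- The change of variables formula for `C¹` maps of degree `j`. -/
theorem HasRegularDegree.integral_comp_mul_det {X Y : Set ℂ} (hX : IsOpen X) {f : ℂ → ℂ} {j : ℕ}
    (h : HasRegularDegree X Y f j) (hJ : IntegrableOn (fun z => (fderiv ℝ f z).det) X)
    {φ : ℂ → ℝ} (hφ : Continuous φ) (hc : HasCompactSupport φ) (hs : tsupport φ ⊆ Y) :
    ∫ z in X, φ (f z) * (fderiv ℝ f z).det = j * ∫ w in Y, φ w := by
  obtain ⟨hf, hdeg⟩ := h
  set d : ℂ → ℝ := fun z => (fderiv ℝ f z).det with hd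
  obtain ⟨A, σ, hAm, hAd, hAU, hA⟩ := exists_injective_partition hX hf
  have hder : ∀ z ∈ X, HasFDerivAt f (fderiv ℝ f z) z := fun z hz =>
    ((hf.contDiffAt (hX.mem_nhds hz)).differentiableAt one_ne_zero).hasFDerivAt
  have hAX : ∀ n, A n ⊆ X := fun n z hz => ((hAU ▸ subset_iUnion A n) hz).1
  have hderA : ∀ n, ∀ z ∈ A n, HasFDerivWithinAt f (fderiv ℝ f z) (A n) z := fun n z hz =>
    (hder z (hAX n hz)).hasFDerivWithinAt
  have himg : ∀ n, MeasurableSet (f '' A n) := fun n =>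
    measurable_image_of_fderivWithin (hAm n) (hderA n) (hA n).1
  obtain ⟨C, hC⟩ := hφ.bounded_above_of_compact_support hc
  have hint : IntegrableOn (fun z => φ (f z) * d z) X := by
    refine hJ.bdd_mul (c := C) ?_ (Eventually.of_forall fun z => hC _)
    exact (hφ.comp_continuousOn hf.continuousOn).aestronglyMeasurable hX.measurableSet
  have hSX : (⋃ n, A n) ⊆ X := iUnion_subset hAX
  have e1 : ∫ z in X, φ (f z) * d z = ∫ z in ⋃ n, A n, φ (f z) * d z := by
    refine setIntegral_eq_of_subset_of_forall_sdiff_eq_zero hX.measurableSet hSX fun z hz => ?_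
    have : d z = 0 := by
      by_contra hn
      exact hz.2 (hAU ▸ ⟨hz.1, hn⟩)
    rw [this, mul_zero]
  have habs : ∀ n, ∀ z ∈ A n, d z = σ n * |d z| := by
    intro n z hz
    have e : (((SignType.sign (d z) : SignType) : ℤ) : ℝ) * |d z| = d z := by
      rcases lt_trichotomy (d z) 0 with h | h | h
      · rw [sign_neg h, abs_of_neg h]; simp
      · simp [h]
      · rw [sign_pos h, abs_of_pos h]; simp
    rw [← (hA n).2 z hz]
    exact e.symm
  have hφi : Integrable φ := hφ.integrable_of_hasCompactSupport hc
  set F : ℕ → ℂ → ℝ := fun n => (f '' A n).indicator fun w => σ n * φ w with hF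
  have hFi : ∀ n, Integrable (F n) := fun n => (hφi.const_mul _).indicator (himg n)
  -- On each piece the determinant is a constant sign times its absolute value, so the area formula
  -- for injective maps turns the integral into a signed integral over the image.
  have e2 : ∀ n, ∫ z in A n, φ (f z) * d z = ∫ w, F n w := by
    intro n
    rw [integral_indicator (himg n), integral_image_eq_integral_abs_det_fderiv_smul volume (hAm n)
      (hderA n) (hA n).1]
    refine setIntegral_congr_fun (hAm n) fun z hz => ?_
    simp only [smul_eq_mul]
    rw [habs n z hz, hd]
    simp only
    ring
  have e3 : ∀ n, ∫ w, ‖F n w‖ ≤ ∫ z in A n, ‖φ (f z) * d z‖ := by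
    intro n
    have : (fun w => ‖F n w‖) = (f '' A n).indicator fun w => ‖(σ n : ℝ) * φ w‖ := by
      ext w; exact norm_indicator_eq_indicator_norm _ _
    rw [this, integral_indicator (himg n),
      integral_image_eq_integral_abs_det_fderiv_smul volume (hAm n) (hderA n) (hA n).1]
    refine le_of_eq (setIntegral_congr_fun (hAm n) fun z hz => ?_)
    simp only [smul_eq_mul]
    rw [habs n z hz]
    simp only [norm_mul, Real.norm_eq_abs, abs_abs]
    ring
  have hsum := hasSum_integral_iUnion hAm hAd (hint.mono_set hSX)
  have hsumn := hasSum_integral_iUnion hAm hAd (hint.mono_set hSX).norm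
  have hsumF := hasSum_integral_of_summable_integral_norm hFi
    (Summable.of_nonneg_of_le (fun n => integral_nonneg fun w => norm_nonneg _) e3 hsumn.summable)
  simp only [e2] at hsum
  rw [e1, hsum.unique hsumF]
  -- By Sard's theorem almost every `w` is a regular value, so the counting hypothesis applies at
  -- almost every point of the target.
  have hsard : volume (f '' {z ∈ X | d z = 0}) = 0 :=
    addHaar_image_eq_zero_of_det_fderivWithin_eq_zero volume
      (fun z hz => (hder z hz.1).hasFDerivWithinAt) fun z hz => hz.2
  have hYφ : ∫ w in Y, φ w = ∫ w, φ w := setIntegral_eq_integral_of_forall_compl_eq_zero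
    fun w hw => image_eq_zero_of_notMem_tsupport fun hh => hw (hs hh)
  rw [hYφ, ← integral_const_mul]
  refine integral_congr_ae ?_
  filter_upwards [measure_eq_zero_iff_ae_notMem.1 hsard] with w hw
  by_cases hwY : w ∈ Y
  swap
  · have : φ w = 0 := image_eq_zero_of_notMem_tsupport fun hh => hwY (hs hh)
    simp [hF, indicator, this]
  have hreg : ∀ z ∈ X, f z = w → d z ≠ 0 := fun z hz hfz h0 => hw ⟨z, ⟨hz, h0⟩, hfz⟩
  obtain ⟨hfin, hcount⟩ := hdeg w hwY hreg
  have hmem : ∀ z ∈ {z ∈ X | f z = w}, ∃ n, z ∈ A n := fun z hz =>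
    mem_iUnion.1 (hAU ▸ (⟨hz.1, hreg z hz.1 hz.2⟩ : z ∈ {z ∈ X | d z ≠ 0}))
  choose! ν hν using hmem
  -- Every preimage of `w` lies in exactly one piece, and no piece contains two of them. The series
  -- over pieces is therefore the finite signed count over the fibre.
  have hinj : InjOn ν {z ∈ X | f z = w} := fun z hz z' hz' he =>
    (hA (ν z)).1 (hν z hz) (he ▸ hν z' hz') (hz.2.trans hz'.2.symm)
  have hsupp : ∀ n, n ∉ hfin.toFinset.image ν → F n w = 0 := by
    intro n hn
    refine indicator_of_notMem ?_ _
    rintro ⟨z, hz, hzw⟩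
    have hzF : z ∈ {z ∈ X | f z = w} := ⟨hAX n hz, hzw⟩
    have : ν z = n := by
      by_contra hne
      exact disjoint_left.1 (hAd hne) (hν z hzF) hz
    exact hn (Finset.mem_image.2 ⟨z, hfin.mem_toFinset.2 hzF, this⟩)
  rw [tsum_eq_sum hsupp, Finset.sum_image (by simpa using hinj)]
  rw [finsum_mem_eq_finite_toFinset_sum _ hfin] at hcount
  have : ((j : ℤ) : ℝ) = j := by norm_cast
  rw [← this, ← hcount, Int.cast_sum, Finset.sum_mul]
  refine Finset.sum_congr rfl fun z hz => ?_
  have hzF := hfin.mem_toFinset.1 hz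
  rw [hF]
  simp only
  rw [indicator_of_mem (show w ∈ f '' A (ν z) from ⟨z, hν z hzF, hzF.2⟩), (hA (ν z)).2 z (hν z hzF)]

lemma weakJacobian_eq_jacDet (X : Set ℂ) (f : ℂ → ℂ) :
    weakJacobian X f = jacDet (weakPartial X 1 f) (weakPartial X Complex.I f) := by
  ext z; simp [weakJacobian, jacDet]; ring

/-- For `W^{1,2}` maps the degree by counting agrees with the degree by integration. -/
theorem HasRegularDegree.hasSobolevDegree {X Y : Set ℂ} (hX : IsOpen X) {f : ℂ → ℂ} {j : ℕ}
    (h : HasRegularDegree X Y f j) (hf : MemW12 X f) : HasSobolevDegree X Y f j := by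
  have key : ∀ e, HasL2WeakPartial X e f →
      weakPartial X e f =ᵐ[volume.restrict X] fun z => fderiv ℝ f z e := by
    intro e he
    obtain ⟨h1, h2⟩ := weakPartial_spec he
    exact IsWeakPartial.ae_eq hX (locallyIntegrableOn_of_memLp h1)
      (((h.1.continuousOn_fderiv_of_isOpen hX le_rfl).clm_apply
        continuousOn_const).locallyIntegrableOn hX.measurableSet) h2
      (isWeakPartial_of_contDiffOn hX h.1 e)
  have hx := key 1 hf.partial_x
  have hy := key Complex.I hf.partial_y
  have hae : weakJacobian X f =ᵐ[volume.restrict X] fun z => (fderiv ℝ f z).det := by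
    filter_upwards [hx, hy] with z h1 h2
    rw [weakJacobian, h1, h2, det_eq_of_apply]
  have hJ : IntegrableOn (fun z => (fderiv ℝ f z).det) X := by
    have := ((weakPartial_spec hf.partial_x).1.star.integrable_mul (weakPartial_spec hf.partial_y).1).im
    refine Integrable.congr this (EventuallyEq.trans (Eventually.of_forall fun z => ?_) hae)
    simp [weakJacobian]; ring
  intro φ hφ hc hs
  rw [← h.integral_comp_mul_det hX hJ hφ.continuous hc hs]
  refine integral_congr_ae ?_
  filter_upwards [hae] with z hz
  rw [hz]

/-! ### Admissible maps -/

/-- The trace conditions concern |f| on strips measured in |z|, the free Lagrangians |f|² on strips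
measured in |z|². The factorization |f|² - T² = (|f| + T)(|f| - T) with |f| ≤ R converts the first,
the inclusions `hE` the second. -/
lemma stripVanish_of_tendsto {r R τ₀ S T : ℝ} {f : ℂ → ℂ} {E : ℝ → Set ℂ}
    (hf : MemLp f 2 (volume.restrict (annulus 1 r)))
    (hb : ∀ᵐ z ∂(volume.restrict (annulus 1 r)), 1 ≤ ‖f z‖ ∧ ‖f z‖ ≤ R) (hT : 0 ≤ T) (hTS : T ^ 2 = S)
    (hE : ∀ᶠ ε in 𝓝[>] (0 : ℝ), strip r τ₀ ε ⊆ E ε ∧ E ε ⊆ annulus 1 r)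
    (h : Tendsto (fun ε : ℝ => ε⁻¹ * ∫ z in E ε, |‖f z‖ - T|) (𝓝[>] 0) (𝓝 0)) :
    StripVanish r τ₀ (fun z => ‖f z‖ ^ 2 - S) := by
  have hR0 : 0 ≤ |R| + T := by positivity
  have h2 := h.const_mul (|R| + T)
  rw [mul_zero] at h2
  refine tendsto_of_tendsto_of_tendsto_of_le_of_le' tendsto_const_nhds h2 ?_ ?_
  · filter_upwards [self_mem_nhdsWithin] with ε hε
    exact mul_nonneg (inv_nonneg.2 (le_of_lt hε)) (integral_nonneg fun z => abs_nonneg _)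
  filter_upwards [self_mem_nhdsWithin, hE] with ε hε hEε
  have hε : 0 < ε := hε
  have hi : IntegrableOn (fun z => |‖f z‖ - T|) (annulus 1 r) :=
    ((hf.integrable (by norm_num)).norm.sub (integrable_const T)).abs
  rw [mul_left_comm]
  refine mul_le_mul_of_nonneg_left ?_ (inv_nonneg.2 hε.le)
  rw [← integral_const_mul]
  refine le_trans ?_ (setIntegral_mono_set ((hi.mono_set hEε.2).const_mul _)
    (Eventually.of_forall fun z => mul_nonneg hR0 (abs_nonneg _)) hEε.1.eventuallyLE)
  refine integral_mono_of_nonneg (Eventually.of_forall fun z => abs_nonneg _)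
    ((hi.mono_set (strip_subset _ _ _)).const_mul _) ?_
  filter_upwards [ae_restrict_of_ae_restrict_of_subset (strip_subset r τ₀ ε) hb] with z hz
  rw [← hTS, sq_sub_sq, abs_mul]
  refine mul_le_mul_of_nonneg_right ?_ (abs_nonneg _)
  rw [abs_of_nonneg (by positivity)]
  linarith [hz.2, le_abs_self R]

/-- An admissible map, apart from the degree condition. -/
lemma annulusMap_of_traces {r R : ℝ} (hr : 1 < r) (hR : 1 < R) {f : ℂ → ℂ}
    (hf : MemW12 (annulus 1 r) f)
    (hb : ∀ᵐ z ∂(volume.restrict (annulus 1 r)), 1 ≤ ‖f z‖ ∧ ‖f z‖ ≤ R)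
    (hi : InnerToInner f) (ho : OuterToOuter r R f) :
    AnnulusMap r R f (weakPartial (annulus 1 r) 1 f) (weakPartial (annulus 1 r) Complex.I f) where
  isOpen := isOpen_annulus _ _
  memLp := hf.memLp
  memLp_x := (weakPartial_spec hf.partial_x).1
  memLp_y := (weakPartial_spec hf.partial_y).1
  weak_x := (weakPartial_spec hf.partial_x).2
  weak_y := (weakPartial_spec hf.partial_y).2
  nonneg := by linarith
  bound := hb.mono fun z hz => hz.2
  one_lt_r := hr
  one_lt_R := hR
  lower := hb.mono fun z hz => hz.1
  inner := by
    refine stripVanish_of_tendsto hf.memLp hb zero_le_one (one_pow 2) ?_ hi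
    filter_upwards [self_mem_nhdsWithin, nhdsWithin_le_nhds (Iio_mem_nhds (sub_pos.2 hr))] with ε hε hε2
    have hε : 0 < ε := hε
    have hε2 : ε < r - 1 := hε2
    refine ⟨fun z hz => ⟨hz.1.1, ?_⟩, fun z hz => ⟨hz.1, by linarith [hz.2]⟩⟩
    have := (abs_lt.1 hz.2).2
    nlinarith [hz.1.1]
  outer := by
    refine stripVanish_of_tendsto hf.memLp hb (by linarith) rfl ?_ ho
    filter_upwards [self_mem_nhdsWithin, nhdsWithin_le_nhds (Iio_mem_nhds (sub_pos.2 hr)),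
      nhdsWithin_le_nhds (Iio_mem_nhds one_pos)] with ε hε hε2 hε3
    have hε : 0 < ε := hε
    have hε2 : ε < r - 1 := hε2
    have hε3 : ε < 1 := hε3
    refine ⟨fun z hz => ⟨?_, hz.1.2⟩, fun z hz => ⟨by linarith [hz.1], hz.2⟩⟩
    have := (abs_lt.1 hz.2).1
    by_contra hn
    have h1 : ‖z‖ ≤ r - ε := not_lt.1 hn
    have h2 : ‖z‖ ^ 2 ≤ (r - ε) ^ 2 := pow_le_pow_left₀ (norm_nonneg z) h1 2
    nlinarith

/-- The winding number of a map of degree `j` is `j`. -/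
lemma AnnulusMap.winding_eq {r R : ℝ} {f u v : ℂ → ℂ} (h : AnnulusMap r R f u v) {D j : ℝ}
    (hD : ∀ {Z Z' : ℝ → ℝ}, RadialTest r Z Z' →
      ∫ z in annulus 1 r, smoothInv (‖f z‖ ^ 2) * angIm f u v z * Z' (‖z‖ ^ 2)
        = D * (Real.pi * (Z (r ^ 2) - Z 1)))
    (hj : ∀ φ : ℂ → ℝ, ContDiff ℝ ∞ φ → HasCompactSupport φ → tsupport φ ⊆ annulus 1 R →
      ∫ z in annulus 1 r, φ (f z) * jacDet u v z = j * ∫ w in annulus 1 R, φ w) : D = j := by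
  have hR2 : 0 < R ^ 2 - 1 := by nlinarith [h.one_lt_R]
  -- With `K` a primitive of this bump and Z = 1, the angular identity computes the integral of
  -- β(|f|²) times the Jacobian as D π ∫ β. The degree formula for φ(w) = β(|w|²) computes the same
  -- integral as j π ∫ β.
  let β : ContDiffBump ((1 + R ^ 2) / 2) := ⟨(R ^ 2 - 1) / 8, (R ^ 2 - 1) / 4, by linarith, by linarith⟩
  have hβs : tsupport β ⊆ Ioo 1 (R ^ 2) := by
    rw [β.tsupport_eq, Real.closedBall_eq_Icc]
    intro x hx
    have h1 : (1 + R ^ 2) / 2 - (R ^ 2 - 1) / 4 ≤ x := hx.1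
    have h2 : x ≤ (1 + R ^ 2) / 2 + (R ^ 2 - 1) / 4 := hx.2
    constructor <;> linarith
  have hβI : 0 < ∫ s in (1 : ℝ)..R ^ 2, β s := by
    rw [intervalIntegral.integral_eq_integral_of_support_subset
      (((subset_tsupport _).trans hβs).trans Ioo_subset_Ioc_self)]
    exact β.integral_pos
  have hβc : Continuous β := β.continuous
  have hK : RadialTest R (fun s => ∫ x in (1 : ℝ)..s, β x) β :=
    RadialTest.of_global (fun s => (hβc.integral_hasStrictDerivAt 1 s).hasDerivAt) hβc
  have hZ : RadialTest r (fun _ => 1) (fun _ => 0) :=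
    RadialTest.of_global (fun s => hasDerivAt_const _ _) continuous_const
  have e1 := h.integral_angular hD hK hZ
  have e2 := hj (fun w => β (‖w‖ ^ 2)) (β.contDiff.comp (contDiff_norm_sq ℝ))
    (AnnulusMap.hasCompactSupport_comp_normSq h.one_lt_R hβs)
    (AnnulusMap.tsupport_comp_normSq h.one_lt_R hβs)
  rw [integral_annulus_comp_normSq h.one_lt_R hβc.continuousOn] at e2
  simp only [mul_zero, zero_add, mul_one, intervalIntegral.integral_same, sub_zero] at e1
  rw [e2] at e1
  have : Real.pi * ∫ s in (1 : ℝ)..R ^ 2, β s ≠ 0 := (mul_pos Real.pi_pos hβI).ne'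
  exact (mul_right_cancel₀ this e1).symm

namespace IsAdmissible

variable {j : ℕ} {r R : ℝ} {f : ℂ → ℂ}

lemma annulusMap (hr : 1 < r) (hR : 1 < R) (h : IsAdmissible j r R f) :
    AnnulusMap r R f (weakPartial (annulus 1 r) 1 f) (weakPartial (annulus 1 r) Complex.I f) :=
  annulusMap_of_traces hr hR h.sobolev h.range h.inner h.outer

lemma integral_angular (hr : 1 < r) (hR : 1 < R) (h : IsAdmissible j r R f)
    {K K' Z Z' : ℝ → ℝ} (hK : RadialTest R K K') (hZ : RadialTest r Z Z') :
    ∫ z in annulus 1 r, (K (‖f z‖ ^ 2)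
        * angIm f (weakPartial (annulus 1 r) 1 f) (weakPartial (annulus 1 r) Complex.I f) z
        * (‖f z‖ ^ 2)⁻¹ * Z' (‖z‖ ^ 2)
      + K' (‖f z‖ ^ 2) * jacDet (weakPartial (annulus 1 r) 1 f) (weakPartial (annulus 1 r) Complex.I f) z
        * Z (‖z‖ ^ 2))
      = j * (Real.pi * (K (R ^ 2) * Z (r ^ 2) - K 1 * Z 1)) := by
  have ha := h.annulusMap hr hR
  obtain ⟨D, hD⟩ := ha.exists_winding
  have hdeg : HasSobolevDegree (annulus 1 r) (annulus 1 R) f j :=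
    h.degree.elim (fun hd => hd.hasSobolevDegree (isOpen_annulus _ _) h.sobolev) id
  have : D = j := ha.winding_eq hD fun φ h1 h2 h3 => by
    rw [← weakJacobian_eq_jacDet]; exact hdeg φ h1 h2 h3
  rw [← this]
  exact ha.integral_angular hD hK hZ

end IsAdmissible

/-! ### Energy estimates -/

/-- The radial and angular derivatives arise from the partial derivatives by a rotation scaled by
|z|, and multiplication by conj f scales by |f|. The same transformation multiplies the Jacobian by
|z|² |f|². -/
lemma energy_identity (f u v : ℂ → ℂ) (z : ℂ) :
    (‖u z‖ ^ 2 + ‖v z‖ ^ 2) * ‖z‖ ^ 2 * ‖f z‖ ^ 2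
      = radRe f u v z ^ 2 + radIm f u v z ^ 2 + angRe f u v z ^ 2 + angIm f u v z ^ 2 := by
  simp only [← Complex.normSq_eq_norm_sq, Complex.normSq_apply, radRe, radIm, angRe, angIm,
    Complex.mul_re, Complex.mul_im, Complex.add_re, Complex.add_im, Complex.sub_re, Complex.sub_im,
    Complex.conj_re, Complex.conj_im, Complex.ofReal_re, Complex.ofReal_im]
  ring

lemma jacobian_identity (f u v : ℂ → ℂ) (z : ℂ) :
    jacDet u v z * ‖z‖ ^ 2 * ‖f z‖ ^ 2
      = radRe f u v z * angIm f u v z - radIm f u v z * angRe f u v z := by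
  simp only [← Complex.normSq_eq_norm_sq, Complex.normSq_apply, radRe, radIm, angRe, angIm, jacDet,
    Complex.mul_re, Complex.mul_im, Complex.add_re, Complex.add_im, Complex.sub_re, Complex.sub_im,
    Complex.conj_re, Complex.conj_im, Complex.ofReal_re, Complex.ofReal_im]
  ring

/-- A map of annuli whose angular free Lagrangians are those of a map of degree `j`. -/
structure DegreeMap (j r R : ℝ) (f u v : ℂ → ℂ) : Prop extends AnnulusMap r R f u v where
  angular : ∀ {K K' Z Z' : ℝ → ℝ}, RadialTest R K K' → RadialTest r Z Z' →
    ∫ z in annulus 1 r, (K (‖f z‖ ^ 2) * angIm f u v z * (‖f z‖ ^ 2)⁻¹ * Z' (‖z‖ ^ 2)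
      + K' (‖f z‖ ^ 2) * jacDet u v z * Z (‖z‖ ^ 2))
      = j * (Real.pi * (K (R ^ 2) * Z (r ^ 2) - K 1 * Z 1))

lemma IsAdmissible.degreeMap {j : ℕ} {r R : ℝ} {f : ℂ → ℂ} (hr : 1 < r) (hR : 1 < R)
    (h : IsAdmissible j r R f) :
    DegreeMap j r R f (weakPartial (annulus 1 r) 1 f) (weakPartial (annulus 1 r) Complex.I f) :=
  { h.annulusMap hr hR with angular := fun hK hZ => h.integral_angular hr hR hK hZ }

/-- The equations satisfied by the derivatives of the radial minimizer at a point `z`. -/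
def RadialSystem (j c : ℝ) (f u v : ℂ → ℂ) (z : ℂ) : Prop :=
  radRe f u v z = j * √(‖f z‖ ^ 2 * (‖f z‖ ^ 2 - c)) ∧ angIm f u v z = j * ‖f z‖ ^ 2 ∧
    angRe f u v z = 0 ∧ radIm f u v z = 0

lemma radialTest_log (r : ℝ) : RadialTest r Real.log (fun τ => τ⁻¹) where
  cont := Real.continuousOn_log.mono fun τ hτ => by
    have : (0 : ℝ) < τ := by linarith [hτ.1]
    exact this.ne'
  cont' := continuousOn_inv₀.mono fun τ hτ => by
    have : (0 : ℝ) < τ := by linarith [hτ.1]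
    exact this.ne'
  deriv := fun τ hτ => Real.hasDerivAt_log (by linarith [hτ.1])

lemma radialTest_one (r : ℝ) : RadialTest r (fun _ => 1) (fun _ => 0) :=
  RadialTest.of_global (fun _ => hasDerivAt_const _ _) continuous_const

lemma exists_radialTest_primitive {R : ℝ} (hR : 1 < R) {k : ℝ → ℝ}
    (hk : ContinuousOn k (Icc 1 (R ^ 2))) : ∃ K : ℝ → ℝ, RadialTest R K k ∧ K 1 = 0 := by
  have h1 : (1 : ℝ) ≤ R ^ 2 := by nlinarith
  have hc : Continuous (IccExtend h1 ((Icc 1 (R ^ 2)).domRestrict k)) :=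
    hk.domRestrict.Icc_extend'
  refine ⟨fun s => ∫ x in (1 : ℝ)..s, IccExtend h1 ((Icc 1 (R ^ 2)).domRestrict k) x, ⟨?_, hk, ?_⟩,
    intervalIntegral.integral_same⟩
  · exact (continuous_iff_continuousAt.2 fun s =>
      (hc.integral_hasStrictDerivAt 1 s).hasDerivAt.continuousAt).continuousOn
  · intro s hs
    refine (hc.integral_hasStrictDerivAt 1 s).hasDerivAt.congr_deriv ?_
    rw [IccExtend_of_mem h1 _ (Ioo_subset_Icc_self hs)]
    rfl

namespace DegreeMap

variable {j r R : ℝ} {f u v : ℂ → ℂ}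

lemma integrable_energy (h : AnnulusMap r R f u v) :
    IntegrableOn (fun z => ‖u z‖ ^ 2 + ‖v z‖ ^ 2) (annulus 1 r) :=
  (h.memLp_x.integrable_norm_pow (by norm_num)).add (h.memLp_y.integrable_norm_pow (by norm_num))

lemma integrable_angIm_div (h : AnnulusMap r R f u v) :
    IntegrableOn (fun z => angIm f u v z * (‖f z‖ ^ 2)⁻¹ * (‖z‖ ^ 2)⁻¹) (annulus 1 r) :=
  integrable_mul_comp_normSq h.one_lt_r (radialTest_log r).cont'
    (h.integrable_mul_comp (radialTest_log R).cont' h.integrable_angIm)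

lemma integral_angIm_div (h : DegreeMap j r R f u v) :
    ∫ z in annulus 1 r, angIm f u v z * (‖f z‖ ^ 2)⁻¹ * (‖z‖ ^ 2)⁻¹
      = j * (Real.pi * Real.log (r ^ 2)) := by
  have := h.angular (radialTest_one R) (radialTest_log r)
  simpa using this

lemma integral_mul_jacDet (h : DegreeMap j r R f u v) {K K' : ℝ → ℝ} (hK : RadialTest R K K') :
    ∫ z in annulus 1 r, jacDet u v z * K' (‖f z‖ ^ 2) = j * (Real.pi * (K (R ^ 2) - K 1)) := by
  have := h.angular hK (radialTest_one r)
  simpa [mul_comm] using this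

lemma integrable_radRe_div (h : AnnulusMap r R f u v) {K K' : ℝ → ℝ} (hK : RadialTest R K K') :
    IntegrableOn (fun z => radRe f u v z * K' (‖f z‖ ^ 2) * (‖z‖ ^ 2)⁻¹) (annulus 1 r) :=
  integrable_mul_comp_normSq h.one_lt_r (radialTest_log r).cont'
    (h.integrable_mul_comp hK.cont' h.integrable_radRe)

lemma integral_radRe_div (h : AnnulusMap r R f u v) {K K' : ℝ → ℝ} (hK : RadialTest R K K') :
    ∫ z in annulus 1 r, radRe f u v z * K' (‖f z‖ ^ 2) * (‖z‖ ^ 2)⁻¹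
      = Real.pi * (K (R ^ 2) - K 1) := by
  have := h.integral_radial hK (radialTest_one r)
  simpa [mul_comm] using this

lemma integrable_inv_normSq (hr : 1 < r) :
    IntegrableOn (fun z : ℂ => (‖z‖ ^ 2)⁻¹) (annulus 1 r) :=
  integrable_comp_normSq hr (radialTest_log r).cont'

lemma integral_inv_normSq (hr : 1 < r) :
    ∫ z in annulus 1 r, (‖z‖ ^ 2)⁻¹ = Real.pi * Real.log (r ^ 2) := by
  simpa using (radialTest_log r).integral_deriv hr

/-- The calibration principle: `L` has the known integral `κ` and lies below `E`, so the energy is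
at least `κ`, with equality exactly where the nonnegative gap vanishes almost everywhere. -/
lemma integral_eq_iff_of_nonneg {E L : ℂ → ℝ} {p : ℂ → Prop} {κ : ℝ}
    (hE : IntegrableOn E (annulus 1 r)) (hL : IntegrableOn L (annulus 1 r))
    (hκ : ∫ z in annulus 1 r, L z = κ)
    (h : ∀ᵐ z ∂(volume.restrict (annulus 1 r)), 0 ≤ E z - L z ∧ (E z - L z = 0 ↔ p z)) :
    κ ≤ ∫ z in annulus 1 r, E z ∧
      (∫ z in annulus 1 r, E z = κ ↔ ∀ᵐ z ∂(volume.restrict (annulus 1 r)), p z) := by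
  have e := integral_sub hE hL
  have h0 : 0 ≤ᵐ[volume.restrict (annulus 1 r)] fun z => E z - L z := h.mono fun z hz => hz.1
  have := integral_nonneg_of_ae h0
  refine ⟨by linarith, ?_⟩
  have h2 := integral_eq_zero_iff_of_nonneg_ae h0 (hE.fun_sub hL)
  have h3 : ∫ z in annulus 1 r, E z = κ ↔ ∫ z in annulus 1 r, (E z - L z) = 0 := by
    rw [e, hκ, sub_eq_zero]
  rw [h3, h2]
  constructor
  · intro hh
    filter_upwards [h, hh] with z hz1 hz2
    exact hz1.2.1 hz2
  · intro hh
    filter_upwards [h, hh] with z hz1 hz2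
    exact hz1.2.2 hz2

lemma sqrt_mul_eq {s c l : ℝ} (hs : 0 < s) (hl : 0 ≤ l) (h : l ^ 2 * s = s - c) :
    √(s * (s - c)) = l * s := by
  rw [← h, show s * (l ^ 2 * s) = (l * s) ^ 2 by ring, Real.sqrt_sq (by positivity)]

/-- The calibration is 2lJ + c(2jN/(sτ) - j²/τ) with l = √(1 - c/s), which is real for s ≥ 1 since c
≤ 1. The Jacobian is weighted by l ≤ 1, and the positive coefficient c/s left over pays for the
square of the angular speed minus j. -/
lemma energy_bound_of_pos {c : ℝ} (hr : 1 < r) (hR : 1 < R) (hc0 : 0 < c) (hc1 : c ≤ 1) :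
    ∃ κ : ℝ, ∀ f u v, DegreeMap j r R f u v →
      κ ≤ ∫ z in annulus 1 r, (‖u z‖ ^ 2 + ‖v z‖ ^ 2) ∧
      (∫ z in annulus 1 r, (‖u z‖ ^ 2 + ‖v z‖ ^ 2) = κ ↔
        ∀ᵐ z ∂(volume.restrict (annulus 1 r)), RadialSystem j c f u v z) := by
  have hk : ContinuousOn (fun s : ℝ => √(1 - c * s⁻¹)) (Icc 1 (R ^ 2)) :=
    (continuousOn_const.sub (continuousOn_const.mul (radialTest_log R).cont')).sqrt
  obtain ⟨K, hK, hK1⟩ := exists_radialTest_primitive hR hk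
  refine ⟨2 * (j * (Real.pi * (K (R ^ 2) - K 1))) + c * (2 * j * (j * (Real.pi * Real.log (r ^ 2)))
    - j ^ 2 * (Real.pi * Real.log (r ^ 2))), fun f u v h => ?_⟩
  have i1 := h.integrable_mul_comp hk h.integrable_jacDet
  have i2 := integrable_angIm_div h.toAnnulusMap
  have i3 := integrable_inv_normSq hr
  have i4 : IntegrableOn (fun z => 2 * j * (angIm f u v z * (‖f z‖ ^ 2)⁻¹ * (‖z‖ ^ 2)⁻¹)
    - j ^ 2 * (‖z‖ ^ 2)⁻¹) (annulus 1 r) := (i2.const_mul (2 * j)).sub (i3.const_mul (j ^ 2))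
  refine integral_eq_iff_of_nonneg (integrable_energy h.toAnnulusMap)
    (L := fun z => 2 * (jacDet u v z * √(1 - c * (‖f z‖ ^ 2)⁻¹))
      + c * (2 * j * (angIm f u v z * (‖f z‖ ^ 2)⁻¹ * (‖z‖ ^ 2)⁻¹) - j ^ 2 * (‖z‖ ^ 2)⁻¹))
    (Integrable.fun_add (i1.const_mul 2) (i4.const_mul c)) ?_ ?_
  · rw [integral_add (i1.const_mul 2) (i4.const_mul c),
      integral_const_mul, integral_const_mul, integral_sub (i2.const_mul (2 * j)) (i3.const_mul (j ^ 2)),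
      integral_const_mul, integral_const_mul, h.integral_angIm_div, integral_inv_normSq hr,
      h.integral_mul_jacDet hK]
  filter_upwards [h.range, ae_restrict_mem (measurableSet_annulus 1 r)] with z hz hzA
  have hτ : 0 < ‖z‖ ^ 2 := by linarith [((mem_annulus_iff_sq hr).1 hzA).1]
  have hs : 0 < ‖f z‖ ^ 2 := by linarith [hz.1]
  have hl0 := Real.sqrt_nonneg (1 - c * (‖f z‖ ^ 2)⁻¹)
  have hl : √(1 - c * (‖f z‖ ^ 2)⁻¹) ^ 2 * ‖f z‖ ^ 2 = ‖f z‖ ^ 2 - c := by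
    rw [Real.sq_sqrt]
    · rw [sub_mul, one_mul, mul_assoc, inv_mul_cancel₀ hs.ne', mul_one]
    · rw [sub_nonneg, mul_inv_le_iff₀ hs]; linarith [hz.1]
  have e1 := energy_identity f u v z
  have e2 := jacobian_identity f u v z
  have e3 := sqrt_mul_eq hs hl0 hl
  unfold RadialSystem
  rw [e3]
  generalize √(1 - c * (‖f z‖ ^ 2)⁻¹) = l at *
  generalize ‖f z‖ ^ 2 = s at *
  generalize ‖z‖ ^ 2 = τ at *
  generalize radRe f u v z = P at *
  generalize radIm f u v z = Q at *
  generalize angRe f u v z = M at *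
  generalize angIm f u v z = N at *
  generalize jacDet u v z = J at *
  generalize ‖u z‖ ^ 2 + ‖v z‖ ^ 2 = E at *
  set D := E - (2 * (J * l) + c * (2 * j * (N * s⁻¹ * τ⁻¹) - j ^ 2 * τ⁻¹)) with hD
  -- All four squares vanish together exactly for M = 0, N = js, Q = 0 and P = lN = j √(s(s - c)).
  -- The value l = 0, attained where c = s = 1, causes no trouble as nothing is divided by l.
  have key : D * τ * s = (P - l * N) ^ 2 + (Q + l * M) ^ 2 + c / s * M ^ 2 + c / s * (N - j * s) ^ 2 := by
    have : D * τ * s = E * τ * s - 2 * l * (J * τ * s) - c * (2 * j * N - j ^ 2 * s) := by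
      rw [hD]; field_simp; ring
    rw [this, e1, e2]
    have hl' : l ^ 2 = 1 - c / s := by field_simp; linarith
    have hcs : c / s * s = c := by field_simp
    linear_combination (-(N ^ 2 + M ^ 2)) * hl' + (2 * j * N - j ^ 2 * s) * hcs
  have hcs : 0 < c / s := by positivity
  have hD0 : 0 ≤ D * τ * s := by rw [key]; positivity
  refine ⟨?_, fun hz0 => ?_, fun hz0 => ?_⟩
  · by_contra hn
    have : D * τ * s < 0 := mul_neg_of_neg_of_pos (mul_neg_of_neg_of_pos (not_le.1 hn) hτ) hs
    linarith
  · rw [hz0, zero_mul, zero_mul] at key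
    have n1 := sq_nonneg (P - l * N)
    have n2 := sq_nonneg (Q + l * M)
    have n3 : 0 ≤ c / s * M ^ 2 := by positivity
    have n4 : 0 ≤ c / s * (N - j * s) ^ 2 := by positivity
    have a1 : P - l * N = 0 := pow_eq_zero_iff two_ne_zero |>.1 (by linarith)
    have a2 : Q + l * M = 0 := pow_eq_zero_iff two_ne_zero |>.1 (by linarith)
    have a3 : M = 0 := by
      have : c / s * M ^ 2 = 0 := by linarith
      simpa [hcs.ne'] using this
    have a4 : N - j * s = 0 := by
      have : c / s * (N - j * s) ^ 2 = 0 := by linarith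
      simpa [hcs.ne'] using this
    exact ⟨by rw [a3] at a2; linear_combination a1 + l * a4, by linarith, a3, by rw [a3] at a2; linarith⟩
  · obtain ⟨rfl, rfl, rfl, rfl⟩ := hz0
    have : D * τ * s = 0 := by rw [key]; ring
    simpa [hτ.ne', hs.ne'] using this

/-- For negative c the weight l = √(1 - c/s) exceeds 1, and the roles of the radial and angular
directions are exchanged: the Jacobian is weighted by 1/l, and the surplus -c/s penalizes the
deviation of the radial component P from jls. The linear term in P is a radial free Lagrangian. -/
lemma energy_bound_of_neg {c : ℝ} (hr : 1 < r) (hR : 1 < R) (hc0 : c < 0) :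
    ∃ κ : ℝ, ∀ f u v, DegreeMap j r R f u v →
      κ ≤ ∫ z in annulus 1 r, (‖u z‖ ^ 2 + ‖v z‖ ^ 2) ∧
      (∫ z in annulus 1 r, (‖u z‖ ^ 2 + ‖v z‖ ^ 2) = κ ↔
        ∀ᵐ z ∂(volume.restrict (annulus 1 r)), RadialSystem j c f u v z) := by
  have hpos : ∀ s ∈ Icc 1 (R ^ 2), 0 < √(1 - c * s⁻¹) := fun s hs => by
    have : 0 < s⁻¹ := inv_pos.2 (by linarith [hs.1])
    exact Real.sqrt_pos.2 (by nlinarith)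
  have hk : ContinuousOn (fun s : ℝ => (√(1 - c * s⁻¹))⁻¹) (Icc 1 (R ^ 2)) :=
    (continuousOn_const.sub (continuousOn_const.mul (radialTest_log R).cont')).sqrt.inv₀
      fun s hs => (hpos s hs).ne'
  obtain ⟨K, hK, hK1⟩ := exists_radialTest_primitive hR hk
  have hk2 : ContinuousOn (fun s : ℝ => (√(1 - c * s⁻¹))⁻¹ * s⁻¹) (Icc 1 (R ^ 2)) :=
    hk.mul (radialTest_log R).cont'
  obtain ⟨K₂, hK₂, hK₂1⟩ := exists_radialTest_primitive hR hk2
  refine ⟨2 * (j * (Real.pi * (K (R ^ 2) - K 1))) + -c * (2 * j * (Real.pi * (K₂ (R ^ 2) - K₂ 1))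
    - j ^ 2 * (Real.pi * Real.log (r ^ 2))), fun f u v h => ?_⟩
  have i1 := h.integrable_mul_comp hk h.integrable_jacDet
  have i2 := integrable_radRe_div h.toAnnulusMap hK₂
  have i3 := integrable_inv_normSq hr
  have i4 : IntegrableOn (fun z => 2 * j * (radRe f u v z * ((√(1 - c * (‖f z‖ ^ 2)⁻¹))⁻¹
    * (‖f z‖ ^ 2)⁻¹) * (‖z‖ ^ 2)⁻¹) - j ^ 2 * (‖z‖ ^ 2)⁻¹) (annulus 1 r) :=
    (i2.const_mul (2 * j)).sub (i3.const_mul (j ^ 2))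
  refine integral_eq_iff_of_nonneg (integrable_energy h.toAnnulusMap)
    (L := fun z => 2 * (jacDet u v z * (√(1 - c * (‖f z‖ ^ 2)⁻¹))⁻¹)
      + -c * (2 * j * (radRe f u v z * ((√(1 - c * (‖f z‖ ^ 2)⁻¹))⁻¹ * (‖f z‖ ^ 2)⁻¹) * (‖z‖ ^ 2)⁻¹)
        - j ^ 2 * (‖z‖ ^ 2)⁻¹))
    (Integrable.fun_add (i1.const_mul 2) (i4.const_mul (-c))) ?_ ?_
  · rw [integral_add (i1.const_mul 2)
        (i4.const_mul (-c)),
      integral_const_mul, integral_const_mul, integral_sub (i2.const_mul (2 * j)) (i3.const_mul (j ^ 2)),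
      integral_const_mul, integral_const_mul, integral_radRe_div h.toAnnulusMap hK₂,
      integral_inv_normSq hr, h.integral_mul_jacDet hK]
  filter_upwards [h.range, ae_restrict_mem (measurableSet_annulus 1 r)] with z hz hzA
  have hτ : 0 < ‖z‖ ^ 2 := by linarith [((mem_annulus_iff_sq hr).1 hzA).1]
  have hs : 0 < ‖f z‖ ^ 2 := by linarith [hz.1]
  have hl0 := hpos _ hz
  have hl : √(1 - c * (‖f z‖ ^ 2)⁻¹) ^ 2 * ‖f z‖ ^ 2 = ‖f z‖ ^ 2 - c := by
    rw [Real.sq_sqrt (Real.sqrt_pos.1 hl0).le, sub_mul, one_mul, mul_assoc, inv_mul_cancel₀ hs.ne', mul_one]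
  have e1 := energy_identity f u v z
  have e2 := jacobian_identity f u v z
  have e3 := sqrt_mul_eq hs hl0.le hl
  unfold RadialSystem
  rw [e3]
  generalize √(1 - c * (‖f z‖ ^ 2)⁻¹) = l at *
  generalize ‖f z‖ ^ 2 = s at *
  generalize ‖z‖ ^ 2 = τ at *
  generalize radRe f u v z = P at *
  generalize radIm f u v z = Q at *
  generalize angRe f u v z = M at *
  generalize angIm f u v z = N at *
  generalize jacDet u v z = J at *
  generalize ‖u z‖ ^ 2 + ‖v z‖ ^ 2 = E at *
  set D := E - (2 * (J * l⁻¹) + -c * (2 * j * (P * (l⁻¹ * s⁻¹) * τ⁻¹) - j ^ 2 * τ⁻¹)) with hD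
  have hls : 0 < l ^ 2 * s := by positivity
  have key : D * τ * s * l ^ 2 = (l * N - P) ^ 2 + (l * M + Q) ^ 2 + -c / s * Q ^ 2
      + -c / s * (P - j * (l * s)) ^ 2 := by
    have : D * τ * s * l ^ 2 = (E * τ * s) * l ^ 2 - 2 * l * (J * τ * s)
        + c * (2 * j * P * l - j ^ 2 * s * l ^ 2) := by
      rw [hD]; field_simp; ring
    rw [this, e1, e2]
    have hl' : l ^ 2 = 1 + -c / s := by field_simp; linarith
    have hcs : -c / s * s = -c := by field_simp
    linear_combination (P ^ 2 + Q ^ 2) * hl' + (2 * j * P * l - j ^ 2 * s * l ^ 2) * hcs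
  have hcs : 0 < -c / s := div_pos (by linarith) hs
  have hD0 : 0 ≤ D * τ * s * l ^ 2 := by rw [key]; positivity
  refine ⟨?_, fun hz0 => ?_, fun hz0 => ?_⟩
  · by_contra hn
    have : D * τ * s * l ^ 2 < 0 := mul_neg_of_neg_of_pos
      (mul_neg_of_neg_of_pos (mul_neg_of_neg_of_pos (not_le.1 hn) hτ) hs) (by positivity)
    linarith
  · rw [hz0, zero_mul, zero_mul, zero_mul] at key
    have n1 := sq_nonneg (l * N - P)
    have n2 := sq_nonneg (l * M + Q)
    have n3 : 0 ≤ -c / s * Q ^ 2 := by positivity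
    have n4 : 0 ≤ -c / s * (P - j * (l * s)) ^ 2 := by positivity
    have a1 : l * N - P = 0 := pow_eq_zero_iff two_ne_zero |>.1 (by linarith)
    have a2 : l * M + Q = 0 := pow_eq_zero_iff two_ne_zero |>.1 (by linarith)
    have a3 : Q = 0 := by
      have : -c / s * Q ^ 2 = 0 := by linarith
      exact pow_eq_zero_iff two_ne_zero |>.1 ((mul_eq_zero.1 this).resolve_left hcs.ne')
    have a4 : P - j * (l * s) = 0 := by
      have : -c / s * (P - j * (l * s)) ^ 2 = 0 := by linarith
      exact pow_eq_zero_iff two_ne_zero |>.1 ((mul_eq_zero.1 this).resolve_left hcs.ne')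
    refine ⟨by linarith, mul_left_cancel₀ hl0.ne' (by linear_combination a1 + a4),
      mul_left_cancel₀ hl0.ne' (by linear_combination a2 - a3), a3⟩
  · obtain ⟨rfl, rfl, rfl, rfl⟩ := hz0
    have : D * τ * s * l ^ 2 = 0 := by rw [key]; ring
    simpa [hτ.ne', hs.ne', hl0.ne'] using this

/-- The calibration is twice the Jacobian; the gap is (P - N)² + (Q + M)² up to a positive factor,
so equality gives only the Cauchy-Riemann equations. The hypothesis log R² = j log r² yields a
further identity that pins down P and Q. -/
lemma energy_bound_of_zero (hr : 1 < r)
    (hrR : Real.log (R ^ 2) = j * Real.log (r ^ 2)) :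
    ∃ κ : ℝ, ∀ f u v, DegreeMap j r R f u v →
      κ ≤ ∫ z in annulus 1 r, (‖u z‖ ^ 2 + ‖v z‖ ^ 2) ∧
      (∫ z in annulus 1 r, (‖u z‖ ^ 2 + ‖v z‖ ^ 2) = κ ↔
        ∀ᵐ z ∂(volume.restrict (annulus 1 r)), RadialSystem j 0 f u v z) := by
  have hid : RadialTest R id (fun _ => 1) := RadialTest.of_global hasDerivAt_id continuous_const
  refine ⟨2 * (j * (Real.pi * (R ^ 2 - 1))), fun f u v h => ?_⟩
  have i1 : IntegrableOn (fun z => jacDet u v z * 1) (annulus 1 r) :=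
    h.integrable_mul_comp hid.cont' h.integrable_jacDet
  have main := integral_eq_iff_of_nonneg (integrable_energy h.toAnnulusMap)
    (L := fun z => 2 * (jacDet u v z * 1)) (κ := 2 * (j * (Real.pi * (R ^ 2 - 1))))
    (p := fun z => radRe f u v z = angIm f u v z ∧ radIm f u v z = - angRe f u v z)
    (i1.const_mul 2) (by
      rw [integral_const_mul]
      have := h.integral_mul_jacDet hid
      simp only [id] at this
      rw [this]) (by
      filter_upwards [h.range, ae_restrict_mem (measurableSet_annulus 1 r)] with z hz hzA
      have hτ : 0 < ‖z‖ ^ 2 := by linarith [((mem_annulus_iff_sq hr).1 hzA).1]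
      have hs : 0 < ‖f z‖ ^ 2 := by linarith [hz.1]
      have e1 := energy_identity f u v z
      have e2 := jacobian_identity f u v z
      generalize ‖f z‖ ^ 2 = s at *
      generalize ‖z‖ ^ 2 = τ at *
      generalize radRe f u v z = P at *
      generalize radIm f u v z = Q at *
      generalize angRe f u v z = M at *
      generalize angIm f u v z = N at *
      generalize jacDet u v z = J at *
      generalize ‖u z‖ ^ 2 + ‖v z‖ ^ 2 = E at *
      have key : (E - 2 * (J * 1)) * τ * s = (P - N) ^ 2 + (Q + M) ^ 2 := by
        linear_combination e1 - 2 * e2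
      refine ⟨?_, fun hz0 => ?_, fun hz0 => ?_⟩
      · by_contra hn
        have : (E - 2 * (J * 1)) * τ * s < 0 :=
          mul_neg_of_neg_of_pos (mul_neg_of_neg_of_pos (not_le.1 hn) hτ) hs
        nlinarith [sq_nonneg (P - N), sq_nonneg (Q + M)]
      · rw [hz0, zero_mul, zero_mul] at key
        have n1 := sq_nonneg (P - N)
        have n2 := sq_nonneg (Q + M)
        have a1 : P - N = 0 := pow_eq_zero_iff two_ne_zero |>.1 (by linarith)
        have a2 : Q + M = 0 := pow_eq_zero_iff two_ne_zero |>.1 (by linarith)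
        exact ⟨by linarith, by linarith⟩
      · obtain ⟨rfl, rfl⟩ := hz0
        have : (E - 2 * (J * 1)) * τ * s = 0 := by rw [key]; ring
        simpa [hτ.ne', hs.ne'] using this)
  refine ⟨main.1, main.2.trans ⟨fun hsys => ?_, fun hsys => ?_⟩⟩
  swap
  · filter_upwards [hsys] with z ⟨h1, h2, h3, h4⟩
    rw [h1, h2, h3, h4, sub_zero, Real.sqrt_mul_self (by positivity)]
    simp
  have j1 := h.integrable_mul_comp (radialTest_log R).cont' h.integrable_jacDet
  have j2 := integrable_radRe_div h.toAnnulusMap (radialTest_log R)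
  have j3 := integrable_inv_normSq hr
  have i := (j1.fun_sub (j2.const_mul (2 * j))).fun_add (j3.const_mul (j ^ 2))
  -- Among conformal maps this integrand is ((P - js)² + Q²)/(τ s²), while its integral is a
  -- combination of free Lagrangians proportional to log R² - j log r². It vanishes by hypothesis,
  -- which forces P = js and Q = 0.
  have e : ∫ z in annulus 1 r, (jacDet u v z * (‖f z‖ ^ 2)⁻¹
      - 2 * j * (radRe f u v z * (‖f z‖ ^ 2)⁻¹ * (‖z‖ ^ 2)⁻¹) + j ^ 2 * (‖z‖ ^ 2)⁻¹) = 0 := by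
    rw [integral_add (j1.fun_sub (j2.const_mul (2 * j))) (j3.const_mul (j ^ 2)),
      integral_sub j1 (j2.const_mul (2 * j)), integral_const_mul, integral_const_mul,
      h.integral_mul_jacDet (radialTest_log R), integral_radRe_div h.toAnnulusMap (radialTest_log R),
      integral_inv_normSq hr, hrR, Real.log_one]
    ring
  have key : ∀ᵐ z ∂(volume.restrict (annulus 1 r)), (jacDet u v z * (‖f z‖ ^ 2)⁻¹
      - 2 * j * (radRe f u v z * (‖f z‖ ^ 2)⁻¹ * (‖z‖ ^ 2)⁻¹) + j ^ 2 * (‖z‖ ^ 2)⁻¹) * ‖z‖ ^ 2 * (‖f z‖ ^ 2) ^ 2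
        = (radRe f u v z - j * ‖f z‖ ^ 2) ^ 2 + radIm f u v z ^ 2 := by
    filter_upwards [hsys, h.range, ae_restrict_mem (measurableSet_annulus 1 r)] with z hz0 hz hzA
    have hτ : 0 < ‖z‖ ^ 2 := by linarith [((mem_annulus_iff_sq hr).1 hzA).1]
    have hs : 0 < ‖f z‖ ^ 2 := by linarith [hz.1]
    have e2 := jacobian_identity f u v z
    rw [← hz0.1, show angRe f u v z = - radIm f u v z by linarith [hz0.2]] at e2
    generalize ‖f z‖ ^ 2 = s at *
    generalize ‖z‖ ^ 2 = τ at *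
    have : (jacDet u v z * s⁻¹ - 2 * j * (radRe f u v z * s⁻¹ * τ⁻¹) + j ^ 2 * τ⁻¹) * τ * s ^ 2
        = jacDet u v z * τ * s - 2 * j * radRe f u v z * s + j ^ 2 * s ^ 2 := by
      field_simp
    rw [this, e2]
    ring
  have h0 : 0 ≤ᵐ[volume.restrict (annulus 1 r)] fun z => jacDet u v z * (‖f z‖ ^ 2)⁻¹
      - 2 * j * (radRe f u v z * (‖f z‖ ^ 2)⁻¹ * (‖z‖ ^ 2)⁻¹) + j ^ 2 * (‖z‖ ^ 2)⁻¹ := by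
    filter_upwards [key, h.range, ae_restrict_mem (measurableSet_annulus 1 r)] with z hz0 hz hzA
    have hτ : 0 < ‖z‖ ^ 2 := by linarith [((mem_annulus_iff_sq hr).1 hzA).1]
    have hs : 0 < ‖f z‖ ^ 2 := by linarith [hz.1]
    by_contra hn
    have := mul_neg_of_neg_of_pos (mul_neg_of_neg_of_pos (not_le.1 hn) hτ) (pow_pos hs 2)
    nlinarith [sq_nonneg (radRe f u v z - j * ‖f z‖ ^ 2), sq_nonneg (radIm f u v z)]
  have hzero := (integral_eq_zero_iff_of_nonneg_ae h0 i).1 e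
  filter_upwards [hzero, key, hsys] with z hz0 hz1 hz2
  simp only [Pi.zero_apply] at hz0
  rw [hz0, zero_mul, zero_mul] at hz1
  have n1 := sq_nonneg (radRe f u v z - j * ‖f z‖ ^ 2)
  have n2 := sq_nonneg (radIm f u v z)
  have a1 : radRe f u v z - j * ‖f z‖ ^ 2 = 0 := pow_eq_zero_iff two_ne_zero |>.1 (by linarith)
  have a2 : radIm f u v z = 0 := pow_eq_zero_iff two_ne_zero |>.1 (by linarith)
  refine ⟨?_, by linarith [hz2.1], by linarith [hz2.2], a2⟩
  rw [sub_zero, Real.sqrt_mul_self (by positivity)]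
  linarith

/-- The energy of maps of degree `j` is bounded below, with equality exactly for the solutions of
the radial system. -/
theorem exists_energy_bound {c : ℝ} (hr : 1 < r) (hR : 1 < R) (hc : c ≤ 1)
    (hrR : c = 0 → Real.log (R ^ 2) = j * Real.log (r ^ 2)) :
    ∃ κ : ℝ, ∀ f u v, DegreeMap j r R f u v →
      κ ≤ ∫ z in annulus 1 r, (‖u z‖ ^ 2 + ‖v z‖ ^ 2) ∧
      (∫ z in annulus 1 r, (‖u z‖ ^ 2 + ‖v z‖ ^ 2) = κ ↔
        ∀ᵐ z ∂(volume.restrict (annulus 1 r)), RadialSystem j c f u v z) := by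
  rcases lt_trichotomy c 0 with h | rfl | h
  exacts [energy_bound_of_neg hr hR h, energy_bound_of_zero hr (hrR rfl),
    energy_bound_of_pos hr hR h hc]

end DegreeMap

/-! ### Rigidity -/

/-- Weak derivatives are defined by real smooth test functions. The product rule tests with φ k,
where `k` is complex valued and only C¹, so the integration by parts is first extended to such
functions through the smooth approximation. -/
lemma BddSobolev.integral_fderiv_mul_aux {X : Set ℂ} {f w : ℂ → ℂ} {M : ℝ} {ψ : ℂ → ℂ}
    (hψ : ContDiff ℝ 1 ψ) (hc : HasCompactSupport ψ) (hs : tsupport ψ ⊆ X) {g : ℕ → ℂ → ℂ} {e : ℂ}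
    (hg : ∀ n, ContDiff ℝ ∞ (g n)) (hgM : ∀ n z, ‖g n z‖ ≤ M)
    (hgf : ∀ᵐ z ∂(volume.restrict (tsupport ψ)), Tendsto (fun n => g n z) atTop (𝓝 (f z)))
    (hw : MemLp w 2 (volume.restrict X))
    (hd : Tendsto (fun n => eLpNorm (fun z => fderiv ℝ (g n) z e - w z) 2
      (volume.restrict (tsupport ψ))) atTop (𝓝 0)) :
    ∫ z in X, f z * fderiv ℝ ψ z e = - ∫ z in X, ψ z * w z := by
  have : IsFiniteMeasure (volume.restrict (tsupport ψ)) :=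
    ⟨by rw [Measure.restrict_apply_univ]; exact hc.measure_lt_top⟩
  have hwK : MemLp w 2 (volume.restrict (tsupport ψ)) := hw.mono_measure (Measure.restrict_mono_set _ hs)
  have hψ0 : ∀ z ∉ tsupport ψ, ψ z = 0 := fun z hz => image_eq_zero_of_notMem_tsupport hz
  have hψ1 : ∀ z ∉ tsupport ψ, fderiv ℝ ψ z e = 0 := fun z hz => by
    rw [fderiv_of_notMem_tsupport ℝ hz]; simp
  have cψ := (hψ.continuous_fderiv one_ne_zero).clm_apply (continuous_const (y := e))
  have h0 : ∀ n, ∫ z in tsupport ψ, g n z * fderiv ℝ ψ z e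
      = - ∫ z in tsupport ψ, ψ z * fderiv ℝ (g n) z e := by
    intro n
    have hg1 : ContDiff ℝ 1 (g n) := (hg n).of_le (by norm_cast)
    have h := integral_fderiv_eq_zero_of_hasCompactSupport (hψ.mul hg1) hc.mul_right e
    have hd : ∀ z, fderiv ℝ (ψ * g n) z e = ψ z * fderiv ℝ (g n) z e + g n z * fderiv ℝ ψ z e := by
      intro z
      rw [fderiv_mul (hψ.differentiable one_ne_zero z) (hg1.differentiable one_ne_zero z)]
      simp
    have cg := (hg1.continuous_fderiv one_ne_zero).clm_apply (continuous_const (y := e))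
    have e1 : ∫ z, fderiv ℝ (ψ * g n) z e = 0 := h
    simp only [hd] at e1
    rw [integral_eq_of_support (K := tsupport ψ) (fun z hz => by rw [hψ0 z hz, hψ1 z hz]; simp),
      integral_add] at e1
    · linear_combination e1
    · exact (hψ.continuous.mul cg).continuousOn.integrableOn_compact hc
    · exact (hg1.continuous.mul cψ).continuousOn.integrableOn_compact hc
  rw [setIntegral_eq_of_support hs (fun z hz => by rw [hψ1 z hz, mul_zero]),
    setIntegral_eq_of_support hs (fun z hz => by rw [hψ0 z hz, zero_mul])]
  obtain ⟨C, hC⟩ := hc.exists_bound_of_continuous hψ.continuous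
  have hint : IntegrableOn (fun z => fderiv ℝ ψ z e) (tsupport ψ) :=
    cψ.continuousOn.integrableOn_compact hc
  have L1 := tendsto_integral_mul_of_bounded (μ := volume.restrict (tsupport ψ)) (a := g) (a' := f)
    (b := fun _ z => fderiv ℝ ψ z e) (b' := fun z => fderiv ℝ ψ z e)
    (fun n => (hg n).continuous.aestronglyMeasurable) hgM hgf (fun _ => hint) hint (by simp)
  have L2 := tendsto_integral_mul_of_bounded (μ := volume.restrict (tsupport ψ)) (a := fun _ => ψ)
    (a' := ψ) (b := fun n z => fderiv ℝ (g n) z e) (b' := w)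
    (fun n => hψ.continuous.aestronglyMeasurable) (fun _ => hC)
    (Eventually.of_forall fun z => tendsto_const_nhds)
    (fun n => (memLp_fderiv_apply (hg n) hc e).integrable (by norm_num))
    (hwK.integrable (by norm_num))
    (tendsto_eLpNorm_one_of_two (fun n => (memLp_fderiv_apply (hg n) hc e).1) hwK.1 hd)
  simp only [h0] at L1
  exact tendsto_nhds_unique L1 L2.neg

/-- The product rule for a bounded Sobolev function and a `C¹` function. -/
lemma BddSobolev.isWeakPartial_mul {X : Set ℂ} {f u v : ℂ → ℂ} {M : ℝ} (h : BddSobolev X f u v M)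
    {k : ℂ → ℂ} (hk : ContDiffOn ℝ 1 k X) :
    IsWeakPartial X 1 (fun z => f z * k z) (fun z => u z * k z + f z * fderiv ℝ k z 1) ∧
    IsWeakPartial X Complex.I (fun z => f z * k z)
      (fun z => v z * k z + f z * fderiv ℝ k z Complex.I) := by
  have key : ∀ {e : ℂ} {w : ℂ → ℂ}, MemLp w 2 (volume.restrict X) →
      (∀ ψ : ℂ → ℂ, ContDiff ℝ 1 ψ → HasCompactSupport ψ → tsupport ψ ⊆ X →
        ∫ z in X, f z * fderiv ℝ ψ z e = - ∫ z in X, ψ z * w z) →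
      IsWeakPartial X e (fun z => f z * k z) (fun z => w z * k z + f z * fderiv ℝ k z e) := by
    intro e w hw hψ φ hφ hc hs
    have hφ1 : ContDiff ℝ 1 φ := hφ.of_le (by norm_cast)
    have e1 := hψ (fun z => φ z • k z) (contDiff_smul_of_tsupport_subset h.isOpen hφ1 hs hk)
      hc.smul_right ((tsupport_smul_subset_left φ k).trans hs)
    have hcont : ∀ {a : ℂ → ℝ} {b p : ℂ → ℂ}, Continuous a → tsupport a ⊆ tsupport φ →
        ContinuousOn b X → MemLp p 2 (volume.restrict X) →
        IntegrableOn (fun z => (a z • b z) * p z) X := by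
      intro a b p ha hta hb hp
      have hK : IsCompact (tsupport a) := hc.of_isClosed_subset (isClosed_tsupport _) hta
      have h1 : LocallyIntegrableOn p X := locallyIntegrableOn_of_memLp hp
      have h2 : IntegrableOn (fun z => (a z • b z) * p z) (tsupport a) :=
        (h1.integrableOn_compact_subset (hta.trans hs) hK).continuousOn_mul
          (ha.continuousOn.smul (hb.mono (hta.trans hs))) hK
      refine ((integrableOn_iff_integrable_of_support_subset fun x hx => ?_).1 h2).integrableOn
      by_contra hn
      exact hx (by simp [image_eq_zero_of_notMem_tsupport hn])
    have hkc : ContinuousOn (fun z => fderiv ℝ k z e) X :=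
      (hk.continuousOn_fderiv_of_isOpen h.isOpen le_rfl).clm_apply continuousOn_const
    have ht : tsupport (fun z => fderiv ℝ φ z e) ⊆ tsupport φ :=
      closure_minimal (fun z hz => by
        by_contra hn
        exact hz (by simp [fderiv_of_notMem_tsupport ℝ hn])) (isClosed_tsupport _)
    have i1 := hcont hφ.continuous subset_rfl hkc h.memLp
    have i2 := hcont ((hφ1.continuous_fderiv one_ne_zero).clm_apply (continuous_const (y := e))) ht
      hk.continuousOn h.memLp
    have i3 := hcont hφ.continuous subset_rfl hk.continuousOn hw
    have e2 : ∫ z in X, f z * fderiv ℝ (fun z => φ z • k z) z e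
        = (∫ z in X, (φ z • fderiv ℝ k z e) * f z) + ∫ z in X, (fderiv ℝ φ z e • k z) * f z := by
      rw [← integral_add i1 i2]
      refine setIntegral_congr_fun h.isOpen.measurableSet fun z hz => ?_
      rw [fderiv_fun_smul (hφ1.differentiable one_ne_zero z)
        ((hk.contDiffAt (h.isOpen.mem_nhds hz)).differentiableAt one_ne_zero)]
      simp
      ring
    rw [e2] at e1
    have e3 : ∫ z in X, fderiv ℝ φ z e • (f z * k z) = ∫ z in X, (fderiv ℝ φ z e • k z) * f z := by
      congr 1; ext1 z; simp only [Complex.real_smul]; ring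
    have e4 : ∫ z in X, φ z • (w z * k z + f z * fderiv ℝ k z e)
        = (∫ z in X, (φ z • k z) * w z) + ∫ z in X, (φ z • fderiv ℝ k z e) * f z := by
      rw [← integral_add i3 i1]
      congr 1; ext1 z; simp only [Complex.real_smul]; ring
    rw [e3, e4]
    linear_combination e1
  constructor
  · refine key h.memLp_x fun ψ hψ hc hs => ?_
    obtain ⟨g, hg, hgM, hgf, h1, h2⟩ := exists_smooth_approx h.isOpen h.memLp h.memLp_x h.memLp_y
      h.weak_x h.weak_y h.nonneg h.bound hc hs
    exact integral_fderiv_mul_aux hψ hc hs hg hgM hgf h.memLp_x h1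
  · refine key h.memLp_y fun ψ hψ hc hs => ?_
    obtain ⟨g, hg, hgM, hgf, h1, h2⟩ := exists_smooth_approx h.isOpen h.memLp h.memLp_x h.memLp_y
      h.weak_x h.weak_y h.nonneg h.bound hc hs
    exact integral_fderiv_mul_aux hψ hc hs hg hgM hgf h.memLp_y h2

lemma isPreconnected_annulus {a b : ℝ} (ha : 0 ≤ a) : IsPreconnected (annulus a b) := by
  have : annulus a b = (fun p : ℝ × ℝ => (p.1 : ℂ) * Complex.exp (p.2 * Complex.I)) ''
      (Ioo a b ×ˢ univ) := by
    ext z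
    constructor
    · intro hz
      exact ⟨(‖z‖, Complex.arg z), ⟨hz, mem_univ _⟩, Complex.norm_mul_exp_arg_mul_I z⟩
    · rintro ⟨⟨t, θ⟩, ⟨ht, -⟩, rfl⟩
      have : ‖(t : ℂ) * Complex.exp (θ * Complex.I)‖ = t := by
        rw [norm_mul, Complex.norm_exp_ofReal_mul_I, mul_one, Complex.norm_real, Real.norm_eq_abs,
          abs_of_nonneg (ha.trans ht.1.le)]
      exact ⟨by rw [this]; exact ht.1, by rw [this]; exact ht.2⟩
  rw [this]
  exact (isPreconnected_Ioo.prod isPreconnected_univ).image _ (by fun_prop)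

/-- A function on an annulus with vanishing weak gradient is constant. -/
lemma ae_eq_const_of_isWeakPartial_zero {r : ℝ} (hr : 1 < r) {w : ℂ → ℂ}
    (hw : IntegrableOn w (annulus 1 r)) (hx : IsWeakPartial (annulus 1 r) 1 w 0)
    (hy : IsWeakPartial (annulus 1 r) Complex.I w 0) :
    ∃ C : ℂ, ∀ᵐ z ∂(volume.restrict (annulus 1 r)), w z = C := by
  have hm := measurableSet_annulus 1 r
  have hloc : LocallyIntegrable ((annulus 1 r).indicator w) :=
    ((integrable_indicator_iff hm).2 hw).locallyIntegrable
  -- Two given points lie in a common smaller concentric annulus. Once the mollification radius is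
  -- below its distance δ from the boundary, the mollified function has zero gradient on that
  -- connected set.
  have hconst : ∀ z ∈ annulus 1 r, ∀ z' ∈ annulus 1 r, ∀ᶠ n in atTop,
      mollify n ((annulus 1 r).indicator w) z = mollify n ((annulus 1 r).indicator w) z' := by
    intro z hz z' hz'
    obtain ⟨δ, hδ, hz1, hz2⟩ : ∃ δ > 0, z ∈ annulus (1 + δ) (r - δ) ∧ z' ∈ annulus (1 + δ) (r - δ) := by
      have h1 := sub_pos.2 hz.1
      have h2 := sub_pos.2 hz.2
      have h3 := sub_pos.2 hz'.1
      have h4 := sub_pos.2 hz'.2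
      refine ⟨min (min (‖z‖ - 1) (r - ‖z‖)) (min (‖z'‖ - 1) (r - ‖z'‖)) / 2, by positivity, ?_⟩
      set m := min (min (‖z‖ - 1) (r - ‖z‖)) (min (‖z'‖ - 1) (r - ‖z'‖)) with hm
      have hm0 : 0 < m := by positivity
      have a1 : m ≤ ‖z‖ - 1 := (min_le_left _ _).trans (min_le_left _ _)
      have a2 : m ≤ r - ‖z‖ := (min_le_left _ _).trans (min_le_right _ _)
      have a3 : m ≤ ‖z'‖ - 1 := (min_le_right _ _).trans (min_le_left _ _)
      have a4 : m ≤ r - ‖z'‖ := (min_le_right _ _).trans (min_le_right _ _)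
      exact ⟨⟨by linarith, by linarith⟩, ⟨by linarith, by linarith⟩⟩
    filter_upwards [mollBump_rOut_tendsto.eventually (gt_mem_nhds hδ)] with n hn
    have hsm := mollify_contDiff n hloc
    refine (isOpen_annulus (1 + δ) (r - δ)).is_const_of_fderiv_eq_zero
      (isPreconnected_annulus (by linarith)) (𝕜 := ℝ)
      (hsm.differentiable (by norm_num)).differentiableOn (fun y hy' => ?_) hz1 hz2
    have hball : Metric.closedBall y (mollBump n).rOut ⊆ annulus 1 r := by
      intro x hxy
      have hd : ‖x - y‖ < δ := lt_of_le_of_lt (mem_closedBall_iff_norm.1 hxy) hn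
      have h1 := abs_lt.1 (lt_of_le_of_lt (abs_norm_sub_norm_le x y) hd)
      exact ⟨by linarith [hy'.1, h1.1], by linarith [hy'.2, h1.2]⟩
    have z0 : mollify n ((annulus 1 r).indicator (0 : ℂ → ℂ)) y = 0 := by
      rw [indicator_zero', mollify_apply]; simp
    have f1 := fderiv_mollify hm hloc hx n hball
    have f2 := fderiv_mollify hm hloc hy n hball
    rw [z0] at f1 f2
    ext1 e
    have he : e = e.re • (1 : ℂ) + e.im • Complex.I := by
      simp [Complex.re_add_im]
    rw [he, map_add, map_smul, map_smul, f1, f2]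
    simp
  have hlim : ∀ᵐ z ∂(volume.restrict (annulus 1 r)),
      Tendsto (fun n => mollify n ((annulus 1 r).indicator w) z) atTop (𝓝 (w z)) := by
    filter_upwards [ae_restrict_of_ae (mollify_ae_tendsto hloc), ae_restrict_mem hm] with z hz hzA
    rwa [indicator_of_mem hzA] at hz
  have hne : NeBot (ae (volume.restrict (annulus 1 r))) := by
    rw [ae_neBot, Ne, Measure.restrict_eq_zero]
    refine ((isOpen_annulus 1 r).measure_pos volume ⟨(((1 + r) / 2 : ℝ) : ℂ), ?_, ?_⟩).ne' <;>
    · rw [Complex.norm_real, Real.norm_eq_abs, abs_of_pos (by linarith)]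
      linarith
  obtain ⟨z₀, hz₀, hz₀A⟩ := (hlim.and (ae_restrict_mem hm)).exists
  refine ⟨w z₀, ?_⟩
  filter_upwards [hlim, ae_restrict_mem hm] with z hz hzA
  exact tendsto_nhds_unique (hz.congr' (hconst z hzA z₀ hz₀A)) hz₀

/-- The system prescribes the radial and the angular derivative as multiples of f, and a rotation
solves for `u` and `v`. The multipliers depend on `f` only through |f|, via `a`. -/
lemma partials_of_radialSystem {j c : ℝ} {f u v : ℂ → ℂ} {z : ℂ} (hs : f z ≠ 0) (hz : z ≠ 0)
    (h : RadialSystem j c f u v z) {a : ℝ}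
    (ha : a * ‖f z‖ ^ 2 = j * √(‖f z‖ ^ 2 * (‖f z‖ ^ 2 - c))) :
    u z = (z.re * a - z.im * j * Complex.I) / (‖z‖ ^ 2 : ℝ) * f z ∧
    v z = (z.im * a + z.re * j * Complex.I) / (‖z‖ ^ 2 : ℝ) * f z := by
  obtain ⟨h1, h2, h3, h4⟩ := h
  have hsq : ∀ w : ℂ, ((‖w‖ ^ 2 : ℝ) : ℂ) = conj w * w := fun w => by
    rw [mul_comm, Complex.mul_conj, Complex.normSq_eq_norm_sq]
  have hcf : conj (f z) ≠ 0 := (map_ne_zero _).2 hs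
  have e1 : z.re * u z + z.im * v z = a * f z := by
    refine mul_left_cancel₀ hcf ?_
    have : conj (f z) * (a * f z) = ((a * ‖f z‖ ^ 2 : ℝ) : ℂ) := by
      rw [Complex.ofReal_mul, hsq]; ring
    rw [this, ha, ← h1]
    exact Complex.ext (by simp [radRe]) (by
      have : radIm f u v z = 0 := h4
      rw [radIm] at this
      rw [this, Complex.ofReal_im])
  have e2 : z.re * v z - z.im * u z = j * Complex.I * f z := by
    refine mul_left_cancel₀ hcf ?_
    have : conj (f z) * (j * Complex.I * f z) = ((j * ‖f z‖ ^ 2 : ℝ) : ℂ) * Complex.I := by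
      rw [Complex.ofReal_mul, hsq]; ring
    rw [this, ← h2]
    refine Complex.ext ?_ ?_
    · have : angRe f u v z = 0 := h3
      rw [angRe] at this
      rw [this]; simp
    · simp [angIm]
  have hτ : ((‖z‖ ^ 2 : ℝ) : ℂ) = (z.re : ℂ) ^ 2 + (z.im : ℂ) ^ 2 := by
    rw [← Complex.normSq_eq_norm_sq, Complex.normSq_apply]; push_cast; ring
  have hτ0 : ((‖z‖ ^ 2 : ℝ) : ℂ) ≠ 0 := by
    rw [Complex.ofReal_ne_zero]; exact pow_ne_zero 2 (norm_ne_zero_iff.2 hz)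
  constructor
  · rw [div_mul_eq_mul_div, eq_div_iff hτ0, hτ]
    linear_combination (z.re : ℂ) * e1 - (z.im : ℂ) * e2
  · rw [div_mul_eq_mul_div, eq_div_iff hτ0, hτ]
    linear_combination (z.im : ℂ) * e1 + (z.re : ℂ) * e2

/-- The modulus of a solution of the radial system is determined. -/
lemma AnnulusMap.normSq_eq_of_radialSystem {j c r R : ℝ} {f u v : ℂ → ℂ} (h : AnnulusMap r R f u v)
    (hj : 0 < j) (hc : c ≤ 1)
    (hsys : ∀ᵐ z ∂(volume.restrict (annulus 1 r)), RadialSystem j c f u v z) {S S' : ℝ → ℝ}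
    (hS : RadialTest r S S') (hS1 : S 1 = 1) (hS2 : S (r ^ 2) = R ^ 2)
    (hSm : ∀ τ ∈ Ioo 1 (r ^ 2), 1 ≤ S τ)
    (hode : ∀ τ ∈ Ioo 1 (r ^ 2), τ * S' τ = j * √(S τ * (S τ - c))) :
    ∀ᵐ z ∂(volume.restrict (annulus 1 r)), ‖f z‖ ^ 2 = S (‖z‖ ^ 2) := by
  have hr := h.one_lt_r
  have hid : ∀ r : ℝ, RadialTest r (fun τ => τ) (fun _ => 1) := fun r =>
    RadialTest.of_global hasDerivAt_id continuous_const
  have hK2 : RadialTest R (fun s => s ^ 2) (fun s => 2 * s) :=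
    RadialTest.of_global (fun s => by simpa using hasDerivAt_pow 2 s) (by fun_prop)
  -- With s = |f|² and S = S(|z|²), the three identities expand the total radial derivative of (s -
  -- S)² τ into admissible products. Their boundary terms cancel because S takes the values 1 and R²
  -- at the ends.
  have e1 := h.integral_radial hK2 (hid r)
  have e2 := h.integral_radial (hid R) (((hid r).mul hS).const_mul (-2))
  have e3 := h.integral_radial (radialTest_one R) ((hid r).mul (hS.mul hS))
  have int : ∀ {K K' Z Z' : ℝ → ℝ}, RadialTest R K K' → RadialTest r Z Z' →
      IntegrableOn (fun z => K (‖f z‖ ^ 2) * Z' (‖z‖ ^ 2)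
        + K' (‖f z‖ ^ 2) * radRe f u v z * (‖z‖ ^ 2)⁻¹ * Z (‖z‖ ^ 2)) (annulus 1 r) := by
    intro K K' Z Z' hK hZ
    refine Integrable.fun_add (integrable_mul_comp_normSq hr hZ.cont' (h.integrable_comp hK.cont)) ?_
    exact (integrable_mul_comp_normSq hr hZ.cont (DegreeMap.integrable_radRe_div h hK)).congr
      (Eventually.of_forall fun z => by simp only; ring)
  have i1 := int hK2 (hid r)
  have i2 := int (hid R) (((hid r).mul hS).const_mul (-2))
  have i3 := int (radialTest_one R) ((hid r).mul (hS.mul hS))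
  have i := Integrable.fun_add (Integrable.fun_add i1 i2) i3
  have e := integral_add (Integrable.fun_add i1 i2) i3
  rw [integral_add i1 i2, e1, e2, e3, hS1, hS2,
    show Real.pi * ((R ^ 2) ^ 2 * r ^ 2 - 1 ^ 2 * 1)
      + Real.pi * (R ^ 2 * (-2 * (r ^ 2 * R ^ 2)) - 1 * (-2 * (1 * 1)))
      + Real.pi * (1 * (r ^ 2 * (R ^ 2 * R ^ 2)) - 1 * (1 * (1 * 1))) = 0 by ring] at e
  have key : ∀ᵐ z ∂(volume.restrict (annulus 1 r)),
      (‖f z‖ ^ 2) ^ 2 * 1 + 2 * ‖f z‖ ^ 2 * radRe f u v z * (‖z‖ ^ 2)⁻¹ * ‖z‖ ^ 2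
      + (‖f z‖ ^ 2 * (-2 * (1 * S (‖z‖ ^ 2) + ‖z‖ ^ 2 * S' (‖z‖ ^ 2)))
        + 1 * radRe f u v z * (‖z‖ ^ 2)⁻¹ * (-2 * (‖z‖ ^ 2 * S (‖z‖ ^ 2))))
      + (1 * (1 * (S (‖z‖ ^ 2) * S (‖z‖ ^ 2))
          + ‖z‖ ^ 2 * (S' (‖z‖ ^ 2) * S (‖z‖ ^ 2) + S (‖z‖ ^ 2) * S' (‖z‖ ^ 2)))
        + 0 * radRe f u v z * (‖z‖ ^ 2)⁻¹ * (‖z‖ ^ 2 * (S (‖z‖ ^ 2) * S (‖z‖ ^ 2))))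
      = (‖f z‖ ^ 2 - S (‖z‖ ^ 2)) ^ 2 + 2 * j * ((‖f z‖ ^ 2 - S (‖z‖ ^ 2))
        * (√(‖f z‖ ^ 2 * (‖f z‖ ^ 2 - c)) - √(S (‖z‖ ^ 2) * (S (‖z‖ ^ 2) - c)))) ∧
      0 ≤ (‖f z‖ ^ 2 - S (‖z‖ ^ 2))
        * (√(‖f z‖ ^ 2 * (‖f z‖ ^ 2 - c)) - √(S (‖z‖ ^ 2) * (S (‖z‖ ^ 2) - c))) := by
    filter_upwards [hsys, h.range, ae_restrict_mem (measurableSet_annulus 1 r)] with z h1 h2 hzA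
    have hτ := (mem_annulus_iff_sq hr).1 hzA
    have h3 := hode _ hτ
    have h4 := hSm _ hτ
    have h5 := h1.1
    have hs := h2.1
    have hτ0 : ‖z‖ ^ 2 ≠ 0 := by linarith [hτ.1]
    rw [h5]
    generalize ‖f z‖ ^ 2 = s at *
    generalize ‖z‖ ^ 2 = τ at *
    generalize S τ = T at *
    generalize S' τ = T' at *
    constructor
    · generalize √(s * (s - c)) = p at *
      generalize √(T * (T - c)) = q at *
      have hi : τ⁻¹ * τ = 1 := inv_mul_cancel₀ hτ0
      linear_combination (2 * s * j * p - 2 * j * p * T) * hi + (2 * T - 2 * s) * h3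
    -- The function x(x - c) increases for x ≥ 1 because c ≤ 1. This monotonicity and the two
    -- boundary conditions replace uniqueness for the initial value problem, which fails at the
    -- value 1 when c = 1.
    · rcases le_total s T with hle | hle
      · refine mul_nonneg_of_nonpos_of_nonpos (by linarith) (sub_nonpos.2 (Real.sqrt_le_sqrt ?_))
        nlinarith
      · refine mul_nonneg (by linarith) (sub_nonneg.2 (Real.sqrt_le_sqrt ?_))
        nlinarith
  have hzero := (integral_eq_zero_iff_of_nonneg_ae (by
    filter_upwards [key] with z hz
    refine le_of_le_of_eq ?_ hz.1.symm
    have := hz.2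
    simp only [Pi.zero_apply]
    positivity) i).1 e
  filter_upwards [hzero, key] with z hz0 hz
  have h1 : (‖f z‖ ^ 2 - S (‖z‖ ^ 2)) ^ 2 + 2 * j * ((‖f z‖ ^ 2 - S (‖z‖ ^ 2))
        * (√(‖f z‖ ^ 2 * (‖f z‖ ^ 2 - c)) - √(S (‖z‖ ^ 2) * (S (‖z‖ ^ 2) - c)))) = 0 :=
    hz.1.symm.trans hz0
  have h2 : 0 ≤ 2 * j * ((‖f z‖ ^ 2 - S (‖z‖ ^ 2))
        * (√(‖f z‖ ^ 2 * (‖f z‖ ^ 2 - c)) - √(S (‖z‖ ^ 2) * (S (‖z‖ ^ 2) - c)))) :=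
    mul_nonneg (by linarith) hz.2
  have h3 : (‖f z‖ ^ 2 - S (‖z‖ ^ 2)) ^ 2 = 0 := le_antisymm (by linarith) (sq_nonneg _)
  exact sub_eq_zero.1 (pow_eq_zero_iff two_ne_zero |>.1 h3)

/-- Solutions of the radial system are unique up to rotation. -/
theorem AnnulusMap.eq_rotation_of_radialSystem {j c r R : ℝ} {f u v : ℂ → ℂ}
    (h : AnnulusMap r R f u v) (hj : 0 < j) (hc : c ≤ 1)
    (hsys : ∀ᵐ z ∂(volume.restrict (annulus 1 r)), RadialSystem j c f u v z) {S S' : ℝ → ℝ}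
    (hS : RadialTest r S S') (hS1 : S 1 = 1) (hS2 : S (r ^ 2) = R ^ 2)
    (hSm : ∀ τ ∈ Ioo 1 (r ^ 2), 1 ≤ S τ)
    (hode : ∀ τ ∈ Ioo 1 (r ^ 2), τ * S' τ = j * √(S τ * (S τ - c))) {g : ℂ → ℂ}
    (hg : ContDiffOn ℝ 1 g (annulus 1 r)) (hgS : ∀ z ∈ annulus 1 r, ‖g z‖ ^ 2 = S (‖z‖ ^ 2))
    (hgsys : ∀ z ∈ annulus 1 r,
      RadialSystem j c g (fun z => fderiv ℝ g z 1) (fun z => fderiv ℝ g z Complex.I) z) :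
    ∃ C : ℂ, ‖C‖ = 1 ∧ ∀ᵐ z ∂(volume.restrict (annulus 1 r)), f z = C * g z := by
  have hr := h.one_lt_r
  have hmod := h.normSq_eq_of_radialSystem hj hc hsys hS hS1 hS2 hSm hode
  have hg1 : ∀ z ∈ annulus 1 r, 1 ≤ ‖g z‖ := fun z hz => by
    have h1 := hgS z hz
    have h2 := hSm _ ((mem_annulus_iff_sq hr).1 hz)
    rw [← h1] at h2
    exact (one_le_sq_iff₀ (norm_nonneg _)).1 h2
  have hg0 : ∀ z ∈ annulus 1 r, g z ≠ 0 := fun z hz h0 => by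
    have := hg1 z hz
    rw [h0, norm_zero] at this
    linarith
  have hk : ContDiffOn ℝ 1 (fun z => (g z)⁻¹) (annulus 1 r) := hg.inv hg0
  obtain ⟨wx, wy⟩ := h.toBddSobolev.isWeakPartial_mul hk
  have hdk : ∀ z ∈ annulus 1 r, ∀ e, fderiv ℝ (fun z => (g z)⁻¹) z e = -(fderiv ℝ g z e) / g z ^ 2 := by
    intro z hz e
    have hd := ((hg.contDiffAt ((isOpen_annulus 1 r).mem_nhds hz)).differentiableAt one_ne_zero).hasFDerivAt
    have h1 := ((hasDerivAt_inv (hg0 z hz)).hasFDerivAt.restrictScalars ℝ).comp z hd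
    have h2 : fderiv ℝ (fun z => (g z)⁻¹) z = _ := h1.fderiv
    rw [h2]
    simp [div_eq_mul_inv]
  have grad : ∀ᵐ z ∂(volume.restrict (annulus 1 r)),
      u z * (g z)⁻¹ + f z * fderiv ℝ (fun z => (g z)⁻¹) z 1 = 0 ∧
      v z * (g z)⁻¹ + f z * fderiv ℝ (fun z => (g z)⁻¹) z Complex.I = 0 := by
    filter_upwards [hsys, h.range, hmod, ae_restrict_mem (measurableSet_annulus 1 r)] with z h1 h2 h3 hzA
    have hf0 : f z ≠ 0 := fun h0 => by
      have := h2.1; rw [h0] at this; norm_num at this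
    have hz0 : z ≠ 0 := fun h0 => by
      have := hzA.1; rw [h0, norm_zero] at this; linarith
    have hs0 : ‖f z‖ ^ 2 ≠ 0 := pow_ne_zero 2 (norm_ne_zero_iff.2 hf0)
    -- Since |f| = |g|, the same number `a` serves both maps. They have equal logarithmic
    -- derivatives, so the quotient rule gives a vanishing gradient of f/g.
    set a := j * √(‖f z‖ ^ 2 * (‖f z‖ ^ 2 - c)) / ‖f z‖ ^ 2 with ha
    have a1 : a * ‖f z‖ ^ 2 = j * √(‖f z‖ ^ 2 * (‖f z‖ ^ 2 - c)) := div_mul_cancel₀ _ hs0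
    obtain ⟨p1, p2⟩ := partials_of_radialSystem hf0 hz0 h1 a1
    have a2 : a * ‖g z‖ ^ 2 = j * √(‖g z‖ ^ 2 * (‖g z‖ ^ 2 - c)) := by
      rw [hgS z hzA, ← h3]; exact a1
    obtain ⟨q1, q2⟩ := partials_of_radialSystem (hg0 z hzA) hz0 (hgsys z hzA) a2
    have hgz := hg0 z hzA
    rw [hdk z hzA, hdk z hzA, p1, p2, q1, q2]
    constructor <;> · field_simp; ring
  have hzero : ∀ {e : ℂ} {p q : ℂ → ℂ}, IsWeakPartial (annulus 1 r) e p q →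
      (∀ᵐ z ∂(volume.restrict (annulus 1 r)), q z = 0) → IsWeakPartial (annulus 1 r) e p 0 := by
    intro e p q hpq hq φ h1 h2 h3
    rw [hpq φ h1 h2 h3]
    congr 1
    refine integral_congr_ae ?_
    filter_upwards [hq] with z hz
    rw [hz]; rfl
  have hint : IntegrableOn (fun z => f z * (g z)⁻¹) (annulus 1 r) := by
    refine Integrable.mul_bdd (c := 1) (h.memLp.integrable (by norm_num))
      (hk.continuousOn.aestronglyMeasurable (measurableSet_annulus 1 r)) ?_
    filter_upwards [ae_restrict_mem (measurableSet_annulus 1 r)] with z hz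
    rw [norm_inv]
    exact inv_le_one_of_one_le₀ (hg1 z hz)
  obtain ⟨C, hC⟩ := ae_eq_const_of_isWeakPartial_zero hr hint
    (hzero wx (grad.mono fun z hz => hz.1)) (hzero wy (grad.mono fun z hz => hz.2))
  have hCg : ∀ᵐ z ∂(volume.restrict (annulus 1 r)), f z = C * g z := by
    filter_upwards [hC, ae_restrict_mem (measurableSet_annulus 1 r)] with z hz hzA
    rw [← hz, inv_mul_cancel_right₀ (hg0 z hzA)]
  have hne : NeBot (ae (volume.restrict (annulus 1 r))) := by
    rw [ae_neBot, Ne, Measure.restrict_eq_zero]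
    refine ((isOpen_annulus 1 r).measure_pos volume ⟨(((1 + r) / 2 : ℝ) : ℂ), ?_, ?_⟩).ne' <;>
    · rw [Complex.norm_real, Real.norm_eq_abs, abs_of_pos (by linarith)]
      linarith
  refine ⟨C, ?_, hCg⟩
  obtain ⟨z, h1, h2, hzA⟩ := (hCg.and (hmod.and (ae_restrict_mem (measurableSet_annulus 1 r)))).exists
  rw [← hgS z hzA, h1, norm_mul, mul_pow] at h2
  have hgz : ‖g z‖ ^ 2 ≠ 0 := pow_ne_zero 2 (norm_ne_zero_iff.2 (hg0 z hzA))
  have : ‖C‖ ^ 2 = 1 := mul_right_cancel₀ hgz (by rw [h2, one_mul])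
  exact (pow_eq_one_iff_of_nonneg (norm_nonneg _) two_ne_zero).1 this

/-! ### Radial maps -/

/-- The map `t e^{iτ} ↦ G(t) e^{ijτ}`. -/
def radialMap (j : ℕ) (G : ℝ → ℝ) (z : ℂ) : ℂ := G ‖z‖ * (z / ‖z‖) ^ j

lemma norm_div_norm_pow {z : ℂ} (hz : z ≠ 0) (j : ℕ) : ‖(z / ‖z‖) ^ j‖ = 1 := by
  have : ‖z‖ ≠ 0 := norm_ne_zero_iff.2 hz
  rw [norm_pow, norm_div, Complex.norm_real, norm_norm, div_self this, one_pow]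

lemma norm_radialMap (j : ℕ) (G : ℝ → ℝ) {z : ℂ} (hz : z ≠ 0) : ‖radialMap j G z‖ = |G ‖z‖| := by
  rw [radialMap, norm_mul, norm_div_norm_pow hz, mul_one, Complex.norm_real, Real.norm_eq_abs]

lemma contDiffOn_norm : ContDiffOn ℝ 1 (fun z : ℂ => ‖z‖) {0}ᶜ :=
  fun _ hz => (contDiffAt_norm ℝ hz).contDiffWithinAt

lemma contDiffOn_radialMap (j : ℕ) {G : ℝ → ℝ} (hG : ContDiffOn ℝ 1 G (Ioi 0)) :
    ContDiffOn ℝ 1 (radialMap j G) {0}ᶜ := by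
  have h0 : ∀ z ∈ ({0}ᶜ : Set ℂ), (‖z‖ : ℂ) ≠ 0 := fun z hz =>
    Complex.ofReal_ne_zero.2 (norm_ne_zero_iff.2 hz)
  have h1 : ContDiffOn ℝ 1 (fun z : ℂ => (‖z‖ : ℂ)) {0}ᶜ :=
    Complex.ofRealCLM.contDiff.comp_contDiffOn contDiffOn_norm
  have h2 : ContDiffOn ℝ 1 (fun z : ℂ => (G ‖z‖ : ℂ)) {0}ᶜ :=
    Complex.ofRealCLM.contDiff.comp_contDiffOn
      (hG.comp contDiffOn_norm fun z hz => norm_pos_iff.2 hz)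
  exact h2.mul ((contDiffOn_id.mul (h1.inv h0)).pow j)

section derivatives

variable {j : ℕ} {G G' : ℝ → ℝ} {z : ℂ}

lemma fderiv_radialMap_radial (hG : ContDiffOn ℝ 1 G (Ioi 0)) (hz : z ≠ 0)
    (hd : HasDerivAt G (G' ‖z‖) ‖z‖) :
    fderiv ℝ (radialMap j G) z z = (‖z‖ * G' ‖z‖ : ℝ) * (z / ‖z‖) ^ j := by
  have hg := (((contDiffOn_radialMap j hG).contDiffAt
    (isOpen_compl_singleton.mem_nhds hz)).differentiableAt one_ne_zero).hasFDerivAt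
  have hγ : HasDerivAt (fun s : ℝ => (s : ℂ) * z) z 1 := by
    simpa using (Complex.ofRealCLM.hasDerivAt (x := 1)).mul_const z
  have h1 := hg.comp_hasDerivAt_of_eq 1 hγ (by simp)
  have hn : HasDerivAt (fun s : ℝ => s * ‖z‖) ‖z‖ 1 := by simpa using (hasDerivAt_id (1 : ℝ)).mul_const ‖z‖
  have h2 := ((hd.comp_of_eq 1 hn (by simp)).ofReal_comp).mul_const ((z / ‖z‖) ^ j)
  have h3 : (radialMap j G ∘ fun s : ℝ => (s : ℂ) * z)
      =ᶠ[𝓝 1] fun s => (((G ∘ fun s : ℝ => s * ‖z‖) s : ℝ) : ℂ) * (z / ‖z‖) ^ j := by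
    filter_upwards [lt_mem_nhds (zero_lt_one : (0 : ℝ) < 1)] with s hs
    have hsc : (s : ℂ) ≠ 0 := Complex.ofReal_ne_zero.2 hs.ne'
    simp only [Function.comp, radialMap, norm_mul, Complex.norm_real, Real.norm_eq_abs, abs_of_pos hs]
    rw [Complex.ofReal_mul, mul_div_mul_left _ _ hsc]
  rw [h1.unique (h2.congr_of_eventuallyEq h3), mul_comm ‖z‖]

/-- A radial map turns rotation by the angle s into rotation by js; this is the derivative of that
relation at s = 0. Differentiability in the profile plays no further role. -/
lemma fderiv_radialMap_angular (hG : ContDiffOn ℝ 1 G (Ioi 0)) (hz : z ≠ 0) :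
    fderiv ℝ (radialMap j G) z (Complex.I * z) = j * Complex.I * radialMap j G z := by
  have hg := (((contDiffOn_radialMap j hG).contDiffAt
    (isOpen_compl_singleton.mem_nhds hz)).differentiableAt one_ne_zero).hasFDerivAt
  have hγ : ∀ n : ℂ, HasDerivAt (fun s : ℝ => Complex.exp (n * s * Complex.I)) (n * Complex.I) 0 := by
    intro n
    have h0 : HasDerivAt (fun s : ℝ => n * (s : ℂ) * Complex.I) (n * Complex.I) 0 := by
      simpa using ((Complex.ofRealCLM.hasDerivAt (x := 0)).const_mul n).mul_const Complex.I
    simpa using h0.cexp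
  have h1 := hg.comp_hasDerivAt_of_eq 0 ((hγ 1).mul_const z) (by simp)
  have h2 := (hγ j).mul_const (radialMap j G z)
  have h3 : (radialMap j G ∘ fun s : ℝ => Complex.exp (1 * s * Complex.I) * z)
      = fun s : ℝ => Complex.exp (j * s * Complex.I) * radialMap j G z := by
    ext1 s
    have hn : ‖Complex.exp (1 * s * Complex.I) * z‖ = ‖z‖ := by
      rw [norm_mul, one_mul, Complex.norm_exp_ofReal_mul_I, one_mul]
    have he : Complex.exp (j * s * Complex.I) = Complex.exp (1 * s * Complex.I) ^ j := by
      rw [← Complex.exp_nat_mul]; congr 1; ring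
    simp only [Function.comp, radialMap, hn, he]
    rw [mul_div_assoc, mul_pow]
    ring
  rw [h3] at h1
  rw [one_mul] at h1
  exact h1.unique h2

lemma re_im_fderiv (g : ℂ → ℂ) (z : ℂ) :
    fderiv ℝ g z z = z.re * fderiv ℝ g z 1 + z.im * fderiv ℝ g z Complex.I ∧
    fderiv ℝ g z (Complex.I * z) = z.re * fderiv ℝ g z Complex.I - z.im * fderiv ℝ g z 1 := by
  constructor
  · conv_lhs => rw [show fderiv ℝ g z z = fderiv ℝ g z (z.re • (1 : ℂ) + z.im • Complex.I) by
      congr 1; simp [Complex.re_add_im]]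
    rw [map_add, map_smul, map_smul, Complex.real_smul, Complex.real_smul]
  · rw [show Complex.I * z = z.re • Complex.I - z.im • (1 : ℂ) by
      apply Complex.ext <;> simp, map_sub, map_smul, map_smul, Complex.real_smul, Complex.real_smul]

lemma radialMap_components (hG : ContDiffOn ℝ 1 G (Ioi 0)) (hz : z ≠ 0)
    (hd : HasDerivAt G (G' ‖z‖) ‖z‖) :
    radRe (radialMap j G) (fun z => fderiv ℝ (radialMap j G) z 1)
        (fun z => fderiv ℝ (radialMap j G) z Complex.I) z = G ‖z‖ * (‖z‖ * G' ‖z‖) ∧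
    radIm (radialMap j G) (fun z => fderiv ℝ (radialMap j G) z 1)
        (fun z => fderiv ℝ (radialMap j G) z Complex.I) z = 0 ∧
    angRe (radialMap j G) (fun z => fderiv ℝ (radialMap j G) z 1)
        (fun z => fderiv ℝ (radialMap j G) z Complex.I) z = 0 ∧
    angIm (radialMap j G) (fun z => fderiv ℝ (radialMap j G) z 1)
        (fun z => fderiv ℝ (radialMap j G) z Complex.I) z = j * G ‖z‖ ^ 2 := by
  have hu : conj ((z / ‖z‖) ^ j) * (z / ‖z‖) ^ j = 1 := by
    rw [mul_comm, Complex.mul_conj, Complex.normSq_eq_norm_sq, norm_div_norm_pow hz]; simp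
  have e1 : conj (radialMap j G z) * fderiv ℝ (radialMap j G) z z
      = ((G ‖z‖ * (‖z‖ * G' ‖z‖) : ℝ) : ℂ) := by
    rw [fderiv_radialMap_radial hG hz hd, radialMap, map_mul, Complex.conj_ofReal]
    push_cast
    linear_combination (G ‖z‖ : ℂ) * ((‖z‖ : ℂ) * (G' ‖z‖ : ℂ)) * hu
  have e2 : conj (radialMap j G z) * fderiv ℝ (radialMap j G) z (Complex.I * z)
      = ((j * G ‖z‖ ^ 2 : ℝ) : ℂ) * Complex.I := by
    rw [fderiv_radialMap_angular hG hz, radialMap, map_mul, Complex.conj_ofReal]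
    push_cast
    linear_combination (j : ℂ) * (G ‖z‖ : ℂ) ^ 2 * Complex.I * hu
  rw [(re_im_fderiv _ z).1] at e1
  rw [(re_im_fderiv _ z).2] at e2
  refine ⟨?_, ?_, ?_, ?_⟩
  · rw [radRe, e1, Complex.ofReal_re]
  · rw [radIm, e1, Complex.ofReal_im]
  · rw [angRe, e2]; simp [-Complex.ofReal_mul]
  · rw [angIm, e2]; simp [-Complex.ofReal_mul]

lemma det_fderiv_radialMap (hG : ContDiffOn ℝ 1 G (Ioi 0)) (hz : z ≠ 0)
    (hd : HasDerivAt G (G' ‖z‖) ‖z‖) (hG0 : G ‖z‖ ≠ 0) :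
    (fderiv ℝ (radialMap j G) z).det = j * G ‖z‖ * G' ‖z‖ / ‖z‖ := by
  have h := jacobian_identity (radialMap j G) (fun z => fderiv ℝ (radialMap j G) z 1)
        (fun z => fderiv ℝ (radialMap j G) z Complex.I) z
  obtain ⟨h1, h2, h3, h4⟩ := radialMap_components (j := j) hG hz hd
  rw [h1, h2, h3, h4, norm_radialMap j G hz, sq_abs] at h
  have : jacDet (fun z => fderiv ℝ (radialMap j G) z 1) (fun z => fderiv ℝ (radialMap j G) z Complex.I) z
      = (fderiv ℝ (radialMap j G) z).det := by
    rw [det_eq_of_apply]; simp [jacDet]; ring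
  rw [this] at h
  have hz0 : ‖z‖ ≠ 0 := norm_ne_zero_iff.2 hz
  rw [eq_div_iff hz0]
  refine mul_right_cancel₀ (mul_ne_zero hz0 (pow_ne_zero 2 hG0)) ?_
  linear_combination h

end derivatives

/-! ### Fibres and images of radial maps -/

lemma exists_pow_eq_of_norm {j : ℕ} (hj : 1 ≤ j) {w : ℂ} (hw : ‖w‖ = 1) : ∃ ζ : ℂ, ζ ^ j = w ∧ ‖ζ‖ = 1 := by
  obtain ⟨ζ, hζ⟩ := IsAlgClosed.exists_pow_nat_eq w (Nat.pos_of_ne_zero (by omega) : 0 < j)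
  refine ⟨ζ, hζ, ?_⟩
  rw [← hζ, norm_pow] at hw
  exact (pow_eq_one_iff_of_nonneg (norm_nonneg _) (by omega)).1 hw

lemma exists_radialMap_eq {j : ℕ} (hj : 1 ≤ j) {G : ℝ → ℝ} {t : ℝ} (ht : 0 < t) {w : ℂ} (hw : w ≠ 0)
    (hG : G t = ‖w‖) : ∃ z : ℂ, ‖z‖ = t ∧ radialMap j G z = w := by
  have hw0 : ‖w‖ ≠ 0 := norm_ne_zero_iff.2 hw
  obtain ⟨ζ, h1, h2⟩ := exists_pow_eq_of_norm (w := w / ‖w‖) hj (by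
    rw [norm_div, Complex.norm_real, norm_norm, div_self hw0])
  have hn : ‖(t : ℂ) * ζ‖ = t := by
    rw [norm_mul, h2, mul_one, Complex.norm_real, Real.norm_eq_abs, abs_of_pos ht]
  have ht' : (t : ℂ) ≠ 0 := Complex.ofReal_ne_zero.2 ht.ne'
  refine ⟨t * ζ, hn, ?_⟩
  rw [radialMap, hn, mul_div_cancel_left₀ _ ht', h1, hG, mul_div_cancel₀]
  exact Complex.ofReal_ne_zero.2 hw0

lemma radialMap_image_annulus {j : ℕ} (hj : 1 ≤ j) {G : ℝ → ℝ} {a b A B : ℝ} (ha : 0 ≤ a) (hA : 0 ≤ A)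
    (h : G '' Ioo a b = Ioo A B) : radialMap j G '' annulus a b = annulus A B := by
  ext w
  constructor
  · rintro ⟨z, hz, rfl⟩
    have hz0 : z ≠ 0 := norm_pos_iff.1 (lt_of_le_of_lt ha hz.1)
    have : G ‖z‖ ∈ Ioo A B := h ▸ mem_image_of_mem G hz
    change A < _ ∧ _ < B
    rw [norm_radialMap j G hz0, abs_of_pos (lt_of_le_of_lt hA this.1)]
    exact this
  · intro hw
    have : ‖w‖ ∈ G '' Ioo a b := h ▸ hw
    obtain ⟨t, ht, htw⟩ := this
    obtain ⟨z, hz1, hz2⟩ := exists_radialMap_eq hj (lt_of_le_of_lt ha ht.1)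
      (norm_pos_iff.1 (lt_of_le_of_lt hA hw.1)) htw
    exact ⟨z, by rw [← hz1] at ht; exact ht, hz2⟩

lemma radialMap_image_sphere {j : ℕ} (hj : 1 ≤ j) {G : ℝ → ℝ} {a : ℝ} (ha : 0 < a) (hG : 0 < G a) :
    radialMap j G '' Metric.sphere 0 a = Metric.sphere 0 (G a) := by
  ext w
  constructor
  · rintro ⟨z, hz, rfl⟩
    have hz' : ‖z‖ = a := by simpa using hz
    have hz0 : z ≠ 0 := norm_pos_iff.1 (hz' ▸ ha)
    rw [mem_sphere_zero_iff_norm, norm_radialMap j G hz0, hz', abs_of_pos hG]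
  · intro hw
    have hw' : ‖w‖ = G a := by simpa using hw
    obtain ⟨z, hz1, hz2⟩ := exists_radialMap_eq (G := G) hj ha (norm_pos_iff.1 (hw' ▸ hG)) hw'.symm
    exact ⟨z, by simpa using hz1, hz2⟩

/-- The profile of the minimizer: a solution of `t G' = j √(G² - c)` that increases from `1` to `R`. -/
structure RadialProfile (j : ℕ) (r R c : ℝ) (G G' : ℝ → ℝ) : Prop where
  one_le : 1 ≤ j
  one_lt_r : 1 < r
  one_lt_R : 1 < R
  c_le : c ≤ 1
  log_eq : c = 0 → Real.log (R ^ 2) = j * Real.log (r ^ 2)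
  deriv : ∀ t, 0 < t → HasDerivAt G (G' t) t
  cont' : ContinuousOn G' (Ioi 0)
  left : G 1 = 1
  right : G r = R
  lower : ∀ t ∈ Icc 1 r, 1 ≤ G t
  ode : ∀ t ∈ Icc 1 r, t * G' t = j * √(G t ^ 2 - c)

namespace RadialProfile

variable {j : ℕ} {r R c : ℝ} {G G' : ℝ → ℝ}

lemma contDiffOn (h : RadialProfile j r R c G G') : ContDiffOn ℝ 1 G (Ioi 0) := by
  have h1 : ContDiffOn ℝ (0 + 1) G (Ioi 0) := by
    rw [contDiffOn_succ_iff_deriv_of_isOpen isOpen_Ioi]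
    refine ⟨fun t ht => (h.deriv t ht).differentiableAt.differentiableWithinAt, by simp, ?_⟩
    exact contDiffOn_zero.2 (h.cont'.congr fun t ht => (h.deriv t ht).deriv)
  simpa using h1

lemma ne_zero_of_mem (_ : RadialProfile j r R c G G') {z : ℂ} (hz : z ∈ annulus 1 r) : z ≠ 0 :=
  norm_pos_iff.1 (zero_lt_one.trans hz.1)

lemma mem_Icc (_ : RadialProfile j r R c G G') {z : ℂ} (hz : z ∈ annulus 1 r) : ‖z‖ ∈ Icc 1 r :=
  ⟨hz.1.le, hz.2.le⟩

lemma deriv_nonneg (h : RadialProfile j r R c G G') {t : ℝ} (ht : t ∈ Icc 1 r) : 0 ≤ G' t := by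
  have h1 := h.ode t ht
  have h2 : 0 ≤ t * G' t := by rw [h1]; positivity
  exact nonneg_of_mul_nonneg_right h2 (by linarith [ht.1])

lemma continuousOn (h : RadialProfile j r R c G G') : ContinuousOn G (Icc 1 r) := fun t ht =>
  (h.deriv t (by linarith [ht.1])).continuousAt.continuousWithinAt

lemma monotoneOn (h : RadialProfile j r R c G G') : MonotoneOn G (Icc 1 r) := by
  refine monotoneOn_of_deriv_nonneg (convex_Icc _ _) h.continuousOn ?_ ?_
  · rw [interior_Icc]
    exact fun t ht => (h.deriv t (by linarith [ht.1])).differentiableAt.differentiableWithinAt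
  · rw [interior_Icc]
    intro t ht
    rw [(h.deriv t (by linarith [ht.1])).deriv]
    exact h.deriv_nonneg (Ioo_subset_Icc_self ht)

lemma upper (h : RadialProfile j r R c G G') {t : ℝ} (ht : t ∈ Icc 1 r) : G t ≤ R :=
  h.right ▸ h.monotoneOn ht (right_mem_Icc.2 h.one_lt_r.le) ht.2

lemma deriv_pos (h : RadialProfile j r R c G G') {t : ℝ} (ht : t ∈ Icc 1 r) (hG : 1 < G t) :
    0 < G' t := by
  have h1 := h.ode t ht
  have h2 : 0 < t * G' t := by
    rw [h1]
    have : (0 : ℝ) < j := by exact_mod_cast h.one_le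
    have h3 : 0 < G t ^ 2 - c := by nlinarith [h.c_le]
    positivity
  exact pos_of_mul_pos_right h2 (by linarith [ht.1])

/-- Rolle's theorem would give a zero of G' at a point where G > 1 by monotonicity, but there the
equation forces G' > 0. The hypothesis `hG` keeps away from the plateau G = 1 of the squeezed
profile. -/
lemma injective_of_one_lt (h : RadialProfile j r R c G G') {s t : ℝ} (hs : s ∈ Icc 1 r)
    (ht : t ∈ Icc 1 r) (hG : 1 < G s) (heq : G s = G t) : s = t := by
  wlog hst : s ≤ t generalizing s t
  · exact (this ht hs (heq ▸ hG) heq.symm (le_of_not_ge hst)).symm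
  by_contra hne
  have hlt := lt_of_le_of_ne hst hne
  have hsub : Icc s t ⊆ Icc 1 r := Icc_subset_Icc hs.1 ht.2
  obtain ⟨x, hx, hx0⟩ := exists_hasDerivAt_eq_zero hlt (h.continuousOn.mono hsub) heq
    fun x hx => h.deriv x (by linarith [hx.1, hs.1])
  have hxI := hsub (Ioo_subset_Icc_self hx)
  have := h.deriv_pos hxI (hG.trans_le (h.monotoneOn hs hxI hx.1.le))
  linarith

lemma radialTest (h : RadialProfile j r R c G G') :
    RadialTest r (fun τ => G (√τ) ^ 2) (fun τ => G (√τ) * G' (√τ) / √τ) := by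
  have hpos : ∀ τ ∈ Icc 1 (r ^ 2), (0 : ℝ) < τ := fun τ hτ => by linarith [hτ.1]
  have hm : MapsTo (fun τ => √τ) (Icc 1 (r ^ 2)) (Ioi (0 : ℝ)) := fun τ hτ => Real.sqrt_pos.2 (hpos τ hτ)
  have hs : ContinuousOn (fun τ : ℝ => √τ) (Icc 1 (r ^ 2)) := Real.continuous_sqrt.continuousOn
  have hG : ContinuousOn (fun τ => G (√τ)) (Icc 1 (r ^ 2)) := h.contDiffOn.continuousOn.comp hs hm
  refine ⟨hG.pow 2, (hG.mul (h.cont'.comp hs hm)).div hs fun τ hτ => (hm hτ).ne', fun τ hτ => ?_⟩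
  have hτ0 := hpos τ (Ioo_subset_Icc_self hτ)
  have h1 := ((h.deriv _ (Real.sqrt_pos.2 hτ0)).comp τ (Real.hasDerivAt_sqrt hτ0.ne')).pow 2
  refine h1.congr_deriv ?_
  have := (Real.sqrt_pos.2 hτ0).ne'
  simp only [Function.comp]
  field_simp
  norm_num
  ring

lemma sqrt_mem (h : RadialProfile j r R c G G') {τ : ℝ} (hτ : τ ∈ Icc 1 (r ^ 2)) : √τ ∈ Icc 1 r :=
  ⟨Real.one_le_sqrt.2 hτ.1, Real.sqrt_le_iff.2 ⟨by linarith [h.one_lt_r], hτ.2⟩⟩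

lemma sqrt_mul_eq (h : RadialProfile j r R c G G') {t : ℝ} (ht : t ∈ Icc 1 r) :
    √(G t ^ 2 * (G t ^ 2 - c)) = G t * √(G t ^ 2 - c) := by
  rw [Real.sqrt_mul (sq_nonneg _), Real.sqrt_sq (by linarith [h.lower t ht])]

lemma ode_sq (h : RadialProfile j r R c G G') {τ : ℝ} (hτ : τ ∈ Icc 1 (r ^ 2)) :
    τ * (G (√τ) * G' (√τ) / √τ) = j * √(G (√τ) ^ 2 * (G (√τ) ^ 2 - c)) := by
  have hm := h.sqrt_mem hτ
  have h1 := h.ode _ hm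
  have h0 : √τ ≠ 0 := by linarith [hm.1]
  have h2 : √τ * √τ = τ := Real.mul_self_sqrt (by linarith [hτ.1])
  rw [h.sqrt_mul_eq hm]
  have : τ * (G (√τ) * G' (√τ) / √τ) = G (√τ) * (√τ * G' (√τ)) := by
    field_simp
    rw [Real.sq_sqrt (by linarith [hτ.1])]
    ring
  rw [this, h1]; ring

lemma contDiffOn_radialMap (h : RadialProfile j r R c G G') :
    ContDiffOn ℝ 1 (radialMap j G) (annulus 1 r) :=
  (_root_.contDiffOn_radialMap j h.contDiffOn).mono fun _ hz => h.ne_zero_of_mem hz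

lemma norm_radialMap (h : RadialProfile j r R c G G') {z : ℂ} (hz : ‖z‖ ∈ Icc 1 r) :
    ‖radialMap j G z‖ = G ‖z‖ := by
  rw [_root_.norm_radialMap j G (norm_pos_iff.1 (by linarith [hz.1])),
    abs_of_nonneg (by linarith [h.lower _ hz])]

lemma radialSystem (h : RadialProfile j r R c G G') {z : ℂ} (hz : z ∈ annulus 1 r) :
    RadialSystem j c (radialMap j G) (fun z => fderiv ℝ (radialMap j G) z 1)
      (fun z => fderiv ℝ (radialMap j G) z Complex.I) z := by
  have hm := h.mem_Icc hz
  obtain ⟨h1, h2, h3, h4⟩ := radialMap_components (j := j) h.contDiffOn (h.ne_zero_of_mem hz)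
    (h.deriv _ (by linarith [hm.1]))
  refine ⟨?_, ?_, h3, h2⟩
  · rw [h1, h.norm_radialMap hm, h.ode _ hm, h.sqrt_mul_eq hm]; ring
  · rw [h4, h.norm_radialMap hm]

lemma isCompact_closedAnnulus (r : ℝ) : IsCompact {z : ℂ | 1 ≤ ‖z‖ ∧ ‖z‖ ≤ r} := by
  refine Metric.isCompact_of_isClosed_isBounded ?_ ?_
  · exact (isClosed_le continuous_const continuous_norm).inter (isClosed_le continuous_norm continuous_const)
  · exact Metric.isBounded_closedBall.subset fun z hz => mem_closedBall_zero_iff.2 hz.2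

lemma closedAnnulus_subset (r : ℝ) : {z : ℂ | 1 ≤ ‖z‖ ∧ ‖z‖ ≤ r} ⊆ {0}ᶜ := fun _ hz =>
  norm_pos_iff.1 (lt_of_lt_of_le zero_lt_one hz.1)

lemma continuousOn_radialMap (h : RadialProfile j r R c G G') :
    ContinuousOn (radialMap j G) {z | 1 ≤ ‖z‖ ∧ ‖z‖ ≤ r} :=
  (_root_.contDiffOn_radialMap j h.contDiffOn).continuousOn.mono (closedAnnulus_subset r)

lemma memLp_fderiv (h : RadialProfile j r R c G G') (e : ℂ) :
    MemLp (fun z => fderiv ℝ (radialMap j G) z e) 2 (volume.restrict (annulus 1 r)) := by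
  have hc : ContinuousOn (fun z => fderiv ℝ (radialMap j G) z e) {0}ᶜ :=
    ((_root_.contDiffOn_radialMap j h.contDiffOn).continuousOn_fderiv_of_isOpen isOpen_compl_singleton
      le_rfl).clm_apply continuousOn_const
  obtain ⟨C, hC⟩ := (isCompact_closedAnnulus r).exists_bound_of_continuousOn
    (hc.mono (closedAnnulus_subset r))
  have hs : annulus 1 r ⊆ {z : ℂ | 1 ≤ ‖z‖ ∧ ‖z‖ ≤ r} := fun z hz => ⟨hz.1.le, hz.2.le⟩
  refine MemLp.of_bound ((hc.mono (hs.trans (closedAnnulus_subset r))).aestronglyMeasurable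
    (measurableSet_annulus 1 r)) C ?_
  filter_upwards [ae_restrict_mem (measurableSet_annulus 1 r)] with z hz using hC z (hs hz)

lemma isWeakPartial (h : RadialProfile j r R c G G') (e : ℂ) :
    IsWeakPartial (annulus 1 r) e (radialMap j G) (fun z => fderiv ℝ (radialMap j G) z e) :=
  isWeakPartial_of_contDiffOn (isOpen_annulus 1 r) h.contDiffOn_radialMap e

lemma memW12 (h : RadialProfile j r R c G G') : MemW12 (annulus 1 r) (radialMap j G) where
  memLp := by
    refine MemLp.of_bound (h.contDiffOn_radialMap.continuousOn.aestronglyMeasurable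
      (measurableSet_annulus 1 r)) R ?_
    filter_upwards [ae_restrict_mem (measurableSet_annulus 1 r)] with z hz
    rw [h.norm_radialMap (h.mem_Icc hz)]
    exact h.upper (h.mem_Icc hz)
  partial_x := ⟨_, h.memLp_fderiv 1, h.isWeakPartial 1⟩
  partial_y := ⟨_, h.memLp_fderiv Complex.I, h.isWeakPartial Complex.I⟩

/-- A point w with 1 < |w| < R is attained only on the circle |z| = t with G(t) = |w|, and there its
preimages are the j roots of z^j = t^j w/|w|. The Jacobian j G G'/t is positive at each of them. A
plateau is sent to the unit circle and meets no such fibre. -/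
lemma hasRegularDegree (h : RadialProfile j r R c G G') :
    HasRegularDegree (annulus 1 r) (annulus 1 R) (radialMap j G) j := by
  refine ⟨h.contDiffOn_radialMap, fun w hw _ => ?_⟩
  have hj0 : 0 < j := h.one_le
  obtain ⟨t, ht, htw⟩ : ∃ t ∈ Ioo 1 r, G t = ‖w‖ :=
    intermediate_value_Ioo h.one_lt_r.le h.continuousOn (by rw [h.left, h.right]; exact hw)
  have hw0 : w ≠ 0 := norm_pos_iff.1 (zero_lt_one.trans hw.1)
  have hwn : (‖w‖ : ℂ) ≠ 0 := Complex.ofReal_ne_zero.2 (norm_ne_zero_iff.2 hw0)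
  have ht0 : 0 < t := zero_lt_one.trans ht.1
  have htc : (t : ℂ) ≠ 0 := Complex.ofReal_ne_zero.2 ht0.ne'
  set b : ℂ := t ^ j * (w / ‖w‖) with hb
  have hbn : ‖b‖ = t ^ j := by
    rw [hb, norm_mul, norm_pow, Complex.norm_real, Real.norm_eq_abs, abs_of_pos ht0, norm_div,
      Complex.norm_real, norm_norm, div_self (norm_ne_zero_iff.2 hw0), mul_one]
  have hfib : ∀ z : ℂ, (z ∈ annulus 1 r ∧ radialMap j G z = w) ↔ z ^ j = b := by
    intro z
    constructor
    · rintro ⟨hz, hzw⟩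
      have hn : G ‖z‖ = G t := by rw [htw, ← hzw, h.norm_radialMap (h.mem_Icc hz)]
      have hzt : ‖z‖ = t := (h.injective_of_one_lt (Ioo_subset_Icc_self ht) (h.mem_Icc hz)
        (htw ▸ hw.1) hn.symm).symm
      rw [radialMap, hzt, htw, div_pow] at hzw
      have : w / ‖w‖ = z ^ j / t ^ j := by rw [div_eq_iff hwn, mul_comm]; exact hzw.symm
      rw [hb, this, mul_div_cancel₀ _ (pow_ne_zero j htc)]
    · intro hz
      have hzt : ‖z‖ = t := by
        have : ‖z‖ ^ j = t ^ j := by rw [← norm_pow, hz, hbn]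
        exact (pow_left_inj₀ (norm_nonneg _) ht0.le hj0.ne').1 this
      refine ⟨by rw [← hzt] at ht; exact ht, ?_⟩
      rw [radialMap, hzt, htw, div_pow, hz, hb]
      field_simp
  have hset : {z ∈ annulus 1 r | radialMap j G z = w} = ↑(Polynomial.nthRoots j b).toFinset := by
    ext z
    rw [Finset.mem_coe, Multiset.mem_toFinset, Polynomial.mem_nthRoots hj0]
    exact hfib z
  have hb0 : b ≠ 0 := by
    rw [← norm_ne_zero_iff, hbn]; positivity
  have hcard : (Polynomial.nthRoots j b).toFinset.card = j := by
    have hp := Complex.isPrimitiveRoot_exp j hj0.ne'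
    rw [Multiset.toFinset_card_of_nodup (hp.nthRoots_nodup hb0), hp.card_nthRoots,
      if_pos (IsAlgClosed.exists_pow_nat_eq b hj0)]
  rw [hset]
  refine ⟨Finset.finite_toSet _, ?_⟩
  rw [finsum_mem_coe_finset]
  have hone : ∀ z ∈ (Polynomial.nthRoots j b).toFinset,
      (SignType.sign (fderiv ℝ (radialMap j G) z).det : ℤ) = 1 := by
    intro z hz
    rw [Multiset.mem_toFinset, Polynomial.mem_nthRoots hj0, ← hfib] at hz
    have hm := h.mem_Icc hz.1
    have hG1 : 1 < G ‖z‖ := by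
      rw [← h.norm_radialMap hm, hz.2]; exact hw.1
    have hz0 : 0 < ‖z‖ := by linarith [hm.1]
    rw [det_fderiv_radialMap h.contDiffOn (h.ne_zero_of_mem hz.1) (h.deriv _ hz0) (by linarith),
      sign_pos]
    · rfl
    · have h1 := h.deriv_pos hm hG1
      have h2 : (0 : ℝ) < j := by exact_mod_cast hj0
      have h3 : 0 < G ‖z‖ := by linarith
      positivity
  rw [Finset.sum_congr rfl hone, Finset.sum_const, hcard]
  simp

lemma isBoundaryOnto (h : RadialProfile j r R c G G') : IsBoundaryOnto r R (radialMap j G) := by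
  refine ⟨h.continuousOn_radialMap, ?_, ?_⟩
  · rw [radialMap_image_sphere h.one_le one_pos (by rw [h.left]; exact one_pos), h.left]
  · rw [radialMap_image_sphere h.one_le (by linarith [h.one_lt_r])
      (by rw [h.right]; linarith [h.one_lt_R]), h.right]

end RadialProfile

/-! ### Admissibility and minimality of radial maps -/

/-- A Lipschitz bound makes the integrand O(ε) on a strip whose area tends to zero. The constant `K`
accounts for the passage from widths in |z| to widths in |z|². -/
lemma tendsto_trace_of_le {r τ₀ C K : ℝ} (hr : 1 < r) (hτ : τ₀ ∉ Ioo 1 (r ^ 2)) (hC : 0 ≤ C)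
    (hK : 0 < K) {E : ℝ → Set ℂ} (hE : ∀ᶠ ε in 𝓝[>] (0 : ℝ), E ε ⊆ strip r τ₀ (K * ε)) {a : ℂ → ℝ}
    (hEm : ∀ ε, MeasurableSet (E ε)) (ha : ∀ z ∈ annulus 1 r, |a z| ≤ C * |‖z‖ ^ 2 - τ₀|) :
    Tendsto (fun ε : ℝ => ε⁻¹ * ∫ z in E ε, |a z|) (𝓝[>] 0) (𝓝 0) := by
  have t := tendsto_integral_strip hr hτ (integrable_const (1 : ℝ))
  have hK0 : Tendsto (fun ε : ℝ => K * ε) (𝓝[>] 0) (𝓝[>] 0) := by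
    refine tendsto_nhdsWithin_iff.2 ⟨?_, ?_⟩
    · have : Tendsto (fun ε : ℝ => K * ε) (𝓝 0) (𝓝 (K * 0)) :=
        (continuous_const.mul continuous_id).tendsto 0
      rw [mul_zero] at this
      exact this.mono_left nhdsWithin_le_nhds
    · filter_upwards [self_mem_nhdsWithin] with ε hε
      exact mul_pos hK hε
  have t2 := (t.comp hK0).const_mul (C * K)
  rw [mul_zero] at t2
  refine tendsto_of_tendsto_of_tendsto_of_le_of_le' tendsto_const_nhds t2 ?_ ?_
  · filter_upwards [self_mem_nhdsWithin] with ε hε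
    exact mul_nonneg (inv_nonneg.2 (le_of_lt hε)) (integral_nonneg fun z => abs_nonneg _)
  filter_upwards [self_mem_nhdsWithin, hE] with ε hε hEε
  have hε : 0 < ε := hε
  rw [inv_mul_le_iff₀ hε]
  have hi : IntegrableOn (fun _ : ℂ => C * (K * ε)) (strip r τ₀ (K * ε)) :=
    (integrable_const (μ := volume.restrict (annulus 1 r)) _).mono_measure
      (Measure.restrict_mono_set _ (strip_subset _ _ _))
  have h1 : ∫ z in E ε, |a z| ≤ ∫ z in E ε, C * (K * ε) := by
    refine integral_mono_of_nonneg (Eventually.of_forall fun z => abs_nonneg _) (hi.mono_set hEε) ?_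
    filter_upwards [ae_restrict_mem (hEm ε)] with z hz
    have := hEε hz
    exact (ha z this.1).trans (mul_le_mul_of_nonneg_left this.2.le hC)
  have h2 : ∫ z in E ε, C * (K * ε) ≤ ∫ z in strip r τ₀ (K * ε), C * (K * ε) :=
    setIntegral_mono_set hi (Eventually.of_forall fun z => by
      simp only [Pi.zero_apply]; positivity) hEε.eventuallyLE
  refine (h1.trans h2).trans (le_of_eq ?_)
  simp only [Function.comp, abs_one]
  have : (fun _ : ℂ => C * (K * ε)) = fun _ => C * (K * ε) * 1 := by simp
  rw [this, integral_const_mul]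
  ring

namespace RadialProfile

variable {j : ℕ} {r R c : ℝ} {G G' : ℝ → ℝ}

lemma exists_lipschitz (h : RadialProfile j r R c G G') :
    ∃ C, 0 ≤ C ∧ ∀ s ∈ Icc 1 r, ∀ t ∈ Icc 1 r, |G t - G s| ≤ C * |t - s| := by
  have hc : ContinuousOn G' (Icc 1 r) := h.cont'.mono fun t ht => by
    have : 0 < t := by linarith [ht.1]
    exact this
  obtain ⟨C, hC⟩ := isCompact_Icc.exists_bound_of_continuousOn hc
  refine ⟨C, (norm_nonneg _).trans (hC 1 (left_mem_Icc.2 h.one_lt_r.le)), fun s hs t ht => ?_⟩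
  exact (convex_Icc 1 r).norm_image_sub_le_of_norm_hasDerivWithin_le
    (fun x hx => (h.deriv x (by linarith [hx.1])).hasDerivWithinAt) hC hs ht

lemma innerToInner (h : RadialProfile j r R c G G') : InnerToInner (radialMap j G) := by
  have hr := h.one_lt_r
  obtain ⟨C, hC, hL⟩ := h.exists_lipschitz
  refine tendsto_trace_of_le (K := 1 + r) hr (AnnulusMap.one_notMem_Ioo r) hC (by linarith) ?_
    (fun ε => measurableSet_annulus _ _) fun z hz => ?_
  · filter_upwards [self_mem_nhdsWithin, nhdsWithin_le_nhds (Iio_mem_nhds (sub_pos.2 hr))] with ε hε hε2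
    have hε : 0 < ε := hε
    have hε2 : ε < r - 1 := hε2
    intro z hz
    have h1 := hz.1
    have h2 := hz.2
    refine ⟨⟨h1, by linarith⟩, ?_⟩
    rw [abs_of_pos (by nlinarith)]
    nlinarith
  · have hm := h.mem_Icc hz
    have hL1 := hL 1 (left_mem_Icc.2 hr.le) _ hm
    rw [h.left] at hL1
    rw [h.norm_radialMap hm]
    refine hL1.trans (mul_le_mul_of_nonneg_left ?_ hC)
    rw [abs_of_nonneg (by linarith [hm.1]), abs_of_nonneg (by nlinarith [hm.1])]
    nlinarith [hm.1]

lemma outerToOuter (h : RadialProfile j r R c G G') : OuterToOuter r R (radialMap j G) := by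
  have hr := h.one_lt_r
  obtain ⟨C, hC, hL⟩ := h.exists_lipschitz
  refine tendsto_trace_of_le (K := 2 * r) hr (AnnulusMap.sq_notMem_Ioo r) hC (by linarith) ?_
    (fun ε => measurableSet_annulus _ _) fun z hz => ?_
  · filter_upwards [self_mem_nhdsWithin, nhdsWithin_le_nhds (Iio_mem_nhds (sub_pos.2 hr))] with ε hε hε2
    have hε : 0 < ε := hε
    have hε2 : ε < r - 1 := hε2
    intro z hz
    have h1 := hz.1
    have h2 := hz.2
    refine ⟨⟨by linarith, h2⟩, ?_⟩
    rw [abs_of_neg (by nlinarith)]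
    nlinarith
  · have hm := h.mem_Icc hz
    rw [h.norm_radialMap hm, ← h.right]
    refine (hL r (right_mem_Icc.2 hr.le) _ hm).trans (mul_le_mul_of_nonneg_left ?_ hC)
    rw [abs_of_nonpos (by linarith [hm.2]), abs_of_nonpos (by nlinarith [hm.1, hm.2])]
    nlinarith [hm.1, hm.2]

lemma hasSobolevDegree (h : RadialProfile j r R c G G') :
    HasSobolevDegree (annulus 1 r) (annulus 1 R) (radialMap j G) j :=
  h.hasRegularDegree.hasSobolevDegree (isOpen_annulus 1 r) h.memW12

lemma isAdmissible (h : RadialProfile j r R c G G') : IsAdmissible j r R (radialMap j G) where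
  sobolev := h.memW12
  range := by
    filter_upwards [ae_restrict_mem (measurableSet_annulus 1 r)] with z hz
    rw [h.norm_radialMap (h.mem_Icc hz)]
    exact ⟨h.lower _ (h.mem_Icc hz), h.upper (h.mem_Icc hz)⟩
  inner := h.innerToInner
  outer := h.outerToOuter
  degree := Or.inl h.hasRegularDegree

end RadialProfile

lemma dirichletEnergy_eq (X : Set ℂ) (f : ℂ → ℂ) : dirichletEnergy X f
    = 1 / 2 * ∫ z in X, (‖weakPartial X 1 f z‖ ^ 2 + ‖weakPartial X Complex.I f z‖ ^ 2) := by
  rw [dirichletEnergy, integral_const_mul]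

lemma RadialSystem.congr {j c : ℝ} {f u v u' v' : ℂ → ℂ} {z : ℂ} (h : RadialSystem j c f u v z)
    (hu : u' z = u z) (hv : v' z = v z) : RadialSystem j c f u' v' z := by
  unfold RadialSystem radRe radIm angRe angIm at *
  rw [hu, hv]
  exact h

lemma weakPartial_const_mul_ae_eq {X : Set ℂ} (hX : IsOpen X) {e : ℂ} {f g : ℂ → ℂ} {C : ℂ}
    (hg : HasL2WeakPartial X e g) (h : ∀ᵐ z ∂(volume.restrict X), f z = C * g z) :
    weakPartial X e f =ᵐ[volume.restrict X] fun z => C * weakPartial X e g z := by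
  obtain ⟨h1, h2⟩ := weakPartial_spec hg
  refine weakPartial_ae_eq hX (h1.const_mul C) fun φ hφ hc hs => ?_
  have e1 : ∫ z in X, fderiv ℝ φ z e • f z = C * ∫ z in X, fderiv ℝ φ z e • g z := by
    rw [← integral_const_mul]
    refine integral_congr_ae ?_
    filter_upwards [h] with z hz
    rw [hz, mul_smul_comm]
  rw [e1, h2 φ hφ hc hs, mul_neg, ← integral_const_mul]
  congr 1
  refine integral_congr_ae (Eventually.of_forall fun z => ?_)
  simp only [mul_smul_comm]

/-- The map with profile `G` is the unique minimizer of the energy, up to rotation. -/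
theorem RadialProfile.isUniqueMinimizer {j : ℕ} {r R c : ℝ} {G G' : ℝ → ℝ}
    (h : RadialProfile j r R c G G') : IsUniqueMinimizer j r R (radialMap j G) := by
  have hr := h.one_lt_r
  have hR := h.one_lt_R
  have hj : (0 : ℝ) < j := by exact_mod_cast h.one_le
  have hg := h.isAdmissible
  refine ⟨hg, fun f hf => ?_⟩
  -- The constant c is the one of the given profile, so the radial map satisfies the equality case
  -- and `κ` is attained.
  obtain ⟨κ, hκ⟩ := DegreeMap.exists_energy_bound (j := j) hr hR h.c_le h.log_eq
  have hX := isOpen_annulus 1 r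
  have gsys : ∀ᵐ z ∂(volume.restrict (annulus 1 r)), RadialSystem j c (radialMap j G)
      (weakPartial (annulus 1 r) 1 (radialMap j G))
      (weakPartial (annulus 1 r) Complex.I (radialMap j G)) z := by
    filter_upwards [ae_restrict_mem (measurableSet_annulus 1 r),
      weakPartial_ae_eq hX (h.memLp_fderiv 1) (h.isWeakPartial 1),
      weakPartial_ae_eq hX (h.memLp_fderiv Complex.I) (h.isWeakPartial Complex.I)] with z hz h1 h2
    exact (h.radialSystem hz).congr h1 h2
  have eg := (hκ _ _ _ (hg.degreeMap hr hR)).2.2 gsys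
  obtain ⟨kf, kf2⟩ := hκ _ _ _ (hf.degreeMap hr hR)
  rw [dirichletEnergy_eq, dirichletEnergy_eq, eg]
  refine ⟨by linarith, fun heq => ?_, ?_⟩
  · have fsys := kf2.1 (by linarith)
    refine (hf.annulusMap hr hR).eq_rotation_of_radialSystem hj h.c_le fsys h.radialTest
      (by simp [h.left]) (by rw [Real.sqrt_sq (by linarith), h.right]) (fun τ hτ => ?_)
      (fun τ hτ => h.ode_sq (Ioo_subset_Icc_self hτ)) h.contDiffOn_radialMap (fun z hz => ?_)
      fun z hz => h.radialSystem hz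
    · exact one_le_pow₀ (h.lower _ (h.sqrt_mem (Ioo_subset_Icc_self hτ)))
    · rw [h.norm_radialMap (h.mem_Icc hz), Real.sqrt_sq (norm_nonneg z)]
  · rintro ⟨C, hC1, hC⟩
    rw [← eg]
    congr 1
    refine integral_congr_ae ?_
    filter_upwards [weakPartial_const_mul_ae_eq hX hg.sobolev.partial_x hC,
      weakPartial_const_mul_ae_eq hX hg.sobolev.partial_y hC] with z h1 h2
    rw [h1, h2, norm_mul, norm_mul, hC1, one_mul, one_mul]

/-! ### The two explicit profiles -/

/-- The radial profile of a harmonic map `a z^j + b z̄^{-j}`. -/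
def harmonicProfile (j : ℕ) (a b t : ℝ) : ℝ := a * t ^ j + b * (t ^ j)⁻¹

/-- The derivative of `harmonicProfile`. -/
def harmonicProfile' (j : ℕ) (a b t : ℝ) : ℝ := j * (a * t ^ j - b * (t ^ j)⁻¹) / t

lemma hasDerivAt_harmonicProfile (j : ℕ) (a b : ℝ) {t : ℝ} (ht : 0 < t) :
    HasDerivAt (harmonicProfile j a b) (harmonicProfile' j a b t) t := by
  have h1 := hasDerivAt_pow j t
  have h0 : t ^ j ≠ 0 := (pow_pos ht j).ne'
  have h2 := (h1.const_mul a).add ((h1.inv h0).const_mul b)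
  refine h2.congr_deriv ?_
  have h3 : (j : ℝ) * t ^ (j - 1) = j * t ^ j / t := by
    rcases Nat.eq_zero_or_pos j with rfl | hj
    · simp
    · rw [eq_div_iff ht.ne', mul_assoc, ← pow_succ, Nat.sub_add_cancel hj]
  rw [h3, harmonicProfile']
  field_simp
  ring

lemma continuousOn_harmonicProfile' (j : ℕ) (a b : ℝ) :
    ContinuousOn (harmonicProfile' j a b) (Ioi 0) := by
  have h0 : ∀ t ∈ Ioi (0 : ℝ), t ^ j ≠ 0 := fun t ht => pow_ne_zero j (ne_of_gt ht)
  have h1 : ContinuousOn (fun t : ℝ => t ^ j) (Ioi 0) := (continuous_pow j).continuousOn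
  exact (continuousOn_const.mul ((continuousOn_const.mul h1).sub
    (continuousOn_const.mul (h1.inv₀ h0)))).div continuousOn_id fun t ht => ne_of_gt ht

/-- Follows from (a t^j + b t^{-j})² - 4ab = (a t^j - b t^{-j})². Thus c = 4ab is a first integral,
and the sign hypothesis selects the root. -/
lemma harmonicProfile_ode (j : ℕ) {a b t : ℝ} (ht : 0 < t) (h : 0 ≤ a * t ^ j - b * (t ^ j)⁻¹) :
    t * harmonicProfile' j a b t = j * √(harmonicProfile j a b t ^ 2 - 4 * a * b) := by
  have h0 : t ^ j ≠ 0 := (pow_pos ht j).ne'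
  have : harmonicProfile j a b t ^ 2 - 4 * a * b = (a * t ^ j - b * (t ^ j)⁻¹) ^ 2 := by
    unfold harmonicProfile; field_simp; ring
  rw [this, Real.sqrt_sq h, harmonicProfile', mul_div_cancel₀ _ ht.ne']

/-- The factorization shows that for t > 1 the profile exceeds 1 exactly where a t^j > 1 - a. -/
lemma harmonicProfile_sub_one {j : ℕ} {a t : ℝ} (ht : 0 < t) : harmonicProfile j a (1 - a) t - 1
    = (t ^ j - 1) * (a * t ^ j - (1 - a)) / t ^ j := by
  have h0 : t ^ j ≠ 0 := (pow_pos ht j).ne'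
  unfold harmonicProfile; field_simp; ring

lemma gCirc_eq_radialMap (j : ℕ) (hj : 1 ≤ j) (r R : ℝ) : gCirc j r R
    = radialMap j (harmonicProfile j ((1 - r ^ j * R) / (1 - r ^ (2 * j)))
      ((r ^ j * R - r ^ (2 * j)) / (1 - r ^ (2 * j)))) := by
  ext z
  rcases eq_or_ne z 0 with rfl | hz
  · have : j ≠ 0 := by omega
    simp [gCirc, radialMap, this]
  · have hn : (‖z‖ : ℂ) ≠ 0 := Complex.ofReal_ne_zero.2 (norm_ne_zero_iff.2 hz)
    have hc : conj z = (‖z‖ : ℂ) ^ 2 / z := by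
      rw [eq_div_iff hz, mul_comm, Complex.mul_conj, Complex.normSq_eq_norm_sq]; push_cast; ring
    unfold gCirc radialMap harmonicProfile
    rw [hc, div_pow, inv_div, div_pow, ← pow_mul, pow_mul' (‖z‖ : ℂ)]
    generalize (r ^ j * R - r ^ (2 * j)) / (1 - r ^ (2 * j)) = b
    generalize (1 - r ^ j * R) / (1 - r ^ (2 * j)) = a
    push_cast
    have hx : (‖z‖ : ℂ) ^ j ≠ 0 := pow_ne_zero j hn
    generalize (‖z‖ : ℂ) ^ j = x at *
    field_simp
    ring

/-- The quotient is the coefficient a of z^j in g°, whose profile has slope j(2a - 1) at t = 1.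
Nonnegative initial slope is the bound: both read 1 + r^{2j} ≤ 2 R r^j. -/
lemma one_sub_coeff_le_iff {j : ℕ} (hj : 1 ≤ j) {r R : ℝ} (hr : 1 < r) :
    1 - (1 - r ^ j * R) / (1 - r ^ (2 * j)) ≤ (1 - r ^ j * R) / (1 - r ^ (2 * j)) ↔
      NitscheBound j r R := by
  have hx : 1 < r ^ j := one_lt_pow₀ hr (by omega)
  unfold NitscheBound
  rw [pow_mul']
  generalize r ^ j = x at *
  have hx2 : 0 < x ^ 2 - 1 := by nlinarith
  have e : (1 - x * R) / (1 - x ^ 2) = (x * R - 1) / (x ^ 2 - 1) := by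
    rw [← neg_div_neg_eq]; congr 1 <;> ring
  rw [e, sub_le_iff_le_add, ← add_div, le_div_iff₀ hx2, ge_iff_le,
    show 1 / 2 * x⁻¹ * (1 + x ^ 2) = (1 + x ^ 2) / (2 * x) by field_simp,
    div_le_iff₀ (by linarith)]
  constructor <;> intro h <;> nlinarith

/-- The profile of `g°`. -/
lemma radialProfile_gCirc {j : ℕ} (hj : 1 ≤ j) {r R : ℝ} (hr : 1 < r) (hR : 1 < R)
    (hN : NitscheBound j r R) : ∃ a c : ℝ, 0 < a ∧ 1 - a ≤ a ∧
      gCirc j r R = radialMap j (harmonicProfile j a (1 - a)) ∧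
      RadialProfile j r R c (harmonicProfile j a (1 - a)) (harmonicProfile' j a (1 - a)) := by
  have hx : 1 < r ^ j := one_lt_pow₀ hr (by omega)
  have hcoef := (one_sub_coeff_le_iff hj hr).2 hN
  have hg := gCirc_eq_radialMap j hj r R
  have hx2 : 0 < (r ^ j) ^ 2 - 1 := by nlinarith
  have hne : 1 - (r ^ j) ^ 2 ≠ 0 := by linarith
  have hab : (r ^ j * R - r ^ (2 * j)) / (1 - r ^ (2 * j)) = 1 - (1 - r ^ j * R) / (1 - r ^ (2 * j)) := by
    rw [pow_mul']; field_simp; ring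
  rw [hab] at hg
  set a := (1 - r ^ j * R) / (1 - r ^ (2 * j)) with ha
  have haR : a * ((r ^ j) ^ 2 - 1) = r ^ j * R - 1 := by
    rw [ha, pow_mul']; field_simp; ring
  have ha0 : 0 < a := by linarith
  have hmono : ∀ t ∈ Icc 1 r, 0 ≤ a * t ^ j - (1 - a) * (t ^ j)⁻¹ := by
    intro t ht
    have h1 : 1 ≤ t ^ j := one_le_pow₀ ht.1
    have h2 : (t ^ j)⁻¹ ≤ 1 := inv_le_one_of_one_le₀ h1
    have h3 : 0 ≤ (t ^ j)⁻¹ := by positivity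
    nlinarith
  refine ⟨a, 4 * a * (1 - a), ha0, hcoef, hg, hj, hr, hR, ?_, ?_,
    fun t ht => hasDerivAt_harmonicProfile j _ _ ht, continuousOn_harmonicProfile' j _ _, ?_, ?_, ?_,
    fun t ht => harmonicProfile_ode j (by linarith [ht.1]) (hmono t ht)⟩
  · nlinarith [sq_nonneg (2 * a - 1)]
  · intro h0
    -- Since a > 0, the product 4a(1 - a) vanishes only for a = 1. The map is then z^j with R = r^j,
    -- which gives the logarithmic relation required when c = 0.
    have ha1 : a = 1 := by
      rcases mul_eq_zero.1 h0 with h | h <;> linarith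
    have hRx : R = r ^ j := by
      rw [ha1] at haR
      have h0 : r ^ j * (R - r ^ j) = 0 := by linarith
      rcases mul_eq_zero.1 h0 with h | h <;> linarith
    rw [hRx, Real.log_pow, Real.log_pow, Real.log_pow]
    ring
  · simp [harmonicProfile]
  · have h0 : r ^ j ≠ 0 := by linarith
    unfold harmonicProfile
    field_simp
    linear_combination haR
  · intro t ht
    have h1 : 1 ≤ t ^ j := one_le_pow₀ ht.1
    have h2 := harmonicProfile_sub_one (j := j) (a := a) (t := t) (by linarith [ht.1])
    have h3 : 0 ≤ (t ^ j - 1) * (a * t ^ j - (1 - a)) / t ^ j := by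
      refine div_nonneg (mul_nonneg (by linarith) ?_) (by linarith)
      nlinarith
    linarith

lemma one_lt_harmonicProfile {j : ℕ} (hj : 1 ≤ j) {a t : ℝ} (ha0 : 0 < a) (ha : 1 - a ≤ a)
    (ht : 1 < t) : 1 < harmonicProfile j a (1 - a) t := by
  have h1 : 1 < t ^ j := one_lt_pow₀ ht (by omega)
  have h2 := harmonicProfile_sub_one (j := j) (a := a) (t := t) (by linarith)
  have h3 : 0 < (t ^ j - 1) * (a * t ^ j - (1 - a)) / t ^ j := by
    refine div_pos (mul_pos (by linarith) ?_) (by linarith)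
    nlinarith
  linarith

lemma RadialProfile.image_Ioo {j : ℕ} {r R c : ℝ} {G G' : ℝ → ℝ} (h : RadialProfile j r R c G G')
    {a : ℝ} (ha : 1 ≤ a) (har : a < r) (hGa : G a = 1) (hG : ∀ t ∈ Ioo a r, 1 < G t) :
    G '' Ioo a r = Ioo 1 R := by
  have hsub : Icc a r ⊆ Icc 1 r := Icc_subset_Icc_left ha
  have hrI : r ∈ Icc 1 r := right_mem_Icc.2 h.one_lt_r.le
  apply Subset.antisymm
  · rintro _ ⟨t, ht, rfl⟩
    have htI := hsub (Ioo_subset_Icc_self ht)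
    refine ⟨hG t ht, lt_of_le_of_ne (h.upper htI) fun heq => ?_⟩
    exact ht.2.ne (h.injective_of_one_lt htI hrI (hG t ht) (by rw [heq, h.right]))
  · have := intermediate_value_Ioo har.le (h.continuousOn.mono hsub)
    rwa [hGa, h.right] at this

/-! ### The critical radius and the squeezed profile -/

lemma one_lt_critRadius {j : ℕ} (hj : 1 ≤ j) {R : ℝ} (hR : 1 < R) :
    1 < critRadius j R ∧ critRadius j R ^ j = R + √(R ^ 2 - 1) := by
  have hy : 1 < R + √(R ^ 2 - 1) := by linarith [Real.sqrt_nonneg (R ^ 2 - 1)]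
  have hj0 : (0 : ℝ) < j := by exact_mod_cast hj
  unfold critRadius
  refine ⟨Real.one_lt_rpow hy (by positivity), ?_⟩
  rw [one_div, Real.rpow_inv_natCast_pow (by linarith) (by omega)]

/-- With x = r^j the bound reads x² - 2Rx + 1 ≤ 0, that is, x lies between the reciprocal roots R ±
√(R² - 1). The larger root is the j-th power of the critical radius and x > 1 exceeds the smaller
one, so r ≤ r_∘ would imply the bound. -/
lemma critRadius_lt {j : ℕ} (hj : 1 ≤ j) {r R : ℝ} (hr : 1 < r) (hR : 1 < R)
    (hN : ¬ NitscheBound j r R) : critRadius j R < r := by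
  obtain ⟨h1, h2⟩ := one_lt_critRadius hj hR
  have hx : 1 < r ^ j := one_lt_pow₀ hr (by omega)
  by_contra hle
  have hpow : r ^ j ≤ R + √(R ^ 2 - 1) := h2 ▸ pow_le_pow_left₀ (by linarith) (not_lt.1 hle) j
  apply hN
  unfold NitscheBound
  rw [pow_mul', ge_iff_le]
  generalize r ^ j = x at *
  rw [show 1 / 2 * x⁻¹ * (1 + x ^ 2) = (1 + x ^ 2) / (2 * x) by field_simp,
    div_le_iff₀ (by linarith)]
  have hs := Real.sqrt_nonneg (R ^ 2 - 1)
  have hs2 : √(R ^ 2 - 1) ^ 2 = R ^ 2 - 1 := Real.sq_sqrt (by nlinarith)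
  generalize √(R ^ 2 - 1) = y at *
  have h3 : R - y ≤ x := by
    have : (R - y) * (R + y) = 1 := by linear_combination -hs2
    by_contra hlt
    have : 0 < R + y := by linarith
    nlinarith
  nlinarith

/-- The profile of the rescaled `g⋄`. -/
def squeezedProfile (j : ℕ) (ρ t : ℝ) : ℝ := harmonicProfile j (1 / 2) (1 / 2) (max 1 (ρ * t))

/-- The constant p(1) is glued to `p` at x = 1, and vanishing slope there makes the result
differentiable. For (t^j + t^{-j})/2 the slope at 1 is indeed zero, so the squeezed map is C¹ across
the circle |z| = 1/ρ. -/
lemma hasDerivAt_comp_max {p : ℝ → ℝ} {p' : ℝ → ℝ} (hp : ∀ x, 1 ≤ x → HasDerivAt p (p' x) x)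
    (h1 : p' 1 = 0) (x : ℝ) : HasDerivAt (fun x => p (max 1 x)) (p' (max 1 x)) x := by
  rcases lt_trichotomy x 1 with hx | rfl | hx
  · rw [max_eq_left hx.le, h1]
    refine (hasDerivAt_const x (p 1)).congr_of_eventuallyEq ?_
    filter_upwards [gt_mem_nhds hx] with y hy
    rw [max_eq_left (le_of_lt hy)]
  · rw [max_self, ← hasDerivWithinAt_univ, ← Iic_union_Ici (a := (1 : ℝ))]
    refine HasDerivWithinAt.union ?_ ?_
    · rw [h1]
      refine (hasDerivWithinAt_const 1 (Iic 1) (p 1)).congr (fun y hy => ?_) (by rw [max_self])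
      rw [max_eq_left hy]
    · refine (hp 1 le_rfl).hasDerivWithinAt.congr (fun y hy => ?_) (by rw [max_self])
      rw [max_eq_right hy]
  · rw [max_eq_right hx.le]
    refine (hp x hx.le).congr_of_eventuallyEq ?_
    filter_upwards [lt_mem_nhds hx] with y hy
    rw [max_eq_right (le_of_lt hy)]

lemma half_eq_one_sub_half : (1 / 2 : ℝ) = 1 - 1 / 2 := by norm_num

/-- On the plateau both sides of the equation with c = 1 are zero, and beyond it the coefficients
1/2, 1/2 give 4ab = 1. The dilation by ρ is harmless because t G' is scale invariant, and G(r) = R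
since r_∘^j = R + √(R² - 1). -/
lemma radialProfile_squeezed {j : ℕ} (hj : 1 ≤ j) {r R : ℝ} (hr : 1 < r) (hR : 1 < R)
    (hN : ¬ NitscheBound j r R) : RadialProfile j r R 1 (squeezedProfile j (critRadius j R / r))
      (fun t => harmonicProfile' j (1 / 2) (1 / 2) (max 1 (critRadius j R / r * t))
        * (critRadius j R / r)) := by
  obtain ⟨h1, h2⟩ := one_lt_critRadius hj hR
  have h3 := critRadius_lt hj hr hR hN
  set ρ := critRadius j R / r with hρ
  have hr0 : 0 < r := by linarith
  have hρ1 : ρ < 1 := (div_lt_one hr0).2 h3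
  have hρ0 : 0 < ρ := div_pos (by linarith) hr0
  have hρr : ρ * r = critRadius j R := div_mul_cancel₀ _ hr0.ne'
  have hmax : ∀ t, 1 ≤ max 1 (ρ * t) := fun t => le_max_left _ _
  have hpow : ∀ t, 1 ≤ max 1 (ρ * t) ^ j := fun t => one_le_pow₀ (hmax t)
  refine ⟨hj, hr, hR, le_rfl, fun h => absurd h one_ne_zero, fun t _ => ?_, ?_, ?_, ?_,
    fun t _ => ?_, fun t _ => ?_⟩
  · have hd := hasDerivAt_comp_max (p := harmonicProfile j (1 / 2) (1 / 2))
      (fun x hx => hasDerivAt_harmonicProfile j _ _ (by linarith)) (by simp [harmonicProfile']) (ρ * t)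
    have hl : HasDerivAt (fun t => ρ * t) ρ t := by simpa using (hasDerivAt_id t).const_mul ρ
    exact hd.comp t hl
  · refine ContinuousOn.mul ?_ continuousOn_const
    refine (continuousOn_harmonicProfile' j _ _).comp (t := Ioi 0) ?_ fun t _ => ?_
    · fun_prop
    · exact lt_of_lt_of_le zero_lt_one (hmax t)
  · unfold squeezedProfile
    rw [mul_one, max_eq_left hρ1.le]
    norm_num [harmonicProfile]
  · unfold squeezedProfile
    rw [hρr, max_eq_right h1.le, harmonicProfile, h2]
    have hs2 : √(R ^ 2 - 1) ^ 2 = R ^ 2 - 1 := Real.sq_sqrt (by nlinarith)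
    have hs := Real.sqrt_nonneg (R ^ 2 - 1)
    have : R + √(R ^ 2 - 1) ≠ 0 := by linarith
    field_simp
    linear_combination hs2
  · unfold squeezedProfile
    have h5 := harmonicProfile_sub_one (j := j) (a := 1 / 2) (t := max 1 (ρ * t)) (by linarith [hmax t])
    rw [← half_eq_one_sub_half] at h5
    have : 0 ≤ (max 1 (ρ * t) ^ j - 1) * (1 / 2 * max 1 (ρ * t) ^ j - 1 / 2) / max 1 (ρ * t) ^ j :=
      div_nonneg (mul_nonneg (by linarith [hpow t]) (by linarith [hpow t])) (by linarith [hpow t])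
    linarith
  · have hode := harmonicProfile_ode j (a := 1 / 2) (b := 1 / 2) (t := max 1 (ρ * t))
      (by linarith [hmax t]) (by
        have := inv_le_one_of_one_le₀ (hpow t)
        linarith [hpow t])
    norm_num at hode
    unfold squeezedProfile
    norm_num
    rw [← hode]
    rcases le_total (ρ * t) 1 with h | h
    · rw [max_eq_left h]; simp [harmonicProfile']
    · rw [max_eq_right h]; ring

/-- At the critical radius x = r_∘^j solves x² - 2Rx + 1 = 0, which makes both coefficients of g°
equal to 1/2. Where ρ|z| ≤ 1 the truncated argument is 1 and the profile is constantly 1. -/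
lemma gDiamondScaled_eq_radialMap {j : ℕ} (hj : 1 ≤ j) {r R : ℝ} (hr : 1 < r) (hR : 1 < R) :
    gDiamondScaled j r R = radialMap j (squeezedProfile j (critRadius j R / r)) := by
  obtain ⟨h1, h2⟩ := one_lt_critRadius hj hR
  have hρ0 : 0 < critRadius j R / r := div_pos (by linarith) (by linarith)
  set ρ := critRadius j R / r
  have hρc : (ρ : ℂ) ≠ 0 := Complex.ofReal_ne_zero.2 hρ0.ne'
  ext z
  have hn : ‖(ρ : ℂ) * z‖ = ρ * ‖z‖ := by
    rw [norm_mul, Complex.norm_real, Real.norm_eq_abs, abs_of_pos hρ0]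
  have hq : (ρ : ℂ) * z / ((ρ * ‖z‖ : ℝ) : ℂ) = z / ‖z‖ := by
    rw [Complex.ofReal_mul, mul_div_mul_left _ _ hρc]
  change gDiamond j R (ρ * z) = _
  unfold gDiamond
  split_ifs with hz
  · have hy : 1 < critRadius j R ^ j := one_lt_pow₀ h1 (by omega)
    have hs2 : √(R ^ 2 - 1) ^ 2 = R ^ 2 - 1 := Real.sq_sqrt (by nlinarith)
    have hRy : critRadius j R ^ j * R = ((critRadius j R ^ j) ^ 2 + 1) / 2 := by
      rw [h2]; linear_combination (-1 / 2) * hs2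
    have hne : 1 - (critRadius j R ^ j) ^ 2 ≠ 0 := by nlinarith
    have ea : (1 - critRadius j R ^ j * R) / (1 - critRadius j R ^ (2 * j)) = 1 / 2 := by
      rw [pow_mul', hRy, div_eq_iff hne]; ring
    have eb : (critRadius j R ^ j * R - critRadius j R ^ (2 * j)) / (1 - critRadius j R ^ (2 * j))
        = 1 / 2 := by
      rw [pow_mul', hRy, div_eq_iff hne]; ring
    rw [gCirc_eq_radialMap j hj, ea, eb]
    rw [hn] at hz
    rw [radialMap, radialMap, hn, hq, squeezedProfile, max_eq_right hz]
  · rw [hn] at hz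
    rw [← div_pow, hn, hq, radialMap, squeezedProfile, max_eq_left (le_of_not_ge hz)]
    norm_num [harmonicProfile]

/-! ### Radial harmonic maps -/

-- A holomorphic function plus the conjugate of one. The factor `k` allows for the dilation in the
-- squeezed map.
open InnerProductSpace in
lemma harmonicAt_combination {j : ℕ} {k z : ℂ} (hk : k ≠ 0) (hz : z ≠ 0) (a b : ℝ) :
    HarmonicAt (fun z => (b : ℂ) * (conj (k * z) ^ j)⁻¹ + (a : ℂ) * (k * z) ^ j) z := by
  have hkz : (k * z) ^ j ≠ 0 := pow_ne_zero j (mul_ne_zero hk hz)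
  have h1 : AnalyticAt ℂ (fun z => (a : ℂ) * (k * z) ^ j) z := by fun_prop
  have h2 : AnalyticAt ℂ (fun z => (b : ℂ) * ((k * z) ^ j)⁻¹) z :=
    analyticAt_const.mul (AnalyticAt.inv (by fun_prop) hkz)
  have h3 := h2.harmonicAt.comp_CLM (Complex.conjCLE : ℂ →L[ℝ] ℂ)
  have e : (fun z => (b : ℂ) * (conj (k * z) ^ j)⁻¹ + (a : ℂ) * (k * z) ^ j)
      = ((Complex.conjCLE : ℂ →L[ℝ] ℂ) ∘ fun z => (b : ℂ) * ((k * z) ^ j)⁻¹)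
        + fun z => (a : ℂ) * (k * z) ^ j := by
    ext z; simp
  rw [e]
  exact h3.add h1.harmonicAt

/-- A harmonic map that is equivariant under rotations satisfies an Euler equation along the real
axis. -/
lemma euler_of_harmonicAt {f : ℂ → ℂ} {t : ℝ} {j : ℕ}
    (hf : InnerProductSpace.HarmonicAt f (t : ℂ))
    (hrot : ∀ s : ℝ, f (t * Complex.exp (s * Complex.I)) = f t * Complex.exp (j * s * Complex.I)) :
    (t : ℂ) ^ 2 * fderiv ℝ (fderiv ℝ f) t 1 1 + t * fderiv ℝ f t 1 - j ^ 2 * f t = 0 := by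
  have hlap : fderiv ℝ (fderiv ℝ f) t 1 1 + fderiv ℝ (fderiv ℝ f) t Complex.I Complex.I = 0 := by
    have := hf.2.eq_of_nhds
    rw [InnerProductSpace.laplacian_eq_iteratedFDeriv_complexPlane] at this
    simpa [iteratedFDeriv_two_apply] using this
  have hγ : ∀ n : ℂ, ∀ s : ℝ, HasDerivAt (fun s : ℝ => Complex.exp (n * s * Complex.I))
      (n * Complex.I * Complex.exp (n * s * Complex.I)) s := by
    intro n s
    have h0 : HasDerivAt (fun s : ℝ => n * (s : ℂ) * Complex.I) (n * Complex.I) s := by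
      simpa using ((Complex.ofRealCLM.hasDerivAt (x := s)).const_mul n).mul_const Complex.I
    simpa [mul_comm] using h0.cexp
  set γ : ℝ → ℂ := fun s => t * Complex.exp (1 * s * Complex.I) with hγd
  have hγ1 : ∀ s, HasDerivAt γ (Complex.I * γ s) s := fun s =>
    ((hγ 1 s).const_mul (t : ℂ)).congr_deriv (by simp only [hγd]; ring)
  have hγ0 : γ 0 = t := by simp [hγd]
  have hγc : ContinuousAt γ 0 := (hγ1 0).continuousAt
  have hfγ : ∀ s : ℝ, f (γ s) = f t * Complex.exp (j * s * Complex.I) := fun s => by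
    rw [← hrot s]; simp [hγd]
  have hdiff : ∀ᶠ z in 𝓝 (t : ℂ), DifferentiableAt ℝ f z := by
    filter_upwards [hf.1.eventually (by simp)] with z hz
    exact hz.differentiableAt two_ne_zero
  have hdiff2 : DifferentiableAt ℝ (fderiv ℝ f) t :=
    (hf.1.fderiv_right (m := 1) (by norm_num)).differentiableAt one_ne_zero
  -- The relation f(t e^{is}) = f(t) e^{ijs} is differentiated once near s = 0 and then again at s =
  -- 0. This expresses the second derivative in the direction I through first order terms, and the
  -- Laplace equation trades it for minus the second derivative in the direction 1.
  have e1 : (fun s => fderiv ℝ f (γ s) (Complex.I * γ s))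
      =ᶠ[𝓝 0] fun s : ℝ => f t * (j * Complex.I) * Complex.exp (j * s * Complex.I) := by
    filter_upwards [hγc.eventually (hγ0.symm ▸ hdiff)] with s hs
    have h1 := hs.hasFDerivAt.comp_hasDerivAt s (hγ1 s)
    have h2 := (hγ j s).const_mul (f t)
    have h3 : f ∘ γ = fun s : ℝ => f t * Complex.exp (j * s * Complex.I) := funext hfγ
    rw [h3] at h1
    rw [h1.unique h2]; ring
  have d1 : HasDerivAt (fun s => fderiv ℝ f (γ s)) (fderiv ℝ (fderiv ℝ f) t (Complex.I * t)) 0 := by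
    have := hdiff2.hasFDerivAt.comp_hasDerivAt_of_eq 0 (hγ1 0) hγ0.symm
    rwa [hγ0] at this
  have d2 : HasDerivAt (fun s => Complex.I * γ s) (-t : ℂ) 0 := by
    refine ((hγ1 0).const_mul Complex.I).congr_deriv ?_
    rw [hγ0, ← mul_assoc, Complex.I_mul_I]; ring
  have d3 := (d1.clm_apply d2).congr_of_eventuallyEq e1.symm
  have d4 := (hγ j 0).const_mul (f t * (j * Complex.I))
  have e2 := d3.unique d4
  rw [hγ0] at e2
  have hI : Complex.I * (t : ℂ) = t • Complex.I := by rw [Complex.real_smul]; ring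
  have ht : (-t : ℂ) = (-t) • (1 : ℂ) := by rw [Complex.real_smul]; simp
  rw [hI, ht] at e2
  simp only [map_smul, _root_.smul_apply] at e2
  simp only [Complex.real_smul, Complex.ofReal_zero, mul_zero, zero_mul, Complex.exp_zero, mul_one, Complex.ofReal_neg] at e2
  have hI2 : Complex.I * Complex.I = -1 := Complex.I_mul_I
  linear_combination (t : ℂ) ^ 2 * hlap - e2 + (-(j : ℂ) ^ 2 * f t) * hI2

/-- Solutions of the Euler equation on an interval. -/
lemma eq_of_euler {j : ℕ} (hj : 1 ≤ j) {r : ℝ} {g g₁ g₂ : ℝ → ℂ}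
    (h1 : ∀ t ∈ Ioo 1 r, HasDerivAt g (g₁ t) t) (h2 : ∀ t ∈ Ioo 1 r, HasDerivAt g₁ (g₂ t) t)
    (he : ∀ t ∈ Ioo 1 r, (t : ℂ) ^ 2 * g₂ t + t * g₁ t - j ^ 2 * g t = 0) :
    ∃ a b : ℂ, ∀ t ∈ Ioo 1 r, g t = a * t ^ j + b * ((t : ℂ) ^ j)⁻¹ := by
  have hj0 : (j : ℂ) ≠ 0 := Nat.cast_ne_zero.2 (by omega)
  have ht0 : ∀ t ∈ Ioo 1 r, (t : ℂ) ≠ 0 := fun t ht =>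
    Complex.ofReal_ne_zero.2 (by linarith [ht.1])
  have hpow : ∀ t ∈ Ioo 1 r, HasDerivAt (fun t : ℝ => (t : ℂ) ^ j) (j * (t : ℂ) ^ j / t) t := by
    intro t ht
    have := (Complex.ofRealCLM.hasDerivAt (x := t)).pow j
    refine this.congr_deriv ?_
    rw [eq_div_iff (ht0 t ht)]
    simp only [Complex.ofRealCLM_apply, Complex.ofReal_one, mul_one]
    rw [mul_assoc, ← pow_succ, Nat.sub_add_cancel hj]
  have hid : ∀ t : ℝ, HasDerivAt (fun t : ℝ => (t : ℂ)) 1 t := fun t =>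
    (Complex.ofRealCLM.hasDerivAt (x := t)).congr_deriv (by simp)
  -- The quantities (j g + t g') t^{-j} and (j g - t g') t^j are first integrals of the Euler
  -- equation, and g is recovered from them linearly.
  have dα : ∀ t ∈ Ioo 1 r, HasDerivAt (fun t : ℝ => (j * g t + t * g₁ t) * ((t : ℂ) ^ j)⁻¹) 0 t := by
    intro t ht
    have := (((h1 t ht).const_mul (j : ℂ)).add ((hid t).mul (h2 t ht))).mul
      ((hpow t ht).inv (pow_ne_zero j (ht0 t ht)))
    refine this.congr_deriv ?_
    have h0 := ht0 t ht
    have hx := pow_ne_zero j h0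
    have hode := he t ht
    simp only [Pi.add_apply, Pi.mul_apply, Pi.inv_apply]
    generalize (t : ℂ) ^ j = x at hx ⊢
    field_simp
    linear_combination hode
  have dβ : ∀ t ∈ Ioo 1 r, HasDerivAt (fun t : ℝ => (j * g t - t * g₁ t) * (t : ℂ) ^ j) 0 t := by
    intro t ht
    have := (((h1 t ht).const_mul (j : ℂ)).sub ((hid t).mul (h2 t ht))).mul (hpow t ht)
    refine this.congr_deriv ?_
    have h0 := ht0 t ht
    have hx := pow_ne_zero j h0
    have hode := he t ht
    simp only [Pi.sub_apply, Pi.mul_apply]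
    generalize (t : ℂ) ^ j = x at hx ⊢
    field_simp
    linear_combination (-x) * hode
  obtain ⟨α, hα⟩ := isOpen_Ioo.exists_is_const_of_deriv_eq_zero isPreconnected_Ioo
    (fun t ht => (dα t ht).differentiableAt.differentiableWithinAt) fun t ht => (dα t ht).deriv
  obtain ⟨β, hβ⟩ := isOpen_Ioo.exists_is_const_of_deriv_eq_zero isPreconnected_Ioo
    (fun t ht => (dβ t ht).differentiableAt.differentiableWithinAt) fun t ht => (dβ t ht).deriv
  refine ⟨α / (2 * j), β / (2 * j), fun t ht => ?_⟩
  rw [← hα t ht, ← hβ t ht]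
  have hx := pow_ne_zero j (ht0 t ht)
  field_simp
  ring

/-! ### Boundary values from traces, and the necessity of the bound -/

lemma volume_real_annulus {a b : ℝ} (ha : 0 ≤ a) (hab : a ≤ b) :
    volume.real (annulus a b) = Real.pi * (b ^ 2 - a ^ 2) := by
  have e : annulus a b = Metric.ball 0 b \ Metric.closedBall 0 a := by
    ext z
    simp only [annulus, mem_ofPred_eq, Set.mem_sdiff, mem_ball_zero_iff, mem_closedBall_zero_iff, not_le]
    exact and_comm
  rcases eq_or_lt_of_le hab with rfl | hlt
  · have : annulus a a = ∅ := by
      ext z; simp only [annulus, mem_ofPred_eq, mem_empty_iff_false, iff_false]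
      intro h; linarith [h.1, h.2]
    rw [this]; simp
  · rw [e, measureReal_sdiff (Metric.closedBall_subset_ball hlt) Metric.isClosed_closedBall.measurableSet,
      Measure.real, Measure.real, Complex.volume_ball, Complex.volume_closedBall]
    rw [ENNReal.toReal_mul, ENNReal.toReal_mul, ENNReal.toReal_pow, ENNReal.toReal_pow,
      ENNReal.toReal_ofReal ha, ENNReal.toReal_ofReal (ha.trans hab)]
    simp
    ring

/-- A function with a limit along shrinking sets takes its trace value as the limit. -/
lemma eq_of_trace {E : ℝ → Set ℂ} {p : ℂ → ℝ} {L T m : ℝ} (hm : 0 < m)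
    (hE : ∀ ε, MeasurableSet (E ε)) (hfin : ∀ ε, volume (E ε) ≠ ⊤)
    (hlim : ∀ η, 0 < η → ∀ᶠ ε in 𝓝[>] (0 : ℝ), ∀ z ∈ E ε, |p z - L| ≤ η)
    (hp : ∀ᶠ ε in 𝓝[>] (0 : ℝ), ContinuousOn p (E ε))
    (hvol : ∀ᶠ ε in 𝓝[>] (0 : ℝ), m * ε ≤ volume.real (E ε))
    (h : Tendsto (fun ε : ℝ => ε⁻¹ * ∫ z in E ε, |p z - T|) (𝓝[>] 0) (𝓝 0)) : L = T := by
  by_contra hne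
  have hd : 0 < |L - T| := abs_pos.2 (sub_ne_zero.2 hne)
  -- If the limit differed from the trace value, |p - T| would be at least half the difference on
  -- the whole strip, whose area is at least m ε. The normalized integrals would stay away from
  -- zero.
  have h1 : ∀ᶠ ε in 𝓝[>] (0 : ℝ), m * (|L - T| / 2) ≤ ε⁻¹ * ∫ z in E ε, |p z - T| := by
    filter_upwards [self_mem_nhdsWithin, hlim _ (half_pos hd), hp, hvol] with ε hε h2 h3 h4
    have hε : 0 < ε := hε
    have hlow : ∀ z ∈ E ε, |L - T| / 2 ≤ |p z - T| := fun z hz => by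
      have := abs_sub_abs_le_abs_sub (L - T) (p z - T)
      rw [show L - T - (p z - T) = -(p z - L) by ring, abs_neg] at this
      linarith [h2 z hz]
    have hup : ∀ z ∈ E ε, |p z - T| ≤ |L - T| / 2 + |L - T| := fun z hz => by
      have := abs_add_le (p z - L) (L - T)
      rw [show p z - L + (L - T) = p z - T by ring] at this
      linarith [h2 z hz]
    have hi : IntegrableOn (fun z => |p z - T|) (E ε) := by
      have : IsFiniteMeasure (volume.restrict (E ε)) :=
        ⟨by rw [Measure.restrict_apply_univ]; exact (hfin ε).lt_top⟩
      refine Integrable.of_bound (((h3.sub continuousOn_const).abs).aestronglyMeasurable (hE ε))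
        (|L - T| / 2 + |L - T|) ?_
      filter_upwards [ae_restrict_mem (hE ε)] with z hz
      rw [Real.norm_eq_abs, abs_abs]; exact hup z hz
    have h5 : ∫ z in E ε, |L - T| / 2 ≤ ∫ z in E ε, |p z - T| :=
      setIntegral_mono_on (integrableOn_const (hfin ε)) hi (hE ε) hlow
    rw [setIntegral_const, smul_eq_mul] at h5
    rw [← div_eq_inv_mul, le_div_iff₀ hε]
    calc m * (|L - T| / 2) * ε = m * ε * (|L - T| / 2) := by ring
      _ ≤ volume.real (E ε) * (|L - T| / 2) := mul_le_mul_of_nonneg_right h4 (by linarith)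
      _ ≤ _ := h5
  have := ge_of_tendsto h h1
  have h6 : 0 < m * (|L - T| / 2) := by positivity
  linarith

lemma volume_annulus_ne_top (a b : ℝ) : volume (annulus a b) ≠ ⊤ :=
  ((measure_mono (annulus_subset_ball a b)).trans_lt measure_ball_lt_top).ne

namespace IsRadialHarmonicMap

variable {j : ℕ} {r R : ℝ} {f : ℂ → ℂ}

/-- The radial profile of a radial harmonic map. -/
lemma exists_profile (hj : 1 ≤ j) (h : IsRadialHarmonicMap j r R f) :
    ∃ a b : ℝ, ∀ t ∈ Ioo 1 r, 0 < harmonicProfile j a b t ∧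
      ∀ τ : ℝ, f (t * Complex.exp (τ * Complex.I))
        = harmonicProfile j a b t * Complex.exp (j * τ * Complex.I) := by
  obtain ⟨G, hG⟩ := h.radial
  have hfG : ∀ t ∈ Ioo 1 r, f t = G t := fun t ht => by
    simpa using (hG t ht.1 ht.2).2 0
  have hmem : ∀ t ∈ Ioo 1 r, (t : ℂ) ∈ annulus 1 r := fun t ht => by
    have : ‖(t : ℂ)‖ = t := by
      rw [Complex.norm_real, Real.norm_eq_abs, abs_of_pos (by linarith [ht.1])]
    exact ⟨by rw [this]; exact ht.1, by rw [this]; exact ht.2⟩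
  have hC2 : ∀ t ∈ Ioo 1 r, ContDiffAt ℝ 2 f (t : ℂ) := fun t ht => (h.harmonic _ (hmem t ht)).1
  have hid : ∀ t : ℝ, HasDerivAt (fun t : ℝ => (t : ℂ)) 1 t := fun t =>
    (Complex.ofRealCLM.hasDerivAt (x := t)).congr_deriv (by simp)
  obtain ⟨a, b, hab⟩ := eq_of_euler hj (r := r) (g := fun t => f t) (g₁ := fun t => fderiv ℝ f t 1)
    (g₂ := fun t => fderiv ℝ (fderiv ℝ f) t 1 1)
    (fun t ht => ((hC2 t ht).differentiableAt two_ne_zero).hasFDerivAt.comp_hasDerivAt t (hid t))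
    (fun t ht => by
      have h1 := (((hC2 t ht).fderiv_right (m := 1) (by norm_num)).differentiableAt
        one_ne_zero).hasFDerivAt.comp_hasDerivAt t (hid t)
      have h2 := h1.clm_apply (hasDerivAt_const t (1 : ℂ))
      simpa using h2)
    (fun t ht => euler_of_harmonicAt (h.harmonic _ (hmem t ht)) fun s => by
      rw [(hG t ht.1 ht.2).2 s, hfG t ht])
  -- The Euler equation yields complex coefficients; the profile being real, their real parts
  -- suffice.
  have hGp : ∀ t ∈ Ioo 1 r, G t = harmonicProfile j a.re b.re t := by
    intro t ht
    have h1 := hab t ht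
    simp only [hfG t ht] at h1
    have h2 := congrArg Complex.re h1
    rw [← Complex.ofReal_pow, ← Complex.ofReal_inv, Complex.ofReal_re, Complex.add_re,
      Complex.re_mul_ofReal, Complex.re_mul_ofReal] at h2
    exact h2
  exact ⟨a.re, b.re, fun t ht => hGp t ht ▸ hG t ht.1 ht.2⟩

lemma eq_radialMap {a b : ℝ} (h : ∀ t ∈ Ioo 1 r, ∀ τ : ℝ, f (t * Complex.exp (τ * Complex.I))
    = harmonicProfile j a b t * Complex.exp (j * τ * Complex.I)) {z : ℂ} (hz : z ∈ annulus 1 r) :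
    f z = radialMap j (harmonicProfile j a b) z := by
  have hz0 : (‖z‖ : ℂ) ≠ 0 := Complex.ofReal_ne_zero.2 (by linarith [hz.1])
  have h1 := h ‖z‖ hz (Complex.arg z)
  have h2 := Complex.norm_mul_exp_arg_mul_I z
  rw [h2] at h1
  have h3 : z / ‖z‖ = Complex.exp (Complex.arg z * Complex.I) := by
    rw [div_eq_iff hz0, mul_comm]; exact h2.symm
  rw [h1, radialMap, h3, ← Complex.exp_nat_mul]
  congr 2; ring

/-- Radial harmonic maps exist only under the Nitsche bound, and are unique. -/
theorem nitscheBound_and_eqOn (hj : 1 ≤ j) (hr : 1 < r) (h : IsRadialHarmonicMap j r R f) :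
    NitscheBound j r R ∧ EqOn f (gCirc j r R) (annulus 1 r) := by
  obtain ⟨a, b, hab⟩ := h.exists_profile hj
  set G := harmonicProfile j a b with hG
  have hfz : ∀ z ∈ annulus 1 r, f z = radialMap j G z := fun z hz => eq_radialMap (fun t ht => (hab t ht).2) hz
  have hnorm : ∀ z ∈ annulus 1 r, ‖f z‖ = G ‖z‖ := fun z hz => by
    rw [hfz z hz, norm_radialMap j G (norm_pos_iff.1 (by linarith [hz.1])), abs_of_pos (hab _ hz).1]
  have hcf : ContinuousOn (fun z => ‖f z‖) (annulus 1 r) :=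
    h.harmonic.continuousOn.norm
  have hGc : ∀ t, 0 < t → ContinuousAt G t := fun t ht => (hasDerivAt_harmonicProfile j a b ht).continuousAt
  have hclose : ∀ t₀, 0 < t₀ → ∀ η, 0 < η → ∃ δ > 0, ∀ t, |t - t₀| < δ → |G t - G t₀| ≤ η := by
    intro t₀ ht₀ η hη
    obtain ⟨δ, hδ, h1⟩ := Metric.continuousAt_iff.1 (hGc t₀ ht₀) η hη
    exact ⟨δ, hδ, fun t ht => (h1 ht).le⟩
  -- The explicit profile is continuous on (0, ∞), so the conditions in the mean determine its
  -- values at t = 1 and t = r, and with them both coefficients.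
  have hG1 : G 1 = 1 := by
    refine eq_of_trace (E := fun ε => annulus 1 (1 + ε)) (p := fun z => ‖f z‖) (m := Real.pi)
      Real.pi_pos (fun ε => measurableSet_annulus _ _) (fun ε => volume_annulus_ne_top _ _) ?_ ?_ ?_ h.inner
    · intro η hη
      obtain ⟨δ, hδ, h1⟩ := hclose 1 one_pos η hη
      filter_upwards [nhdsWithin_le_nhds (Iio_mem_nhds hδ),
        nhdsWithin_le_nhds (Iio_mem_nhds (sub_pos.2 hr))] with ε hε hε2 z hz
      have hε : ε < δ := hε
      have hε2 : ε < r - 1 := hε2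
      have hzz : z ∈ annulus 1 r := ⟨hz.1, by linarith [hz.2]⟩
      rw [hnorm z hzz]
      refine h1 _ ?_
      rw [abs_of_pos (by linarith [hz.1])]; linarith [hz.2]
    · filter_upwards [nhdsWithin_le_nhds (Iio_mem_nhds (sub_pos.2 hr))] with ε hε2
      have hε2 : ε < r - 1 := hε2
      exact hcf.mono fun z hz => ⟨hz.1, by linarith [hz.2]⟩
    · filter_upwards [self_mem_nhdsWithin] with ε hε
      have hε : 0 < ε := hε
      rw [volume_real_annulus zero_le_one (by linarith)]
      exact mul_le_mul_of_nonneg_left (by nlinarith) Real.pi_pos.le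
  have hGr : G r = R := by
    refine eq_of_trace (E := fun ε => annulus (r - ε) r) (p := fun z => ‖f z‖) (m := Real.pi)
      Real.pi_pos (fun ε => measurableSet_annulus _ _) (fun ε => volume_annulus_ne_top _ _) ?_ ?_ ?_ h.outer
    · intro η hη
      obtain ⟨δ, hδ, h1⟩ := hclose r (by linarith) η hη
      filter_upwards [nhdsWithin_le_nhds (Iio_mem_nhds hδ),
        nhdsWithin_le_nhds (Iio_mem_nhds (sub_pos.2 hr))] with ε hε hε2 z hz
      have hε : ε < δ := hε
      have hε2 : ε < r - 1 := hε2
      have hzz : z ∈ annulus 1 r := ⟨by linarith [hz.1], hz.2⟩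
      rw [hnorm z hzz]
      refine h1 _ ?_
      rw [abs_of_neg (by linarith [hz.2])]; linarith [hz.1]
    · filter_upwards [nhdsWithin_le_nhds (Iio_mem_nhds (sub_pos.2 hr))] with ε hε2
      have hε2 : ε < r - 1 := hε2
      exact hcf.mono fun z hz => ⟨by linarith [hz.1], hz.2⟩
    · filter_upwards [self_mem_nhdsWithin,
        nhdsWithin_le_nhds (Iio_mem_nhds (sub_pos.2 hr))] with ε hε hε2
      have hε : 0 < ε := hε
      have hε2 : ε < r - 1 := hε2
      rw [volume_real_annulus (by linarith) (by linarith)]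
      exact mul_le_mul_of_nonneg_left (by nlinarith) Real.pi_pos.le
  have hb : b = 1 - a := by
    have : a + b = 1 := by simpa [hG, harmonicProfile] using hG1
    linarith
  have hx : 1 < r ^ j := one_lt_pow₀ hr (by omega)
  have hne : 1 - (r ^ j) ^ 2 ≠ 0 := by nlinarith
  have ha : a = (1 - r ^ j * R) / (1 - r ^ (2 * j)) := by
    rw [pow_mul', eq_div_iff hne]
    rw [hG, hb, harmonicProfile] at hGr
    have h0 : r ^ j ≠ 0 := by linarith
    field_simp at hGr
    linear_combination -hGr
  have hb' : b = (r ^ j * R - r ^ (2 * j)) / (1 - r ^ (2 * j)) := by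
    rw [hb, ha, pow_mul']; field_simp; ring
  constructor
  · rw [← one_sub_coeff_le_iff hj hr, ← ha]
    -- As the image lies in the target annulus, the profile exceeds 1 in the interior. The
    -- factorization of G - 1 turns this into a sign condition, whose limit as t decreases to 1 is 1
    -- - a ≤ a.
    have hgt : ∀ t ∈ Ioo 1 r, 0 ≤ a * t ^ j - (1 - a) := by
      intro t ht
      have hmem : (t : ℂ) ∈ annulus 1 r := by
        have : ‖(t : ℂ)‖ = t := by
          rw [Complex.norm_real, Real.norm_eq_abs, abs_of_pos (by linarith [ht.1])]
        exact ⟨by rw [this]; exact ht.1, by rw [this]; exact ht.2⟩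
      have h1 : f t ∈ annulus 1 R := h.onto ▸ mem_image_of_mem f hmem
      have h2 : 1 < G t := by
        have := h1.1
        rw [hnorm _ hmem, Complex.norm_real, Real.norm_eq_abs, abs_of_pos (by linarith [ht.1])] at this
        exact this
      have ht1 : 1 < t ^ j := one_lt_pow₀ ht.1 (by omega)
      have h3 := harmonicProfile_sub_one (j := j) (a := a) (t := t) (by linarith [ht.1])
      rw [← hb, ← hG] at h3
      have h4 : 0 < (t ^ j - 1) * (a * t ^ j - b) / t ^ j := by linarith
      rw [← hb]
      by_contra hn
      have : (t ^ j - 1) * (a * t ^ j - b) / t ^ j ≤ 0 :=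
        div_nonpos_of_nonpos_of_nonneg
          (mul_nonpos_of_nonneg_of_nonpos (by linarith) (by linarith)) (by linarith)
      linarith
    have hlim : Tendsto (fun t : ℝ => a * t ^ j - (1 - a)) (𝓝[>] 1) (𝓝 (a * 1 ^ j - (1 - a))) := by
      have : Continuous fun t : ℝ => a * t ^ j - (1 - a) := by fun_prop
      exact (this.tendsto 1).mono_left nhdsWithin_le_nhds
    have := ge_of_tendsto hlim (by
      filter_upwards [Ioo_mem_nhdsGT hr] with t ht using hgt t ht)
    rw [one_pow] at this
    linarith
  · intro z hz
    rw [hfz z hz, gCirc_eq_radialMap j hj, ← ha, ← hb']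

end IsRadialHarmonicMap

lemma isRadialHarmonicMap_gCirc {j : ℕ} (hj : 1 ≤ j) {r R : ℝ} (hr : 1 < r) (hR : 1 < R)
    (hN : NitscheBound j r R) : IsRadialHarmonicMap j r R (gCirc j r R) := by
  obtain ⟨a, c, ha0, ha, hg, hp⟩ := radialProfile_gCirc hj hr hR hN
  refine ⟨⟨harmonicProfile j a (1 - a), fun t ht htr => ⟨?_, fun τ => ?_⟩⟩, fun z hz => ?_, ?_, ?_, ?_⟩
  · linarith [hp.lower t ⟨ht.le, htr.le⟩]
  · have hn : ‖(t : ℂ) * Complex.exp (τ * Complex.I)‖ = t := by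
      rw [norm_mul, Complex.norm_exp_ofReal_mul_I, mul_one, Complex.norm_real, Real.norm_eq_abs,
        abs_of_pos (by linarith)]
    have ht0 : (t : ℂ) ≠ 0 := Complex.ofReal_ne_zero.2 (by linarith)
    rw [hg, radialMap, hn, mul_div_cancel_left₀ _ ht0, ← Complex.exp_nat_mul]
    congr 2; ring
  · have := harmonicAt_combination (j := j) one_ne_zero (hp.ne_zero_of_mem hz)
      ((1 - r ^ j * R) / (1 - r ^ (2 * j))) ((r ^ j * R - r ^ (2 * j)) / (1 - r ^ (2 * j)))
    simp only [one_mul] at this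
    exact this
  · rw [hg]
    exact radialMap_image_annulus hj zero_le_one zero_le_one
      (hp.image_Ioo le_rfl hr hp.left fun t ht => one_lt_harmonicProfile hj ha0 ha ht.1)
  · rw [hg]; exact hp.innerToInner
  · rw [hg]; exact hp.outerToOuter

/-- On this open annulus ρ|w| > 1, so near each of its points only the first branch of g⋄ occurs. No
claim is made across the circle |z| = 1/ρ. -/
lemma harmonicOnNhd_gDiamondScaled {j : ℕ} (hj : 1 ≤ j) {r R : ℝ} (hr : 1 < r) (hR : 1 < R) :
    InnerProductSpace.HarmonicOnNhd (gDiamondScaled j r R) (annulus (r / critRadius j R) r) := by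
  obtain ⟨h1, -⟩ := one_lt_critRadius hj hR
  have hc0 : 0 < critRadius j R := by linarith
  have hρ0 : 0 < critRadius j R / r := div_pos hc0 (by linarith)
  have hρc : ((critRadius j R / r : ℝ) : ℂ) ≠ 0 := Complex.ofReal_ne_zero.2 hρ0.ne'
  intro z hz
  have hz0 : z ≠ 0 := norm_pos_iff.1 (lt_trans (div_pos (by linarith) hc0) hz.1)
  refine (InnerProductSpace.harmonicAt_congr_nhds ?_).2 (harmonicAt_combination (j := j) hρc hz0
    ((1 - critRadius j R ^ j * R) / (1 - critRadius j R ^ (2 * j)))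
    ((critRadius j R ^ j * R - critRadius j R ^ (2 * j)) / (1 - critRadius j R ^ (2 * j))))
  filter_upwards [(isOpen_annulus _ _).mem_nhds hz] with w hw
  have : 1 ≤ ‖((critRadius j R / r : ℝ) : ℂ) * w‖ := by
    rw [norm_mul, Complex.norm_real, Real.norm_eq_abs, abs_of_pos hρ0, div_mul_eq_mul_div,
      le_div_iff₀ (by linarith), one_mul, mul_comm]
    exact ((div_lt_iff₀ hc0).1 hw.1).le
  rw [gDiamondScaled, gDiamond, if_pos this, gCirc]

/-! ### The theorem -/

theorem theorem1p1 (j : ℕ) (hj : 1 ≤ j) (r R : ℝ) (hr : 1 < r) (hR : 1 < R) :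
    ((∃ f : ℂ → ℂ, IsRadialHarmonicMap j r R f) ↔ NitscheBound j r R) ∧
    (NitscheBound j r R →
      IsRadialHarmonicMap j r R (gCirc j r R) ∧
      (∀ f : ℂ → ℂ, IsRadialHarmonicMap j r R f → EqOn f (gCirc j r R) (annulus 1 r)) ∧
      IsBoundaryOnto r R (gCirc j r R) ∧
      HasRegularDegree (annulus 1 r) (annulus 1 R) (gCirc j r R) j ∧
      HasSobolevDegree (annulus 1 r) (annulus 1 R) (gCirc j r R) j ∧
      IsUniqueMinimizer j r R (gCirc j r R)) ∧
    (¬ NitscheBound j r R →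
      (1 < r / critRadius j R ∧ r / critRadius j R < r) ∧
      InnerProductSpace.HarmonicOnNhd (gDiamondScaled j r R) (annulus (r / critRadius j R) r) ∧
      gDiamondScaled j r R '' annulus (r / critRadius j R) r = annulus 1 R ∧
      (∀ z : ℂ, 1 < ‖z‖ → ‖z‖ ≤ r / critRadius j R →
        gDiamondScaled j r R z = z ^ j / (‖z‖ : ℂ) ^ j) ∧
      IsBoundaryOnto r R (gDiamondScaled j r R) ∧
      HasRegularDegree (annulus 1 r) (annulus 1 R) (gDiamondScaled j r R) j ∧
      HasSobolevDegree (annulus 1 r) (annulus 1 R) (gDiamondScaled j r R) j ∧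
      IsUniqueMinimizer j r R (gDiamondScaled j r R)) := by
  refine ⟨⟨fun ⟨f, hf⟩ => (hf.nitscheBound_and_eqOn hj hr).1,
    fun hN => ⟨_, isRadialHarmonicMap_gCirc hj hr hR hN⟩⟩, fun hN => ?_, fun hN => ?_⟩
  · refine ⟨isRadialHarmonicMap_gCirc hj hr hR hN,
      fun f hf => (hf.nitscheBound_and_eqOn hj hr).2, ?_⟩
    obtain ⟨a, c, -, -, hg, hp⟩ := radialProfile_gCirc hj hr hR hN
    rw [hg]
    exact ⟨hp.isBoundaryOnto, hp.hasRegularDegree, hp.hasSobolevDegree, hp.isUniqueMinimizer⟩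
  · have hp := radialProfile_squeezed hj hr hR hN
    have h1 := (one_lt_critRadius hj hR).1
    have h2 := critRadius_lt hj hr hR hN
    have hc0 : 0 < critRadius j R := by linarith
    have hr0 : 0 < r := by linarith
    have hlt : 1 < r / critRadius j R := (one_lt_div hc0).2 h2
    have hlt' : r / critRadius j R < r := div_lt_self hr0 h1
    have hρ : critRadius j R / r * (r / critRadius j R) = 1 := by
      rw [← inv_div r, inv_mul_cancel₀ (div_pos hr0 hc0).ne']
    have hρ0 : 0 < critRadius j R / r := div_pos hc0 hr0
    have hone : ∀ t ≤ r / critRadius j R, squeezedProfile j (critRadius j R / r) t = 1 := by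
      intro t ht
      have : critRadius j R / r * t ≤ 1 := hρ ▸ mul_le_mul_of_nonneg_left ht hρ0.le
      rw [squeezedProfile, max_eq_left this]
      norm_num [harmonicProfile]
    refine ⟨⟨hlt, hlt'⟩, harmonicOnNhd_gDiamondScaled hj hr hR, ?_⟩
    rw [gDiamondScaled_eq_radialMap hj hr hR]
    refine ⟨?_, fun z _ hz => ?_, hp.isBoundaryOnto, hp.hasRegularDegree, hp.hasSobolevDegree,
      hp.isUniqueMinimizer⟩
    · refine radialMap_image_annulus hj (by linarith) zero_le_one
        (hp.image_Ioo hlt.le hlt' (hone _ le_rfl) fun t ht => ?_)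
      have : 1 < critRadius j R / r * t := hρ ▸ mul_lt_mul_of_pos_left ht.1 hρ0
      rw [squeezedProfile, max_eq_right this.le]
      have h3 := one_lt_harmonicProfile hj (a := 1 / 2) (by norm_num) (by norm_num) this
      rwa [← half_eq_one_sub_half] at h3
    · rw [radialMap, hone _ hz, Complex.ofReal_one, one_mul, div_pow]

end
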